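/- Let $k$ be a field, let $Q$ be a finite quiver with vertex set $Q_0$ and arrow set $Q_1$, and let $Q_n$ be the set of paths of length $n$. Two paths are parallel, written $\gamma\parallel\gamma'$, if they have the same source and the same end; for sets $X,Y$ of paths, $X\parallel Y=\{(\gamma,\gamma')\in X\times Y:\gamma\parallel\gamma'\}$, and $k(X\parallel Y)$ is the vector space with this basis. Put $$C^n(Q)=k(Q_n\parallel Q_0)\oplus k(Q_n\parallel Q_1)=k(Q_n\parallel Q_0\cup Q_1),\qquad C^{*+1}(Q)=\bigoplus_{n\ge1}C^n(Q),$$ where elements of $C^n(Q)$ have degree $n-1$. For basis elements $(\alpha,x)\in Q_n\parallel Q_0\cup Q_1$, $\alpha=a_1\cdots a_n$, and $(\beta,y)\in Q_m\parallel Q_0\cup Q_1$ with $n,m\ge1$, and for $1\le i\le n$, let $(\alpha,x)\circ_i(\beta,y)=(a_1\cdots a_{i-1}\,\beta\,a_{i+1}\cdots a_n,\;x)$ if $a_i=y$, and $0$ otherwise. Extend this bilinearly, and for $f\in C^n(Q)$, $g\in C^m(Q)$ put $$f\circ g=\sum_{i=1}^n(-1)^{(i-1)(m-1)}f\circ_i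 g,\qquad [f,g]_Q=f\circ g-(-1)^{(n-1)(m-1)}g\circ f .$$ Let $A=kQ/\langle Q_2\rangle$, where $\langle Q_2\rangle$ is the two-sided ideal generated by the paths of length two. Then $A=E\oplus r$ with $E=kQ_0$ and $r=kQ_1$ (the Jacobson radical of $A$); let $\pi:A\to r$ be the projection along $E$. Let $C^n(A,A)=\mathrm{Hom}_k(A^{\otimes n},A)$ with the Hochschild differential $\delta$ and cohomology $HH^n(A)$. For $f\in C^n(A,A)$, $g\in C^m(A,A)$, $n,m\ge 1$, let $f\circ_i g$ be the insertion of $g$ in the $i$-th place of $f$, that is $$(f\circ_i g)(x_1,\dots,x_{n+m-1})=f(x_1,\dots,x_{i-1},g(x_i,\dots,x_{i+m-1}),x_{i+m},\dots,x_{n+m-1}),$$ and let the Gerstenhaber bracket $[f,g]$ be given by the same formulas for $f\circ g$ and for the bracket as above. Let $C^n_E(r,A)=\mathrm{Hom}_{E^e}(r^{\otimes_E n},A)$ be the reduced cochains (for $n=0$: the elements of $A$ that commute with $E$), and let the reduced bracket $[f,g]_R$ be given by the same formulas, with $\pi g$ in place of $g$ in the insertion $f\circ_i g$. Let $p^n:C^n_E(r,A)\to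 C^n(A,A)$, $(p^nf)(x_1,\dots,x_n)=f(\pi x_1,\dots,\pi x_n)$. Make $C^\bullet(Q)=(C^n(Q))_{n\ge0}$ a complex with the differential $D$ that is zero on $k(Q_n\parallel Q_1)$ and is given on $k(Q_n\parallel Q_0)$ by $$D(\gamma,e)=\sum_{a}(a\gamma,a)+(-1)^{n+1}\sum_{a}(\gamma a,a)\in k(Q_{n+1}\parallel Q_1),$$ where the sums are over the arrows $a$ for which $a\gamma$, respectively $\gamma a$, is a path. A graded Lie algebra is a graded vector space $L=\bigoplus_{d\ge0}L_d$ with a bilinear bracket $L_d\times L_{d'}\to L_{d+d'}$ such that, for homogeneous $u,v,w$, $[u,v]=-(-1)^{|u||v|}[v,u]$ and $[u,[v,w]]=[[u,v],w]+(-1)^{|u||v|}[v,[u,w]]$, and moreover (automatic if $2$ and $3$ are invertible in $k$) $[u,u]=0$ for $|u|$ even and $[u,[u,u]]=0$ for $|u|$ odd. Then: 1. $C^{*+1}(Q)$ with the bracket $[-,-]_Q$ is a graded Lie algebra. 2. $C^{*+1}_E(r,A)=\bigoplus_{n\ge1}C^n_E(r,A)$ with the reduced bracket is a graded Lie algebra.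 There are linear isomorphisms $\Phi^n:C^n(Q)\to C^n_E(r,A)$, $n\ge0$, where $\Phi^n(\gamma,x)$ sends arrows $(a_1,\dots,a_n)$ to $x$ if $\gamma=a_1\cdots a_n$ and to $0$ otherwise, and $\Phi([f,g]_Q)=[\Phi f,\Phi g]_R$ for $f\in C^n(Q)$, $g\in C^m(Q)$, $n,m\ge1$. So the graded Lie algebras $C^{*+1}(Q)$ and $C^{*+1}_E(r,A)$ are isomorphic. 3. The graded Lie algebra structure on $HH^{*+1}(A)$ given by the Gerstenhaber bracket is induced by the one on $C^{*+1}(Q)$: the maps $p^n\Phi^n$ form a morphism of complexes $C^\bullet(Q)\to C^\bullet(A,A)$ which induces isomorphisms $H^n(C^\bullet(Q))\cong HH^n(A)$ for all $n\ge0$; the bracket $[-,-]_Q$ induces a graded Lie algebra structure on $H^{*+1}(C^\bullet(Q))$, the Gerstenhaber bracket induces one on $HH^{*+1}(A)$, and these isomorphisms identify the two. -/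

import Mathlib

universe u v w

namespace RadSq

/-! ### Graded Lie algebras -/

section Graded

variable (k : Type w) [CommRing k] (L : ℕ → Type*) [∀ n, AddCommGroup (L n)] [∀ n, Module k (L n)]

/-- The graded commutator `[x, y] = x ∘ y - (-1)^{|x||y|} y ∘ x` of a graded operation `∘`, where
elements of `L n` have degree `n`. -/
noncomputable def gradedCommutator {k : Type w} [CommRing k] {L : ℕ → Type*}
    [∀ n, AddCommGroup (L n)] [∀ n, Module k (L n)]
    (circ : ∀ n m N : ℕ, n + m = N → (L n →ₗ[k] L m →ₗ[k] L N)) (n m : ℕ) :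
    L n →ₗ[k] L m →ₗ[k] L (n + m) :=
  circ n m (n + m) rfl - ((-1 : k) ^ (n * m)) • (circ m n (n + m) (Nat.add_comm m n)).flip

/-- The graded vector space `⨁ n, L n` with the degree preserving bracket whose homogeneous
components are `b n m : L n × L m → L (n + m)` is a graded Lie algebra: the bracket is graded
antisymmetric and satisfies the graded Jacobi identity. The equations are read in `⨁ n, L n`.
The last two conditions follow from the first two if `2` and `3` are invertible; they belong to the
definition over a field of arbitrary characteristic. -/
structure IsGradedLie (b : ∀ n m : ℕ, L n →ₗ[k] L m →ₗ[k] L (n + m)) : Prop where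
  antisymm : ∀ (n m : ℕ) (x : L n) (y : L m),
    DirectSum.lof k ℕ L (n + m) (b n m x y) =
      -((-1 : k) ^ (n * m) • DirectSum.lof k ℕ L (m + n) (b m n y x))
  jacobi : ∀ (n m l : ℕ) (x : L n) (y : L m) (z : L l),
    DirectSum.lof k ℕ L (n + (m + l)) (b n (m + l) x (b m l y z)) =
      DirectSum.lof k ℕ L (n + m + l) (b (n + m) l (b n m x y) z) +
        (-1 : k) ^ (n * m) • DirectSum.lof k ℕ L (m + (n + l)) (b m (n + l) y (b n l x z))
  even_self : ∀ (n : ℕ) (x : L n), Even n → b n n x x = 0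
  odd_self : ∀ (n : ℕ) (x : L n), Odd n → b n (n + n) x (b n n x x) = 0

end Graded

/-! ### Cohomology of a cochain complex given by its spaces and its differentials -/

section Cohomology

variable {k : Type w} [CommRing k] {C : ℕ → Type*} [∀ n, AddCommGroup (C n)] [∀ n, Module k (C n)]
  (d : ∀ n, C n →ₗ[k] C (n + 1))

/-- The `n`-cocycles. -/
def cocycles (n : ℕ) : Submodule k (C n) := LinearMap.ker (d n)

/-- The `n`-coboundaries; they are zero for `n = 0`. -/
def coboundaries : ∀ n : ℕ, Submodule k (C n)
  | 0 => ⊥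
  | n + 1 => LinearMap.range (d n)

/-- The `n`-th cohomology, cocycles modulo coboundaries. -/
abbrev Cohomology (n : ℕ) : Type _ := ↥(cocycles d n) ⧸ (coboundaries d n).submoduleOf (cocycles d n)

/-- The cohomology class of a cocycle. -/
def cohomologyClass (n : ℕ) (z : C n) (hz : z ∈ cocycles d n) : Cohomology d n :=
  Submodule.Quotient.mk ⟨z, hz⟩

/-- `B` is the operation induced on the cohomology in degrees `≥ 1` by the operation `b` on
cochains: the bracket of two cocycles is a cocycle and `B` sends the classes of two cocycles to the
class of their bracket. Elements of `C (n + 1)` have degree `n` here. -/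
def IsInducedBracket (b : ∀ n m : ℕ, C (n + 1) →ₗ[k] C (m + 1) →ₗ[k] C (n + m + 1))
    (B : ∀ n m : ℕ, Cohomology d (n + 1) →ₗ[k] Cohomology d (m + 1) →ₗ[k] Cohomology d (n + m + 1)) :
    Prop :=
  ∀ (n m : ℕ) (x : C (n + 1)) (y : C (m + 1))
    (hx : x ∈ cocycles d (n + 1)) (hy : y ∈ cocycles d (m + 1)),
    ∃ hxy : b n m x y ∈ cocycles d (n + m + 1),
      B n m (cohomologyClass d (n + 1) x hx) (cohomologyClass d (m + 1) y hy) =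
        cohomologyClass d (n + m + 1) (b n m x y) hxy

end Cohomology

/-! ### Insertion of a multilinear map into another one -/

section Insertion

variable {n m N : ℕ} {M : Type*}

/-- For `x = (x_0, …, x_N)` with `N = n + m`, the vector
`(x_0, …, x_{i-1}, u, x_{i+m+1}, …, x_N)` of length `n + 1`. -/
def insertVec (h : n + m = N) (x : Fin (N + 1) → M) (i : Fin (n + 1)) (t : M) : Fin (n + 1) → M :=
  fun l => if l.val < i.val then x ⟨l.val, by omega⟩
    else if l.val = i.val then t else x ⟨l.val + m, by omega⟩

/-- The block `(x_i, …, x_{i+m})` of `x = (x_0, …, x_N)`, with `N = n + m`. -/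
def block (h : n + m = N) (x : Fin (N + 1) → M) (i : Fin (n + 1)) : Fin (m + 1) → M :=
  fun j => x ⟨i.val + j.val, by omega⟩

lemma insertVec_eq_update (h : n + m = N) (x : Fin (N + 1) → M) (i : Fin (n + 1)) (s t : M) :
    insertVec h x i t = Function.update (insertVec h x i s) i t := by
  funext l
  by_cases hl : l = i
  · subst hl; simp [insertVec]
  · have : l.val ≠ i.val := fun e => hl (Fin.ext e)
    simp [insertVec, hl, this]

lemma block_update_left (h : n + m = N) (x : Fin (N + 1) → M) (i : Fin (n + 1)) (j : Fin (N + 1))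
    (v : M) (hj : j.val < i.val) : block h (Function.update x j v) i = block h x i := by
  funext l
  have : (⟨i.val + l.val, by omega⟩ : Fin (N + 1)) ≠ j := fun e => by
    have := congrArg Fin.val e; simp at this; omega
  simp [block, Function.update_of_ne this]

lemma block_update_right (h : n + m = N) (x : Fin (N + 1) → M) (i : Fin (n + 1)) (j : Fin (N + 1))
    (v : M) (hj : i.val + m < j.val) : block h (Function.update x j v) i = block h x i := by
  funext l
  have : (⟨i.val + l.val, by omega⟩ : Fin (N + 1)) ≠ j := fun e => by
    have := congrArg Fin.val e; simp at this; omega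
  simp [block, Function.update_of_ne this]

lemma block_update_mid (h : n + m = N) (x : Fin (N + 1) → M) (i : Fin (n + 1)) (j : Fin (N + 1))
    (v : M) (hj : i.val ≤ j.val) (hj' : j.val ≤ i.val + m) :
    block h (Function.update x j v) i =
      Function.update (block h x i) ⟨j.val - i.val, by omega⟩ v := by
  funext l
  by_cases hl : l.val = j.val - i.val
  · have h1 : (⟨i.val + l.val, by omega⟩ : Fin (N + 1)) = j := Fin.ext (by simp; omega)
    have h2 : l = ⟨j.val - i.val, by omega⟩ := Fin.ext hl
    rw [← h2]
    simp [block, h1]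
  · have h1 : (⟨i.val + l.val, by omega⟩ : Fin (N + 1)) ≠ j := fun e => by
      have := congrArg Fin.val e; simp at this; omega
    have h2 : l ≠ ⟨j.val - i.val, by omega⟩ := fun e => hl (congrArg Fin.val e)
    simp [block, h1, h2]

lemma insertVec_update_mid (h : n + m = N) (x : Fin (N + 1) → M) (i : Fin (n + 1))
    (j : Fin (N + 1)) (v t : M) (hj : i.val ≤ j.val) (hj' : j.val ≤ i.val + m) :
    insertVec h (Function.update x j v) i t = insertVec h x i t := by
  funext l
  unfold insertVec
  split_ifs with h1 h2
  · exact Function.update_of_ne (fun e => by have := congrArg Fin.val e; simp at this; omega) _ _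
  · rfl
  · exact Function.update_of_ne (fun e => by have := congrArg Fin.val e; simp at this; omega) _ _

lemma insertVec_update_left (h : n + m = N) (x : Fin (N + 1) → M) (i : Fin (n + 1))
    (j : Fin (N + 1)) (v t : M) (hj : j.val < i.val) :
    insertVec h (Function.update x j v) i t =
      Function.update (insertVec h x i t) ⟨j.val, by omega⟩ v := by
  funext l
  by_cases hl : l.val = j.val
  · have h2 : l = ⟨j.val, by omega⟩ := Fin.ext hl
    have h1 : (⟨l.val, by omega⟩ : Fin (N + 1)) = j := Fin.ext hl
    rw [← h2, Function.update_self]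
    unfold insertVec
    rw [if_pos (by omega), h1, Function.update_self]
  · have h2 : l ≠ ⟨j.val, by omega⟩ := fun e => hl (congrArg Fin.val e)
    rw [Function.update_of_ne h2]
    unfold insertVec
    split_ifs with h3 h4
    · exact Function.update_of_ne (fun e => by have := congrArg Fin.val e; simp at this; omega) _ _
    · rfl
    · exact Function.update_of_ne (fun e => by have := congrArg Fin.val e; simp at this; omega) _ _

lemma insertVec_update_right (h : n + m = N) (x : Fin (N + 1) → M) (i : Fin (n + 1))
    (j : Fin (N + 1)) (v t : M) (hj : i.val + m < j.val) :
    insertVec h (Function.update x j v) i t =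
      Function.update (insertVec h x i t) ⟨j.val - m, by omega⟩ v := by
  funext l
  by_cases hl : l.val = j.val - m
  · have h2 : l = ⟨j.val - m, by omega⟩ := Fin.ext hl
    have h1 : (⟨l.val + m, by omega⟩ : Fin (N + 1)) = j := Fin.ext (by simp; omega)
    rw [← h2, Function.update_self]
    unfold insertVec
    rw [if_neg (by omega), if_neg (by omega), h1, Function.update_self]
  · have h2 : l ≠ ⟨j.val - m, by omega⟩ := fun e => hl (congrArg Fin.val e)
    rw [Function.update_of_ne h2]
    unfold insertVec
    split_ifs with h3 h4
    · exact Function.update_of_ne (fun e => by have := congrArg Fin.val e; simp at this; omega) _ _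
    · rfl
    · exact Function.update_of_ne (fun e => by have := congrArg Fin.val e; simp at this; omega) _ _

lemma insertVec_apply_left (h : n + m = N) (x : Fin (N + 1) → M) (i : Fin (n + 1)) (t : M)
    (l : Fin (n + 1)) (hl : l.val < i.val) : insertVec h x i t l = x ⟨l.val, by omega⟩ := if_pos hl

lemma insertVec_apply_self (h : n + m = N) (x : Fin (N + 1) → M) (i : Fin (n + 1)) (t : M) :
    insertVec h x i t i = t := by simp [insertVec]

lemma insertVec_apply_right (h : n + m = N) (x : Fin (N + 1) → M) (i : Fin (n + 1)) (t : M)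
    (l : Fin (n + 1)) (hl : i.val < l.val) : insertVec h x i t l = x ⟨l.val + m, by omega⟩ := by
  unfold insertVec
  rw [if_neg (by omega), if_neg (by omega)]

variable {k : Type*} [CommRing k] [AddCommGroup M] [Module k M]
  {P : Type*} [AddCommGroup P] [Module k P]

lemma map_insertVec_add (h : n + m = N) (f : MultilinearMap k (fun _ : Fin (n + 1) => M) P)
    (x : Fin (N + 1) → M) (i : Fin (n + 1)) (s t : M) :
    f (insertVec h x i (s + t)) = f (insertVec h x i s) + f (insertVec h x i t) := by
  rw [insertVec_eq_update h x i 0 (s + t), insertVec_eq_update h x i 0 s,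
    insertVec_eq_update h x i 0 t]
  exact f.map_update_add _ _ _ _

lemma map_insertVec_smul (h : n + m = N) (f : MultilinearMap k (fun _ : Fin (n + 1) => M) P)
    (x : Fin (N + 1) → M) (i : Fin (n + 1)) (c : k) (t : M) :
    f (insertVec h x i (c • t)) = c • f (insertVec h x i t) := by
  rw [insertVec_eq_update h x i 0 (c • t), insertVec_eq_update h x i 0 t]
  exact f.map_update_smul _ _ _ _

/-- The insertion
`(f ∘_i g)(x_0, …, x_N) = f(x_0, …, x_{i-1}, g(x_i, …, x_{i+m}), x_{i+m+1}, …, x_N)`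
of a map `g` in `m + 1` variables into the `i`-th variable of a map `f` in `n + 1` variables, for
`N = n + m` and `i = 0, …, n`. -/
def partialComp (h : n + m = N) (i : Fin (n + 1))
    (f : MultilinearMap k (fun _ : Fin (n + 1) => M) P)
    (g : MultilinearMap k (fun _ : Fin (m + 1) => M) M) :
    MultilinearMap k (fun _ : Fin (N + 1) => M) P :=
  MultilinearMap.mk' (fun x => f (insertVec h x i (g (block h x i))))
    (by
      intro x j a b
      rcases lt_or_ge j.val i.val with hj | hj
      · simp only [block_update_left h x i j _ hj, insertVec_update_left h x i j _ _ hj]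
        exact f.map_update_add _ _ _ _
      rcases le_or_gt j.val (i.val + m) with hj' | hj'
      · simp only [block_update_mid h x i j _ hj hj', insertVec_update_mid h x i j _ _ hj hj',
          g.map_update_add, map_insertVec_add]
      · simp only [block_update_right h x i j _ hj', insertVec_update_right h x i j _ _ hj']
        exact f.map_update_add _ _ _ _)
    (by
      intro x j c a
      rcases lt_or_ge j.val i.val with hj | hj
      · simp only [block_update_left h x i j _ hj, insertVec_update_left h x i j _ _ hj]
        exact f.map_update_smul _ _ _ _
      rcases le_or_gt j.val (i.val + m) with hj' | hj'
      · simp only [block_update_mid h x i j _ hj hj', insertVec_update_mid h x i j _ _ hj hj',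
          g.map_update_smul, map_insertVec_smul]
      · simp only [block_update_right h x i j _ hj', insertVec_update_right h x i j _ _ hj']
        exact f.map_update_smul _ _ _ _)

lemma partialComp_apply (h : n + m = N) (i : Fin (n + 1))
    (f : MultilinearMap k (fun _ : Fin (n + 1) => M) P)
    (g : MultilinearMap k (fun _ : Fin (m + 1) => M) M) (x : Fin (N + 1) → M) :
    partialComp h i f g x = f (insertVec h x i (g (block h x i))) := rfl

lemma partialComp_add_right (h : n + m = N) (i : Fin (n + 1))
    (f : MultilinearMap k (fun _ : Fin (n + 1) => M) P)
    (g g' : MultilinearMap k (fun _ : Fin (m + 1) => M) M) :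
    partialComp h i f (g + g') = partialComp h i f g + partialComp h i f g' := by
  ext x
  exact map_insertVec_add h f x i _ _

lemma partialComp_smul_right (h : n + m = N) (i : Fin (n + 1)) (c : k)
    (f : MultilinearMap k (fun _ : Fin (n + 1) => M) P)
    (g : MultilinearMap k (fun _ : Fin (m + 1) => M) M) :
    partialComp h i f (c • g) = c • partialComp h i f g := by
  ext x
  exact map_insertVec_smul h f x i c _

end Insertion

/-! ### The Hochschild cochain complex and the Gerstenhaber bracket of an algebra -/

section Hochschild

variable (k : Type w) [CommRing k] (A : Type*) [Ring A] [Algebra k A]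

/-- The Hochschild cochains `C^n(A, A) = Hom_k(A^{⊗ n}, A)`, as `k`-multilinear maps; for `n = 0`
these are the elements of `A`. -/
abbrev HochschildCochain (n : ℕ) : Type _ := MultilinearMap k (fun _ : Fin n => A) A

variable {k A}

lemma contractNth_update {n : ℕ} (i : Fin n) (x : Fin (n + 1) → A) (j : Fin (n + 1)) :
    ∃ (l : Fin n) (φ : A →ₗ[k] A), ∀ v : A,
      Fin.contractNth i.castSucc (· * ·) (Function.update x j v) =
        Function.update (Fin.contractNth i.castSucc (· * ·) x) l (φ v) := by
  have key : ∀ (l : Fin n) (φ : A →ₗ[k] A),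
      (∀ v (q : Fin n), Fin.contractNth i.castSucc (· * ·) (Function.update x j v) q =
        if q = l then φ v else Fin.contractNth i.castSucc (· * ·) x q) →
      ∃ (l : Fin n) (φ : A →ₗ[k] A), ∀ v : A,
      Fin.contractNth i.castSucc (· * ·) (Function.update x j v) =
        Function.update (Fin.contractNth i.castSucc (· * ·) x) l (φ v) := by
    intro l φ hq
    refine ⟨l, φ, fun v => funext fun q => ?_⟩
    rw [hq, Function.update_apply]
  rcases lt_trichotomy j.val i.val with h | h | h
  · refine key ⟨j.val, by omega⟩ LinearMap.id fun v q => ?_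
    simp only [Fin.contractNth, Function.update_apply, Fin.ext_iff, Fin.val_castSucc, Fin.val_succ,
      LinearMap.id_apply]
    split_ifs <;> first | rfl | omega
  · refine key i (LinearMap.mulRight k (x i.succ)) fun v q => ?_
    by_cases hq : q = i
    · subst hq
      simp [Fin.contractNth, Function.update_apply, Fin.ext_iff, h]
    · have : q.val ≠ i.val := fun e => hq (Fin.ext e)
      simp only [Fin.contractNth, Function.update_apply, Fin.ext_iff, Fin.val_castSucc,
        Fin.val_succ]
      split_ifs <;> first | rfl | omega
  · by_cases h' : j.val = i.val + 1
    · refine key i (LinearMap.mulLeft k (x i.castSucc)) fun v q => ?_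
      by_cases hq : q = i
      · subst hq
        simp [Fin.contractNth, Function.update_apply, Fin.ext_iff, h']
      · have : q.val ≠ i.val := fun e => hq (Fin.ext e)
        simp only [Fin.contractNth, Function.update_apply, Fin.ext_iff, Fin.val_castSucc,
          Fin.val_succ]
        split_ifs <;> first | rfl | omega
    · refine key ⟨j.val - 1, by omega⟩ LinearMap.id fun v q => ?_
      simp only [Fin.contractNth, Function.update_apply, Fin.ext_iff, Fin.val_castSucc,
        Fin.val_succ, LinearMap.id_apply]
      split_ifs <;> first | rfl | omega

/-- The multilinear map `(x_0, …, x_n) ↦ f(x_0, …, x_i x_{i+1}, …, x_n)`. -/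
def contractCochain {n : ℕ} (f : HochschildCochain k A n) (i : Fin n) :
    HochschildCochain k A (n + 1) :=
  MultilinearMap.mk' (fun x => f (Fin.contractNth i.castSucc (· * ·) x))
    (by
      intro x j a b
      obtain ⟨l, φ, hl⟩ := contractNth_update (k := k) i x j
      simp only [hl, map_add, f.map_update_add])
    (by
      intro x j c a
      obtain ⟨l, φ, hl⟩ := contractNth_update (k := k) i x j
      simp only [hl, map_smul, f.map_update_smul])

/-- The multilinear map `(x_0, …, x_n) ↦ x_0 f(x_1, …, x_n)`. -/
def mulLeftCochain {n : ℕ} (f : HochschildCochain k A n) : HochschildCochain k A (n + 1) :=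
  MultilinearMap.mk' (fun x => x 0 * f (Fin.tail x))
    (by
      intro x j a b
      refine Fin.cases ?_ (fun j => ?_) j
      · simp [Fin.tail_update_zero, add_mul]
      · simp [Fin.tail_update_succ, mul_add, (Fin.succ_ne_zero j).symm])
    (by
      intro x j c a
      refine Fin.cases ?_ (fun j => ?_) j
      · simp [Fin.tail_update_zero]
      · simp [Fin.tail_update_succ, (Fin.succ_ne_zero j).symm])

/-- The multilinear map `(x_0, …, x_n) ↦ f(x_0, …, x_{n-1}) x_n`. -/
def mulRightCochain {n : ℕ} (f : HochschildCochain k A n) : HochschildCochain k A (n + 1) :=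
  MultilinearMap.mk' (fun x => f (Fin.init x) * x (Fin.last n))
    (by
      intro x j a b
      refine Fin.lastCases ?_ (fun j => ?_) j
      · simp [Fin.init_update_last, mul_add]
      · simp [Fin.init_update_castSucc, add_mul, (Fin.castSucc_lt_last j).ne'])
    (by
      intro x j c a
      refine Fin.lastCases ?_ (fun j => ?_) j
      · simp [Fin.init_update_last]
      · simp [Fin.init_update_castSucc, (Fin.castSucc_lt_last j).ne'])

variable (k A)

/-- The Hochschild differential
`(δ f)(x_0, …, x_n) = x_0 f(x_1, …, x_n) + ∑_{i=0}^{n-1} (-1)^{i+1} f(x_0, …, x_i x_{i+1}, …, x_n)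
+ (-1)^{n+1} f(x_0, …, x_{n-1}) x_n`. -/
def hochschildD (n : ℕ) : HochschildCochain k A n →ₗ[k] HochschildCochain k A (n + 1) where
  toFun f := mulLeftCochain f + ∑ i : Fin n, (-1 : k) ^ (i.val + 1) • contractCochain f i +
    (-1 : k) ^ (n + 1) • mulRightCochain f
  map_add' f g := by
    have h1 : mulLeftCochain (f + g) = mulLeftCochain f + mulLeftCochain g := by
      ext x; exact mul_add _ _ _
    have h2 : mulRightCochain (f + g) = mulRightCochain f + mulRightCochain g := by
      ext x; exact add_mul _ _ _
    have h3 : ∀ i : Fin n, contractCochain (f + g) i = contractCochain f i + contractCochain g i :=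
      fun i => rfl
    simp only [h1, h2, h3, smul_add, Finset.sum_add_distrib]
    abel
  map_smul' c f := by
    have h1 : mulLeftCochain (c • f) = c • mulLeftCochain f := by
      ext x; exact mul_smul_comm _ _ _
    have h2 : mulRightCochain (c • f) = c • mulRightCochain f := by
      ext x; exact smul_mul_assoc _ _ _
    have h3 : ∀ i : Fin n, contractCochain (c • f) i = c • contractCochain f i :=
      fun i => rfl
    simp only [h1, h2, h3, smul_add, Finset.smul_sum, smul_comm c, RingHom.id_apply]

/-- The Hochschild cohomology `HH^n(A)`. -/
abbrev HH (n : ℕ) : Type _ := Cohomology (hochschildD k A) n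

/-- The operation `f ∘ g = ∑_i (-1)^{i m} f ∘_i g` for `f ∈ C^{n+1}(A, A)`, `g ∈ C^{m+1}(A, A)`,
`i = 0, …, n`. -/
def hochschildCirc (n m N : ℕ) (h : n + m = N) :
    HochschildCochain k A (n + 1) →ₗ[k] HochschildCochain k A (m + 1) →ₗ[k]
      HochschildCochain k A (N + 1) :=
  LinearMap.mk₂ k (fun f g => ∑ i : Fin (n + 1), (-1 : k) ^ (i.val * m) • partialComp h i f g)
    (fun f f' g => by
      have : ∀ i, partialComp h i (f + f') g = partialComp h i f g + partialComp h i f' g :=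
        fun i => rfl
      simp only [this, smul_add, Finset.sum_add_distrib])
    (fun c f g => by
      have : ∀ i, partialComp h i (c • f) g = c • partialComp h i f g := fun i => rfl
      simp only [this, Finset.smul_sum, smul_comm c])
    (fun f g g' => by simp only [partialComp_add_right, smul_add, Finset.sum_add_distrib])
    (fun c f g => by simp only [partialComp_smul_right, Finset.smul_sum, smul_comm c])

/-- The Gerstenhaber bracket on Hochschild cochains; elements of `C^{n+1}(A, A)` have
degree `n`. -/
noncomputable def gerstenhaberBracket (n m : ℕ) :
    HochschildCochain k A (n + 1) →ₗ[k] HochschildCochain k A (m + 1) →ₗ[k]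
      HochschildCochain k A (n + m + 1) :=
  gradedCommutator (L := fun n => HochschildCochain k A (n + 1)) (hochschildCirc k A) n m

end Hochschild

/-! ### Paths and the path algebra -/

section Paths

variable (V : Type u) [Quiver.{v + 1} V]

/-- A path of the quiver, together with its source and its end. -/
structure QPath where
  src : V
  tgt : V
  path : Quiver.Path src tgt

variable {V}

/-- The arrows `[a_1, …, a_n]` in the decomposition of a path `a_1 ⋯ a_n`. -/
def arrowsOf {s : V} : ∀ {t : V}, Quiver.Path s t → List (Quiver.Total V)
  | _, .nil => []
  | _, .cons p e => arrowsOf p ++ [⟨_, _, e⟩]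

/-- The path obtained from `a_0 ⋯ a_{n-1}` by replacing the arrow `a_i` by the path `β`, if `a_i` is
parallel to `β`. (In the other cases, which are not used, the path is left as it is.) -/
noncomputable def substArrow (β : QPath V) (i : ℕ) {s : V} :
    ∀ {t : V}, Quiver.Path s t → Quiver.Path s t
  | _, .nil => .nil
  | _, .cons (b := u) (c := t) p e =>
    open Classical in
    if i = p.length then
      if h : β.src = u ∧ β.tgt = t then p.comp (β.path.cast h.1 h.2) else .cons p e
    else .cons (substArrow β i p) e

lemma length_arrowsOf {s t : V} (p : Quiver.Path s t) : (arrowsOf p).length = p.length := by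
  induction p with
  | nil => rfl
  | cons p e ih => simp [arrowsOf, ih]

lemma length_cast {s t s' t' : V} (hs : s = s') (ht : t = t') (p : Quiver.Path s t) :
    (p.cast hs ht).length = p.length := by
  subst hs; subst ht; rfl

lemma length_substArrow (β : QPath V) (i : ℕ) {s t : V} (p : Quiver.Path s t) (a : Quiver.Total V)
    (ha : (arrowsOf p)[i]? = some a) (hs : β.src = a.left) (ht : β.tgt = a.right) :
    (substArrow β i p).length + 1 = p.length + β.path.length := by
  induction p with
  | nil => simp [arrowsOf] at ha
  | cons p e ih =>
    unfold substArrow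
    by_cases hi : i = p.length
    · have : a = ⟨_, _, e⟩ := by
        rw [arrowsOf, List.getElem?_append_right (by rw [length_arrowsOf, hi]), length_arrowsOf,
          hi] at ha
        simpa using ha.symm
      subst this
      rw [if_pos hi, dif_pos ⟨hs, ht⟩]
      simp [length_cast]; omega
    · rw [if_neg hi]
      have hlt : i < (arrowsOf p ++ [(⟨_, _, e⟩ : Quiver.Total V)]).length := by
        by_contra hcon
        rw [arrowsOf, List.getElem?_eq_none (by omega)] at ha
        cases ha
      simp [length_arrowsOf] at hlt
      have := ih (by
        rw [arrowsOf, List.getElem?_append_left (by rw [length_arrowsOf]; omega)] at ha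
        exact ha)
      simp; omega

namespace QPath

/-- The length of a path. -/
def length (p : QPath V) : ℕ := p.path.length

/-- The trivial path `e_i` at a vertex `i`. -/
abbrev trivial (i : V) : QPath V := ⟨i, i, .nil⟩

/-- An arrow, as a path of length one. -/
abbrev ofArrow (a : Quiver.Total V) : QPath V := ⟨a.left, a.right, a.hom.toPath⟩

/-- The arrows in the decomposition of a path. -/
def arrows (p : QPath V) : List (Quiver.Total V) := arrowsOf p.path

/-- The concatenation `p q` of two paths, for `p` ending where `q` starts. -/
def concat (p q : QPath V) (h : p.tgt = q.src) : QPath V :=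
  ⟨p.src, q.tgt, p.path.comp (q.path.cast h.symm rfl)⟩

/-- The path obtained from `α = a_0 ⋯ a_{n-1}` by replacing the arrow `a_i` by a path `β` parallel
to `a_i`. -/
noncomputable def subst (α : QPath V) (i : ℕ) (β : QPath V) : QPath V :=
  ⟨α.src, α.tgt, substArrow β i α.path⟩

/-- Two paths are parallel if they have the same source and the same end. -/
def Parallel (p q : QPath V) : Prop := p.src = q.src ∧ p.tgt = q.tgt

lemma length_subst (α β : QPath V) (i : ℕ) (a : Quiver.Total V) (ha : α.arrows[i]? = some a)
    (hβ : β.Parallel (ofArrow a)) : (α.subst i β).length + 1 = α.length + β.length :=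
  length_substArrow β i α.path a ha hβ.1 hβ.2

lemma length_concat (p q : QPath V) (h : p.tgt = q.src) :
    (p.concat q h).length = p.length + q.length := by
  simp [concat, length, length_cast]

lemma concat_assoc (p q r : QPath V) (h : p.tgt = q.src) (h' : q.tgt = r.src) :
    (p.concat q h).concat r h' = p.concat (q.concat r h') h := by
  obtain ⟨p1, p2, p⟩ := p
  obtain ⟨q1, q2, q⟩ := q
  obtain ⟨r1, r2, r⟩ := r
  dsimp only at h h'
  subst h; subst h'
  simp [concat]

lemma trivial_concat (q : QPath V) (i : V) (h : i = q.src) :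
    (trivial i).concat q h = q := by
  subst h
  simp [concat, trivial]

lemma concat_trivial (q : QPath V) (i : V) (h : q.tgt = i) :
    q.concat (trivial i) h = q := by
  subst h
  simp [concat, trivial]

end QPath

end Paths

section PathAlgebra

variable (k : Type w) [Field k] (V : Type u) [Quiver.{v + 1} V]

/-- The path algebra `kQ`: the vector space with basis the paths of the quiver. -/
def PathAlg : Type _ := QPath V →₀ k

noncomputable instance : AddCommGroup (PathAlg k V) := inferInstanceAs (AddCommGroup (QPath V →₀ k))

noncomputable instance : Module k (PathAlg k V) := inferInstanceAs (Module k (QPath V →₀ k))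

variable {k V} in
/-- A path, as an element of the path algebra. -/
noncomputable def ofPath (p : QPath V) : PathAlg k V := Finsupp.single p 1

variable {k V} in
open Classical in
/-- The product of two paths in the path algebra: their concatenation, or zero. -/
noncomputable def pathMul (p q : QPath V) : PathAlg k V :=
  if h : p.tgt = q.src then ofPath (p.concat q h) else 0

/-- The bilinear extension of the product of paths. -/
noncomputable def pathMulLin : PathAlg k V →ₗ[k] PathAlg k V →ₗ[k] PathAlg k V :=
  Finsupp.linearCombination k fun p : QPath V =>
    (Finsupp.linearCombination k fun q : QPath V => (pathMul p q : PathAlg k V) :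
      (QPath V →₀ k) →ₗ[k] PathAlg k V)

noncomputable instance : Mul (PathAlg k V) := ⟨fun x y => pathMulLin k V x y⟩

noncomputable instance [Fintype V] : One (PathAlg k V) := ⟨∑ i : V, ofPath (QPath.trivial i)⟩

variable {k V}

lemma PathAlg.mul_def (x y : PathAlg k V) : x * y = pathMulLin k V x y := rfl

lemma PathAlg.ofPath_mul (p q : QPath V) :
    (ofPath p * ofPath q : PathAlg k V) = pathMul p q := by
  rw [PathAlg.mul_def, pathMulLin, ofPath, ofPath]
  erw [Finsupp.linearCombination_single, one_smul, Finsupp.linearCombination_single, one_smul]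

lemma PathAlg.hom_ext {M : Type*} [AddCommGroup M] [Module k M] {f g : PathAlg k V →ₗ[k] M}
    (h : ∀ p, f (ofPath p) = g (ofPath p)) : f = g :=
  Finsupp.lhom_ext' fun p => LinearMap.ext_ring (h p)

lemma PathAlg.mul_assoc' (x y z : PathAlg k V) : x * y * z = x * (y * z) := by
  have key : ∀ p q r : QPath V, (ofPath p * ofPath q * ofPath r : PathAlg k V) =
      ofPath p * (ofPath q * ofPath r) := by
    intro p q r
    simp only [PathAlg.ofPath_mul]
    by_cases h : p.tgt = q.src
    · by_cases h' : q.tgt = r.src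
      · rw [pathMul, dif_pos h, pathMul, dif_pos h', PathAlg.ofPath_mul, PathAlg.ofPath_mul,
          pathMul, pathMul, dif_pos (show (p.concat q h).tgt = r.src from h'),
          dif_pos (show p.tgt = (q.concat r h').src from h), QPath.concat_assoc]
      · rw [pathMul, dif_pos h, pathMul, dif_neg h', PathAlg.ofPath_mul, pathMul,
          dif_neg (show ¬ (p.concat q h).tgt = r.src from h'), PathAlg.mul_def, map_zero]
    · by_cases h' : q.tgt = r.src
      · rw [pathMul, dif_neg h, pathMul, dif_pos h', PathAlg.ofPath_mul, pathMul,
          dif_neg (show ¬ p.tgt = (q.concat r h').src from h), PathAlg.mul_def, map_zero,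
          LinearMap.zero_apply]
      · rw [pathMul, dif_neg h, pathMul, dif_neg h', PathAlg.mul_def, PathAlg.mul_def, map_zero,
          map_zero, LinearMap.zero_apply]
  let μ := pathMulLin k V
  have h3 : ∀ p q, μ (μ (ofPath p) (ofPath q)) = (μ (ofPath p)).comp (μ (ofPath q)) := fun p q =>
    PathAlg.hom_ext fun r => key p q r
  have h2 : ∀ p, μ.comp (μ (ofPath p)) = (LinearMap.llcomp k _ _ _ (μ (ofPath p))).comp μ :=
    fun p => PathAlg.hom_ext fun q => h3 p q
  have h1 : (LinearMap.llcomp k (PathAlg k V) (PathAlg k V) (PathAlg k V →ₗ[k] PathAlg k V) μ).comp μ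
      = ((LinearMap.llcomp k (PathAlg k V) (PathAlg k V →ₗ[k] PathAlg k V)
        (PathAlg k V →ₗ[k] PathAlg k V)).flip μ).comp
        ((LinearMap.llcomp k (PathAlg k V) (PathAlg k V) (PathAlg k V)).comp μ) :=
    PathAlg.hom_ext fun p => h2 p
  exact congrArg (fun F => F z) (congrArg (fun F => F y) (congrArg (fun F => F x) h1))

lemma PathAlg.ofPath_trivial_mul (i : V) (p : QPath V) (h : i = p.src) :
    (ofPath (QPath.trivial i) * ofPath p : PathAlg k V) = ofPath p := by
  rw [PathAlg.ofPath_mul, pathMul, dif_pos (show (QPath.trivial i).tgt = p.src from h),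
    QPath.trivial_concat]

lemma PathAlg.one_mul' [Fintype V] (x : PathAlg k V) : 1 * x = x := by
  have : pathMulLin k V 1 = LinearMap.id := PathAlg.hom_ext fun p => by
    change pathMulLin k V (∑ i : V, ofPath (QPath.trivial i)) (ofPath p) = ofPath p
    rw [map_sum, LinearMap.sum_apply, Finset.sum_eq_single p.src]
    · exact PathAlg.ofPath_trivial_mul _ p rfl
    · intro i _ hi
      change (ofPath (QPath.trivial i) * ofPath p : PathAlg k V) = 0
      rw [PathAlg.ofPath_mul, pathMul, dif_neg (show ¬ (QPath.trivial i).tgt = p.src from hi)]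
    · intro h; exact absurd (Finset.mem_univ _) h
  exact congrArg (fun F => F x) this

lemma PathAlg.mul_one' [Fintype V] (x : PathAlg k V) : x * 1 = x := by
  have : (pathMulLin k V).flip 1 = LinearMap.id := PathAlg.hom_ext fun p => by
    change pathMulLin k V (ofPath p) (∑ i : V, ofPath (QPath.trivial i)) = ofPath p
    rw [map_sum, Finset.sum_eq_single p.tgt]
    · change (ofPath p * ofPath (QPath.trivial p.tgt) : PathAlg k V) = ofPath p
      rw [PathAlg.ofPath_mul, pathMul, dif_pos (show p.tgt = (QPath.trivial p.tgt).src from rfl),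
        QPath.concat_trivial]
    · intro i _ hi
      change (ofPath p * ofPath (QPath.trivial i) : PathAlg k V) = 0
      rw [PathAlg.ofPath_mul, pathMul, dif_neg (fun h => hi h.symm)]
    · intro h; exact absurd (Finset.mem_univ _) h
  exact congrArg (fun F => F x) this

noncomputable instance [Fintype V] : Ring (PathAlg k V) where
  __ := (inferInstance : AddCommGroup (PathAlg k V))
  mul := (· * ·)
  one := 1
  left_distrib x y z := by change pathMulLin k V x (y + z) = _; rw [map_add]; rfl
  right_distrib x y z := by
    change pathMulLin k V (x + y) z = _; rw [map_add]; rfl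
  zero_mul x := by change pathMulLin k V 0 x = _; rw [map_zero]; rfl
  mul_zero x := by change pathMulLin k V x 0 = _; rw [map_zero]
  mul_assoc := PathAlg.mul_assoc'
  one_mul := PathAlg.one_mul'
  mul_one := PathAlg.mul_one'

noncomputable instance [Fintype V] : Algebra k (PathAlg k V) :=
  Algebra.ofModule
    (fun c x y => by change pathMulLin k V (c • x) y = _; rw [map_smul]; rfl)
    (fun c x y => by change pathMulLin k V x (c • y) = _; rw [map_smul]; rfl)

end PathAlgebra

/-! ### The monomial algebra of radical square zero -/

section RadicalSquareZero

variable (k : Type w) [Field k] (V : Type u) [Quiver.{v + 1} V] [Fintype V]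

/-- The two-sided ideal `⟨Q_2⟩` of the path algebra generated by the paths of length two. -/
noncomputable def idealQ2 : TwoSidedIdeal (PathAlg k V) :=
  TwoSidedIdeal.span {x | ∃ p : QPath V, p.length = 2 ∧ x = ofPath p}

/-- The algebra `A = kQ / ⟨Q_2⟩`. -/
def RadSqAlg : Type _ := (idealQ2 k V).ringCon.Quotient

noncomputable instance : Ring (RadSqAlg k V) :=
  inferInstanceAs (Ring (idealQ2 k V).ringCon.Quotient)

noncomputable instance : Algebra k (RadSqAlg k V) :=
  inferInstanceAs (Algebra k (idealQ2 k V).ringCon.Quotient)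

/-- The projection `kQ → A`. -/
noncomputable def toRadSq : PathAlg k V →ₐ[k] RadSqAlg k V :=
  { (idealQ2 k V).ringCon.mk' with commutes' := fun _ => rfl }

variable {V}

/-- The image in `A` of a path. -/
noncomputable def pathClass (p : QPath V) : RadSqAlg k V := toRadSq k V (ofPath p)

variable (V)

/-- The subspace `E = kQ_0` of `A` spanned by the trivial paths. -/
noncomputable def subE : Submodule k (RadSqAlg k V) :=
  Submodule.span k {x | ∃ p : QPath V, p.length = 0 ∧ x = pathClass k p}

/-- The radical `r = kQ_1` of `A`, spanned by the arrows. -/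
noncomputable def rad : Submodule k (RadSqAlg k V) :=
  Submodule.span k {x | ∃ p : QPath V, p.length = 1 ∧ x = pathClass k p}

variable {k V}

lemma toRadSq_surjective : Function.Surjective (toRadSq k V) :=
  fun y => Quotient.inductionOn y fun x => ⟨x, rfl⟩

lemma toRadSq_eq_iff (x y : PathAlg k V) :
    toRadSq k V x = toRadSq k V y ↔ x - y ∈ idealQ2 k V :=
  (RingCon.eq _).trans (TwoSidedIdeal.rel_iff _ _ _)

lemma pathClass_mul (p q : QPath V) (h : p.tgt = q.src) :
    pathClass k p * pathClass k q = pathClass k (p.concat q h) := by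
  rw [pathClass, pathClass, ← map_mul, PathAlg.ofPath_mul, pathMul, dif_pos h, pathClass]

lemma pathClass_mul_of_ne (p q : QPath V) (h : ¬ p.tgt = q.src) :
    pathClass k p * pathClass k q = 0 := by
  rw [pathClass, pathClass, ← map_mul, PathAlg.ofPath_mul, pathMul, dif_neg h, map_zero]

lemma pathClass_eq_zero (p : QPath V) (hp : 2 ≤ p.length) : pathClass k p = 0 := by
  obtain ⟨s, t, p⟩ := p
  cases p with
  | nil => simp [QPath.length] at hp
  | cons p b =>
    cases p with
    | nil => simp [QPath.length] at hp
    | cons p a =>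
      have h0 : pathClass k (⟨_, _, (Quiver.Path.nil.cons a).cons b⟩ : QPath V) = 0 := by
        rw [pathClass, ← map_zero (toRadSq k V), toRadSq_eq_iff, sub_zero]
        exact TwoSidedIdeal.subset_span ⟨_, rfl, rfl⟩
      have h1 := pathClass_mul (k := k) (⟨_, _, p⟩ : QPath V)
        ⟨_, _, (Quiver.Path.nil.cons a).cons b⟩ rfl
      rw [h0, mul_zero] at h1
      exact h1.symm

lemma PathAlg.span_ofPath : Submodule.span k (Set.range (ofPath : QPath V → PathAlg k V)) = ⊤ := by
  rw [← top_le_iff]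
  have := (Finsupp.basisSingleOne (R := k) (ι := QPath V)).span_eq
  rw [Finsupp.coe_basisSingleOne] at this
  exact this.ge

lemma span_pathClass : Submodule.span k (Set.range (pathClass k : QPath V → RadSqAlg k V)) = ⊤ := by
  have h := congrArg (Submodule.map (toRadSq k V).toLinearMap) (PathAlg.span_ofPath (k := k) (V := V))
  rw [Submodule.map_span, Submodule.map_top, LinearMap.range_eq_top.2 toRadSq_surjective,
    ← Set.range_comp] at h
  exact h

/-- The span of the paths of length at least two in the path algebra. -/
noncomputable def longPart (k : Type w) [Field k] (V : Type u) [Quiver.{v + 1} V] : Submodule k (PathAlg k V) :=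
  Submodule.span k {x | ∃ p : QPath V, 2 ≤ p.length ∧ x = ofPath p}

lemma mul_mem_longPart_left (x y : PathAlg k V) (hy : y ∈ longPart k V) : x * y ∈ longPart k V := by
  induction hy using Submodule.span_induction with
  | zero => rw [mul_zero]; exact zero_mem _
  | add a b _ _ ha hb => rw [mul_add]; exact add_mem ha hb
  | smul c a _ ha => rw [mul_smul_comm]; exact Submodule.smul_mem _ _ ha
  | mem y hy =>
    obtain ⟨p, hp, rfl⟩ := hy
    have hx : x ∈ Submodule.span k (Set.range (ofPath : QPath V → PathAlg k V)) := by
      rw [PathAlg.span_ofPath]; trivial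
    induction hx using Submodule.span_induction with
    | zero => rw [zero_mul]; exact zero_mem _
    | add a b _ _ ha hb => rw [add_mul]; exact add_mem ha hb
    | smul c a _ ha => rw [smul_mul_assoc]; exact Submodule.smul_mem _ _ ha
    | mem x hx =>
      obtain ⟨q, rfl⟩ := hx
      rw [PathAlg.ofPath_mul, pathMul]
      split_ifs with h
      · exact Submodule.subset_span ⟨_, by rw [QPath.length_concat]; omega, rfl⟩
      · exact zero_mem _

lemma mul_mem_longPart_right (x y : PathAlg k V) (hx : x ∈ longPart k V) :
    x * y ∈ longPart k V := by
  induction hx using Submodule.span_induction with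
  | zero => rw [zero_mul]; exact zero_mem _
  | add a b _ _ ha hb => rw [add_mul]; exact add_mem ha hb
  | smul c a _ ha => rw [smul_mul_assoc]; exact Submodule.smul_mem _ _ ha
  | mem x hx =>
    obtain ⟨p, hp, rfl⟩ := hx
    have hy : y ∈ Submodule.span k (Set.range (ofPath : QPath V → PathAlg k V)) := by
      rw [PathAlg.span_ofPath]; trivial
    induction hy using Submodule.span_induction with
    | zero => rw [mul_zero]; exact zero_mem _
    | add a b _ _ ha hb => rw [mul_add]; exact add_mem ha hb
    | smul c a _ ha => rw [mul_smul_comm]; exact Submodule.smul_mem _ _ ha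
    | mem x hx =>
      obtain ⟨q, rfl⟩ := hx
      rw [PathAlg.ofPath_mul, pathMul]
      split_ifs with h
      · exact Submodule.subset_span ⟨_, by rw [QPath.length_concat]; omega, rfl⟩
      · exact zero_mem _

lemma idealQ2_le (x : PathAlg k V) (hx : x ∈ idealQ2 k V) : x ∈ longPart k V := by
  let J : TwoSidedIdeal (PathAlg k V) := TwoSidedIdeal.mk' (longPart k V : Set (PathAlg k V))
    (zero_mem _) (fun ha hb => add_mem ha hb) (fun ha => neg_mem ha)
    (fun hb => mul_mem_longPart_left _ _ hb) (fun ha => mul_mem_longPart_right _ _ ha)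
  have hJ : x ∈ J := by
    refine TwoSidedIdeal.mem_span_iff.1 hx J ?_
    rintro y ⟨p, hp, rfl⟩
    rw [SetLike.mem_coe, TwoSidedIdeal.mem_mk']
    exact Submodule.subset_span ⟨p, hp.ge, rfl⟩
  rwa [TwoSidedIdeal.mem_mk'] at hJ

lemma PathAlg.eq_zero_of_span_disjoint {S T : Set (QPath V)} (hST : Disjoint S T) (x : PathAlg k V)
    (hS : x ∈ Submodule.span k (ofPath '' S)) (hT : x ∈ Submodule.span k (ofPath '' T)) : x = 0 := by
  have hS' : (x : QPath V →₀ k) ∈ Finsupp.supported k k S := by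
    rw [Finsupp.supported_eq_span_single]; exact hS
  have hT' : (x : QPath V →₀ k) ∈ Finsupp.supported k k T := by
    rw [Finsupp.supported_eq_span_single]; exact hT
  exact (Submodule.disjoint_def.1 (Finsupp.disjoint_supported_supported hST)) x hS' hT'

lemma isCompl_rad_subE : IsCompl (rad k V) (subE k V) := by
  constructor
  · rw [Submodule.disjoint_def]
    intro x hr hE
    have hr' : x ∈ Submodule.map (toRadSq k V).toLinearMap
        (Submodule.span k (ofPath '' {p : QPath V | p.length = 1})) := by
      rw [Submodule.map_span, ← Set.image_comp]
      refine Submodule.span_mono ?_ hr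
      rintro y ⟨p, hp, rfl⟩
      exact ⟨p, hp, rfl⟩
    have hE' : x ∈ Submodule.map (toRadSq k V).toLinearMap
        (Submodule.span k (ofPath '' {p : QPath V | p.length = 0})) := by
      rw [Submodule.map_span, ← Set.image_comp]
      refine Submodule.span_mono ?_ hE
      rintro y ⟨p, hp, rfl⟩
      exact ⟨p, hp, rfl⟩
    obtain ⟨a, ha, rfl⟩ := hr'
    obtain ⟨b, hb, hab⟩ := hE'
    have hl := idealQ2_le _ ((toRadSq_eq_iff b a).1 hab)
    have hl' : b - a ∈ Submodule.span k (ofPath '' {p : QPath V | 2 ≤ p.length}) := by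
      refine Submodule.span_mono ?_ hl
      rintro y ⟨p, hp, rfl⟩
      exact ⟨p, hp, rfl⟩
    have ha' : a = 0 := by
      refine PathAlg.eq_zero_of_span_disjoint (S := {p : QPath V | p.length = 1})
        (T := {p : QPath V | p.length = 0} ∪ {p : QPath V | 2 ≤ p.length}) ?_ a ha ?_
      · rw [Set.disjoint_left]
        rintro p hp (hp' | hp') <;> simp only [Set.mem_ofPred_eq] at hp hp' <;> omega
      · rw [Set.image_union, Submodule.span_union]
        have : a = b - (b - a) := by abel
        rw [this]
        exact Submodule.sub_mem _ (Submodule.mem_sup_left hb) (Submodule.mem_sup_right hl')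
    rw [ha', map_zero]
  · rw [codisjoint_iff, ← top_le_iff, ← span_pathClass, Submodule.span_le]
    rintro _ ⟨p, rfl⟩
    rcases Nat.lt_or_ge p.length 2 with hp | hp
    · rcases Nat.lt_or_ge p.length 1 with hp' | hp'
      · exact Submodule.mem_sup_right (Submodule.subset_span ⟨p, by omega, rfl⟩)
      · exact Submodule.mem_sup_left (Submodule.subset_span ⟨p, by omega, rfl⟩)
    · rw [pathClass_eq_zero p hp]; exact zero_mem _

lemma mul_mem_rad_left (a x : RadSqAlg k V) (hx : x ∈ rad k V) : a * x ∈ rad k V := by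
  induction hx using Submodule.span_induction with
  | zero => rw [mul_zero]; exact zero_mem _
  | add x y _ _ hx hy => rw [mul_add]; exact add_mem hx hy
  | smul c x _ hx => rw [mul_smul_comm]; exact Submodule.smul_mem _ _ hx
  | mem x hx =>
    obtain ⟨p, hp, rfl⟩ := hx
    have ha : a ∈ Submodule.span k (Set.range (pathClass k : QPath V → RadSqAlg k V)) := by
      rw [span_pathClass]; trivial
    induction ha using Submodule.span_induction with
    | zero => rw [zero_mul]; exact zero_mem _
    | add a b _ _ ha hb => rw [add_mul]; exact add_mem ha hb
    | smul c a _ ha => rw [smul_mul_assoc]; exact Submodule.smul_mem _ _ ha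
    | mem a ha =>
      obtain ⟨q, rfl⟩ := ha
      by_cases h : q.tgt = p.src
      · rw [pathClass_mul q p h]
        rcases Nat.eq_zero_or_pos q.length with h0 | h0
        · exact Submodule.subset_span ⟨_, by rw [QPath.length_concat]; omega, rfl⟩
        · rw [pathClass_eq_zero _ (by rw [QPath.length_concat]; omega)]; exact zero_mem _
      · rw [pathClass_mul_of_ne q p h]; exact zero_mem _

lemma mul_mem_rad_right (x a : RadSqAlg k V) (hx : x ∈ rad k V) : x * a ∈ rad k V := by
  induction hx using Submodule.span_induction with
  | zero => rw [zero_mul]; exact zero_mem _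
  | add x y _ _ hx hy => rw [add_mul]; exact add_mem hx hy
  | smul c x _ hx => rw [smul_mul_assoc]; exact Submodule.smul_mem _ _ hx
  | mem x hx =>
    obtain ⟨p, hp, rfl⟩ := hx
    have ha : a ∈ Submodule.span k (Set.range (pathClass k : QPath V → RadSqAlg k V)) := by
      rw [span_pathClass]; trivial
    induction ha using Submodule.span_induction with
    | zero => rw [mul_zero]; exact zero_mem _
    | add a b _ _ ha hb => rw [mul_add]; exact add_mem ha hb
    | smul c a _ ha => rw [mul_smul_comm]; exact Submodule.smul_mem _ _ ha
    | mem a ha =>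
      obtain ⟨q, rfl⟩ := ha
      by_cases h : p.tgt = q.src
      · rw [pathClass_mul p q h]
        rcases Nat.eq_zero_or_pos q.length with h0 | h0
        · exact Submodule.subset_span ⟨_, by rw [QPath.length_concat]; omega, rfl⟩
        · rw [pathClass_eq_zero _ (by rw [QPath.length_concat]; omega)]; exact zero_mem _
      · rw [pathClass_mul_of_ne p q h]; exact zero_mem _

lemma mul_mem_subE (x y : RadSqAlg k V) (hx : x ∈ subE k V) (hy : y ∈ subE k V) :
    x * y ∈ subE k V := by
  induction hx using Submodule.span_induction with
  | zero => rw [zero_mul]; exact zero_mem _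
  | add a b _ _ ha hb => rw [add_mul]; exact add_mem ha hb
  | smul c a _ ha => rw [smul_mul_assoc]; exact Submodule.smul_mem _ _ ha
  | mem x hx =>
    obtain ⟨p, hp, rfl⟩ := hx
    induction hy using Submodule.span_induction with
    | zero => rw [mul_zero]; exact zero_mem _
    | add a b _ _ ha hb => rw [mul_add]; exact add_mem ha hb
    | smul c a _ ha => rw [mul_smul_comm]; exact Submodule.smul_mem _ _ ha
    | mem y hy =>
      obtain ⟨q, hq, rfl⟩ := hy
      by_cases h : p.tgt = q.src
      · rw [pathClass_mul p q h]
        exact Submodule.subset_span ⟨_, by rw [QPath.length_concat]; omega, rfl⟩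
      · rw [pathClass_mul_of_ne p q h]; exact zero_mem _

variable (k V) in
/-- The projection `π : A → r` along the decomposition `A = E ⊕ r`. -/
noncomputable def radProj : RadSqAlg k V →ₗ[k] rad k V :=
  (rad k V).projectionOnto (subE k V) isCompl_rad_subE

/-- Left multiplication by an element of `A` on the ideal `r`. -/
noncomputable def actL (a : RadSqAlg k V) : rad k V →ₗ[k] rad k V :=
  (LinearMap.mulLeft k a).restrict fun x hx => mul_mem_rad_left a x hx

/-- Right multiplication by an element of `A` on the ideal `r`. -/
noncomputable def actR (a : RadSqAlg k V) : rad k V →ₗ[k] rad k V :=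
  (LinearMap.mulRight k a).restrict fun x hx => mul_mem_rad_right x a hx

lemma radProj_of_mem (x : rad k V) : radProj k V x = x :=
  Submodule.projectionOnto_apply_left isCompl_rad_subE x

lemma radProj_of_mem_subE (x : RadSqAlg k V) (hx : x ∈ subE k V) : radProj k V x = 0 :=
  Submodule.projectionOnto_apply_of_mem_right isCompl_rad_subE hx

lemma exists_decomp (x : RadSqAlg k V) : ∃ (y : rad k V) (z : RadSqAlg k V), z ∈ subE k V ∧
    x = y + z := by
  have : x ∈ rad k V ⊔ subE k V := by rw [isCompl_rad_subE.sup_eq_top]; trivial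
  obtain ⟨y, hy, z, hz, h⟩ := Submodule.mem_sup.1 this
  exact ⟨⟨y, hy⟩, z, hz, h.symm⟩

lemma radProj_mul_left (e x : RadSqAlg k V) (he : e ∈ subE k V) :
    radProj k V (e * x) = actL e (radProj k V x) := by
  obtain ⟨y, z, hz, rfl⟩ := exists_decomp x
  have h : e * (y : RadSqAlg k V) = (actL e y : rad k V) := rfl
  rw [mul_add, map_add, map_add, radProj_of_mem_subE _ (mul_mem_subE _ _ he hz),
    radProj_of_mem_subE _ hz, h, radProj_of_mem, radProj_of_mem, add_zero, add_zero]

lemma radProj_mul_right (e x : RadSqAlg k V) (he : e ∈ subE k V) :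
    radProj k V (x * e) = actR e (radProj k V x) := by
  obtain ⟨y, z, hz, rfl⟩ := exists_decomp x
  have h : (y : RadSqAlg k V) * e = (actR e y : rad k V) := rfl
  rw [add_mul, map_add, map_add, radProj_of_mem_subE _ (mul_mem_subE _ _ hz he),
    radProj_of_mem_subE _ hz, h, radProj_of_mem, radProj_of_mem, add_zero, add_zero]

end RadicalSquareZero

/-! ### The reduced cochains and the reduced bracket -/

section Reduced

variable (k : Type w) [Field k] (V : Type u) [Quiver.{v + 1} V] [Fintype V]

variable {k V} in
/-- The `k`-multilinear map `f : r × ⋯ × r → A` in `n` variables corresponds to a homomorphism of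
`E`-bimodules `r ⊗_E ⋯ ⊗_E r → A`. For `n = 0`, where the tensor product is `E`, this means that
the element `f ()` of `A` commutes with `E`. -/
structure IsBimoduleHom {n : ℕ}
    (f : MultilinearMap k (fun _ : Fin n => rad k V) (RadSqAlg k V)) : Prop where
  balanced : ∀ e ∈ subE k V, ∀ (x : Fin n → rad k V) (i j : Fin n), j.val = i.val + 1 →
    f (Function.update x i (actR e (x i))) = f (Function.update x j (actL e (x j)))
  left : ∀ e ∈ subE k V, ∀ (x : Fin n → rad k V) (i : Fin n), i.val = 0 →
    f (Function.update x i (actL e (x i))) = e * f x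
  right : ∀ e ∈ subE k V, ∀ (x : Fin n → rad k V) (i : Fin n), i.val + 1 = n →
    f (Function.update x i (actR e (x i))) = f x * e
  zero : n = 0 → ∀ e ∈ subE k V, ∀ x : Fin n → rad k V, e * f x = f x * e

/-- The reduced cochains `C^n_E(r, A) = Hom_{E^e}(r^{⊗_E n}, A)`, described through the universal
property of the tensor product over `E`; `C^0_E(r, A) = A^E`. -/
def ReducedCochain (n : ℕ) :
    Submodule k (MultilinearMap k (fun _ : Fin n => rad k V) (RadSqAlg k V)) where
  carrier := {f | IsBimoduleHom f}
  add_mem' {_ _} hf hg :=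
    ⟨fun e he x i j h => congrArg₂ (· + ·) (hf.balanced e he x i j h) (hg.balanced e he x i j h),
      fun e he x i h => (congrArg₂ (· + ·) (hf.left e he x i h) (hg.left e he x i h)).trans
        (mul_add _ _ _).symm,
      fun e he x i h => (congrArg₂ (· + ·) (hf.right e he x i h) (hg.right e he x i h)).trans
        (add_mul _ _ _).symm,
      fun h e he x => (mul_add _ _ _).trans <|
        (congrArg₂ (· + ·) (hf.zero h e he x) (hg.zero h e he x)).trans (add_mul _ _ _).symm⟩
  zero_mem' :=
    ⟨fun _ _ _ _ _ _ => rfl, fun _ _ _ _ _ => (mul_zero _).symm, fun _ _ _ _ _ => (zero_mul _).symm,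
      fun _ _ _ _ => (mul_zero _).trans (zero_mul _).symm⟩
  smul_mem' c _ hf :=
    ⟨fun e he x i j h => congrArg (c • ·) (hf.balanced e he x i j h),
      fun e he x i h => (congrArg (c • ·) (hf.left e he x i h)).trans (mul_smul_comm _ _ _).symm,
      fun e he x i h => (congrArg (c • ·) (hf.right e he x i h)).trans (smul_mul_assoc _ _ _).symm,
      fun h e he x => (mul_smul_comm _ _ _).trans <|
        (congrArg (c • ·) (hf.zero h e he x)).trans (smul_mul_assoc _ _ _).symm⟩

variable {k V}

lemma isBimoduleHom_partialComp {n m N : ℕ} (h : n + m = N) (i : Fin (n + 1))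
    (f : MultilinearMap k (fun _ : Fin (n + 1) => rad k V) (RadSqAlg k V))
    (g : MultilinearMap k (fun _ : Fin (m + 1) => rad k V) (RadSqAlg k V))
    (hf : IsBimoduleHom f) (hg : IsBimoduleHom g) :
    IsBimoduleHom (partialComp h i f ((radProj k V).compMultilinearMap g)) := by
  set G := (radProj k V).compMultilinearMap g with hG
  have gb : ∀ e ∈ subE k V, ∀ (x : Fin (m + 1) → rad k V) (i j : Fin (m + 1)), j.val = i.val + 1 →
      G (Function.update x i (actR e (x i))) = G (Function.update x j (actL e (x j))) :=
    fun e he x i j hij => congrArg (radProj k V) (hg.balanced e he x i j hij)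
  have gl : ∀ e ∈ subE k V, ∀ (x : Fin (m + 1) → rad k V) (i : Fin (m + 1)), i.val = 0 →
      G (Function.update x i (actL e (x i))) = actL e (G x) :=
    fun e he x i hi => (congrArg (radProj k V) (hg.left e he x i hi)).trans (radProj_mul_left _ _ he)
  have gr : ∀ e ∈ subE k V, ∀ (x : Fin (m + 1) → rad k V) (i : Fin (m + 1)), i.val + 1 = m + 1 →
      G (Function.update x i (actR e (x i))) = actR e (G x) :=
    fun e he x i hi =>
      (congrArg (radProj k V) (hg.right e he x i hi)).trans (radProj_mul_right _ _ he)
  have bx : ∀ (x : Fin (N + 1) → rad k V) (j : Fin (N + 1)) (hj : i.val ≤ j.val)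
      (hj' : j.val ≤ i.val + m), x j = block h x i ⟨j.val - i.val, by omega⟩ := by
    intro x j hj hj'
    simp only [block]
    congr 1
    apply Fin.ext
    simp only
    omega
  have lx : ∀ (x : Fin (N + 1) → rad k V) (t : rad k V) (j : Fin (N + 1)) (hj : j.val < i.val),
      x j = insertVec h x i t ⟨j.val, by omega⟩ := by
    intro x t j hj
    rw [insertVec_apply_left h x i t ⟨j.val, by omega⟩ hj]
  have rx : ∀ (x : Fin (N + 1) → rad k V) (t : rad k V) (j : Fin (N + 1)) (hj : i.val + m < j.val),
      x j = insertVec h x i t ⟨j.val - m, by omega⟩ := by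
    intro x t j hj
    rw [insertVec_apply_right h x i t ⟨j.val - m, by omega⟩ (by simp only; omega)]
    congr 1
    apply Fin.ext
    simp only
    omega
  have sx : ∀ (x : Fin (N + 1) → rad k V) (t : rad k V) (φ : rad k V →ₗ[k] rad k V),
      insertVec h x i (φ t) =
        Function.update (insertVec h x i t) i (φ (insertVec h x i t i)) := by
    intro x t φ
    rw [insertVec_apply_self]
    exact insertVec_eq_update h x i t _
  refine ⟨?_, ?_, ?_, fun h0 => absurd h0 (Nat.succ_ne_zero N)⟩
  · intro e he x j j' hjj
    simp only [partialComp_apply]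
    rcases lt_or_ge j.val i.val with hj | hj
    · rw [block_update_left h x i j _ hj, insertVec_update_left h x i j _ _ hj,
        lx x (G (block h x i)) j hj]
      rcases lt_or_ge j'.val i.val with hj' | hj'
      · rw [block_update_left h x i j' _ hj', insertVec_update_left h x i j' _ _ hj',
          lx x (G (block h x i)) j' hj']
        exact hf.balanced e he _ _ _ hjj
      · rw [block_update_mid h x i j' _ hj' (by omega), insertVec_update_mid h x i j' _ _ hj' (by omega),
          bx x j' hj' (by omega), gl e he _ _ (by simp only; omega), sx x _ (actL e)]
        exact hf.balanced e he _ _ _ (by simp only; omega)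
    rcases le_or_gt j.val (i.val + m) with hj2 | hj2
    · rw [block_update_mid h x i j _ hj hj2, insertVec_update_mid h x i j _ _ hj hj2, bx x j hj hj2]
      rcases le_or_gt j'.val (i.val + m) with hj' | hj'
      · rw [block_update_mid h x i j' _ (by omega) hj', insertVec_update_mid h x i j' _ _ (by omega) hj',
          bx x j' (by omega) hj', gb e he _ _ ⟨j'.val - i.val, by omega⟩ (by simp only; omega)]
      · rw [block_update_right h x i j' _ hj', insertVec_update_right h x i j' _ _ hj',
          rx x (G (block h x i)) j' hj', gr e he _ _ (by simp only; omega), sx x _ (actR e)]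
        exact hf.balanced e he _ _ _ (by simp only; omega)
    · rw [block_update_right h x i j _ hj2, insertVec_update_right h x i j _ _ hj2,
        block_update_right h x i j' _ (by omega), insertVec_update_right h x i j' _ _ (by omega),
        rx x (G (block h x i)) j hj2, rx x (G (block h x i)) j' (by omega)]
      exact hf.balanced e he _ _ _ (by simp only; omega)
  · intro e he x j hj0
    simp only [partialComp_apply]
    rcases lt_or_ge j.val i.val with hj | hj
    · rw [block_update_left h x i j _ hj, insertVec_update_left h x i j _ _ hj,
        lx x (G (block h x i)) j hj]
      exact hf.left e he _ _ hj0
    · rw [block_update_mid h x i j _ hj (by omega), insertVec_update_mid h x i j _ _ hj (by omega),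
        bx x j hj (by omega), gl e he _ _ (by simp only; omega), sx x _ (actL e)]
      exact hf.left e he _ _ (by omega)
  · intro e he x j hjN
    simp only [partialComp_apply]
    rcases le_or_gt j.val (i.val + m) with hj2 | hj2
    · rw [block_update_mid h x i j _ (by omega) hj2, insertVec_update_mid h x i j _ _ (by omega) hj2,
        bx x j (by omega) hj2, gr e he _ _ (by simp only; omega), sx x _ (actR e)]
      exact hf.right e he _ _ (by omega)
    · rw [block_update_right h x i j _ hj2, insertVec_update_right h x i j _ _ hj2,
        rx x (G (block h x i)) j hj2]
      exact hf.right e he _ _ (by simp only; omega)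

/-- The insertion `(f ∘_i g)(x_0, …, x_N) = f(x_0, …, π g(x_i, …, x_{i+m}), …, x_N)` of reduced
cochains. -/
noncomputable def reducedInsert {n m N : ℕ} (h : n + m = N) (i : Fin (n + 1))
    (f : ReducedCochain k V (n + 1)) (g : ReducedCochain k V (m + 1)) :
    ReducedCochain k V (N + 1) :=
  ⟨partialComp h i f.1 ((radProj k V).compMultilinearMap g.1),
    isBimoduleHom_partialComp h i f.1 g.1 f.2 g.2⟩

variable (k V)

/-- The operation `f ∘_R g = ∑_i (-1)^{i m} f ∘_i g` on reduced cochains, `i = 0, …, n`. -/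
noncomputable def reducedCirc (n m N : ℕ) (h : n + m = N) :
    ReducedCochain k V (n + 1) →ₗ[k] ReducedCochain k V (m + 1) →ₗ[k] ReducedCochain k V (N + 1) :=
  LinearMap.mk₂ k (fun f g => ∑ i : Fin (n + 1), (-1 : k) ^ (i.val * m) • reducedInsert h i f g)
    (fun f f' g => by
      have : ∀ i, reducedInsert h i (f + f') g = reducedInsert h i f g + reducedInsert h i f' g :=
        fun i => rfl
      simp only [this, smul_add, Finset.sum_add_distrib])
    (fun c f g => by
      have : ∀ i, reducedInsert h i (c • f) g = c • reducedInsert h i f g := fun i => rfl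
      simp only [this, Finset.smul_sum, smul_comm c])
    (fun f g g' => by
      have : ∀ i, reducedInsert h i f (g + g') = reducedInsert h i f g + reducedInsert h i f g' := by
        intro i
        refine Subtype.ext ?_
        have e : (radProj k V).compMultilinearMap (g + g').1 =
            (radProj k V).compMultilinearMap g.1 + (radProj k V).compMultilinearMap g'.1 := by
          ext x; exact congrArg Subtype.val ((radProj k V).map_add _ _)
        simp only [reducedInsert, e, partialComp_add_right]
        rfl
      simp only [this, smul_add, Finset.sum_add_distrib])
    (fun c f g => by
      have : ∀ i, reducedInsert h i f (c • g) = c • reducedInsert h i f g := by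
        intro i
        refine Subtype.ext ?_
        have e : (radProj k V).compMultilinearMap (c • g).1 =
            c • (radProj k V).compMultilinearMap g.1 := by
          ext x; exact congrArg Subtype.val ((radProj k V).map_smul _ _)
        simp only [reducedInsert, e, partialComp_smul_right]
        rfl
      simp only [this, Finset.smul_sum, smul_comm c])

/-- The reduced bracket; elements of `C^{n+1}_E(r, A)` have degree `n`. -/
noncomputable def reducedBracket (n m : ℕ) :
    ReducedCochain k V (n + 1) →ₗ[k] ReducedCochain k V (m + 1) →ₗ[k]
      ReducedCochain k V (n + m + 1) :=
  gradedCommutator (L := fun n => ReducedCochain k V (n + 1)) (reducedCirc k V) n m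

/-- The comparison map `p^n : C^n_E(r, A) → C^n(A, A)`,
`(p^n f)(x_1, …, x_n) = f(π x_1, …, π x_n)`. -/
noncomputable def comparison (n : ℕ) :
    ReducedCochain k V n →ₗ[k] HochschildCochain k (RadSqAlg k V) n where
  toFun f := f.1.compLinearMap fun _ => radProj k V
  map_add' _ _ := rfl
  map_smul' _ _ := rfl

variable {V}

/-- The class in `r` of an arrow. -/
noncomputable def arrowClass (a : Quiver.Total V) : rad k V :=
  ⟨pathClass k (QPath.ofArrow a), Submodule.subset_span ⟨_, rfl, rfl⟩⟩

end Reduced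

/-! ### The combinatorial complex and the combinatorial bracket -/

section Combinatorial

variable (k : Type w) [Field k] (V : Type u) [Quiver.{v + 1} V]

/-- The set `Q_n` of the paths of length `n`. -/
def pathsOfLength (n : ℕ) : Set (QPath V) := {p | p.length = n}

variable {V} in
/-- The set `X ∥ Y` of the pairs of parallel paths, for sets of paths `X` and `Y`. -/
def parallelPairs (X Y : Set (QPath V)) : Set (QPath V × QPath V) :=
  {c | c.1 ∈ X ∧ c.2 ∈ Y ∧ c.1.Parallel c.2}

/-- The set `Q_n ∥ Q_0 ∪ Q_1`. -/
abbrev basisPairs (n : ℕ) : Set (QPath V × QPath V) :=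
  parallelPairs (pathsOfLength V n) (pathsOfLength V 0 ∪ pathsOfLength V 1)

/-- The space `C^n(Q) = k(Q_n ∥ Q_0 ∪ Q_1) = k(Q_n ∥ Q_0) ⊕ k(Q_n ∥ Q_1)`. -/
abbrev QuiverCochain (n : ℕ) : Type _ := ↥(basisPairs V n) →₀ k

variable {V}

lemma subst_mem {n m N : ℕ} (h : n + m = N) {α β x : QPath V} {i : ℕ} {a : Quiver.Total V}
    (hα : (α, x) ∈ basisPairs V (n + 1)) (hβ : (β, QPath.ofArrow a) ∈ basisPairs V (m + 1))
    (ha : α.arrows[i]? = some a) : (α.subst i β, x) ∈ basisPairs V (N + 1) := by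
  refine ⟨?_, hα.2.1, hα.2.2⟩
  have h1 := QPath.length_subst α β i a ha hβ.2.2
  have h2 : α.length = n + 1 := hα.1
  have h3 : β.length = m + 1 := hβ.1
  change (α.subst i β).length = N + 1
  omega

open Classical in
/-- The element `(α, x) ∘_i (β, y) = δ_{a_i, y} (α ⋄_i β, x)` for `α = a_0 ⋯ a_n`, where `α ⋄_i β` is
obtained by replacing the arrow `a_i` of `α` by the path `β`. -/
noncomputable def pairInsert {n m N : ℕ} (h : n + m = N) (i : Fin (n + 1))
    (c : basisPairs V (n + 1)) (d : basisPairs V (m + 1)) : QuiverCochain k V (N + 1) :=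
  if hd : ∃ a, c.1.1.arrows[i.val]? = some a ∧ d.1.2 = QPath.ofArrow a then
    Finsupp.single ⟨(c.1.1.subst i.val d.1.1, c.1.2), by
      obtain ⟨a, ha, hy⟩ := hd
      exact subst_mem h c.2 (by rw [← hy]; exact d.2) ha⟩ 1
  else 0

variable (V)

/-- The bilinear operation with `(α, x) ∘ (β, y) = ∑_i (-1)^{i m} (α, x) ∘_i (β, y)` for
`α` of length `n + 1` and `β` of length `m + 1`, `i = 0, …, n`. -/
noncomputable def quiverCirc (n m N : ℕ) (h : n + m = N) :
    QuiverCochain k V (n + 1) →ₗ[k] QuiverCochain k V (m + 1) →ₗ[k] QuiverCochain k V (N + 1) :=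
  Finsupp.linearCombination k fun c => Finsupp.linearCombination k fun d =>
    ∑ i : Fin (n + 1), (-1 : k) ^ (i.val * m) • pairInsert k h i c d

/-- The combinatorial bracket `[-, -]_Q`; elements of `C^{n+1}(Q)` have degree `n`. -/
noncomputable def quiverBracket (n m : ℕ) :
    QuiverCochain k V (n + 1) →ₗ[k] QuiverCochain k V (m + 1) →ₗ[k] QuiverCochain k V (n + m + 1) :=
  gradedCommutator (L := fun n => QuiverCochain k V (n + 1)) (quiverCirc k V) n m

variable {V}

lemma leftPair_mem {n : ℕ} (c : basisPairs V n) (hc : c.1.2.length = 0) {s : V}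
    (a : s ⟶ c.1.1.src) :
    ((QPath.ofArrow ⟨s, _, a⟩).concat c.1.1 rfl, QPath.ofArrow ⟨s, _, a⟩) ∈
      basisPairs V (n + 1) := by
  have hst : c.1.2.src = c.1.2.tgt := Quiver.Path.eq_of_length_zero c.1.2.path hc
  have hs : c.1.1.src = c.1.2.src := c.2.2.2.1
  have ht : c.1.1.tgt = c.1.2.tgt := c.2.2.2.2
  have hl : c.1.1.length = n := c.2.1
  refine ⟨?_, Or.inr rfl, rfl, ?_⟩
  · exact (QPath.length_concat _ _ rfl).trans ((congrArg (1 + ·) hl).trans (Nat.add_comm 1 n))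
  · exact ht.trans (hst.symm.trans hs.symm)

lemma rightPair_mem {n : ℕ} (c : basisPairs V n) (hc : c.1.2.length = 0) {t : V}
    (a : c.1.1.tgt ⟶ t) :
    (c.1.1.concat (QPath.ofArrow ⟨_, t, a⟩) rfl, QPath.ofArrow ⟨_, t, a⟩) ∈
      basisPairs V (n + 1) := by
  have hst : c.1.2.src = c.1.2.tgt := Quiver.Path.eq_of_length_zero c.1.2.path hc
  have hs : c.1.1.src = c.1.2.src := c.2.2.2.1
  have ht : c.1.1.tgt = c.1.2.tgt := c.2.2.2.2
  have hl : c.1.1.length = n := c.2.1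
  refine ⟨?_, Or.inr rfl, ?_, rfl⟩
  · exact (QPath.length_concat _ _ rfl).trans (congrArg (· + 1) hl)
  · exact hs.trans (hst.trans ht.symm)

open Classical in
/-- The element `D_n(γ, e) = ∑_a (aγ, a) + (-1)^{n+1} ∑_a (γa, a)` for `(γ, e) ∈ Q_n ∥ Q_0`, where
the first sum is over the arrows `a` for which `aγ` is a path and the second one over those for
which `γa` is a path; it is zero on `Q_n ∥ Q_1`. -/
noncomputable def pairD [Fintype V] [∀ s t : V, Fintype (s ⟶ t)] (n : ℕ) (c : basisPairs V n) :
    QuiverCochain k V (n + 1) :=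
  if hc : c.1.2.length = 0 then
    (∑ s : V, ∑ a : s ⟶ c.1.1.src, Finsupp.single ⟨_, leftPair_mem c hc a⟩ 1) +
      (-1 : k) ^ (n + 1) • ∑ t : V, ∑ a : c.1.1.tgt ⟶ t, Finsupp.single ⟨_, rightPair_mem c hc a⟩ 1
  else 0

variable (V)

/-- The differential of the complex `C^•(Q)`. -/
noncomputable def quiverD [Fintype V] [∀ s t : V, Fintype (s ⟶ t)] (n : ℕ) :
    QuiverCochain k V n →ₗ[k] QuiverCochain k V (n + 1) :=
  Finsupp.linearCombination k (pairD k n)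

end Combinatorial

end RadSq

open RadSq

/-! All three brackets are restrictions of one. The comparison `p` is injective because `π` is the
identity on `r`, and `p f` applies `π` to each of its arguments, so inserting `p g` into `p f` is
the same as inserting `π g` into `f`: circle products are preserved on the nose
(`comparison_reducedCirc`). The map `Φ` is injective and turns `∘_i` on pairs into the reduced
insertion (`toReduced_pairInsert`): `π` kills `y` if it is a vertex, and compares it with `a_i` if
it is an arrow. Hence the graded Lie axioms need a proof only for the Gerstenhaber bracket. There
they come from the pre-Lie identity: in `(F ∘ G) ∘ H` the operation `H` lands inside `G`, which
gives `F ∘ (G ∘ H)`, or to the left or to the right of `G`, and these last two parts are exchanged,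
up to sign, when `G` and `H` are (`seqCirc_associator`). No step divides by 2 or 3.

The Hochschild differential is, up to sign, the bracket with the multiplication `μ`. So it is a
derivation of the bracket by the Jacobi identity, it squares to zero because `μ ∘ μ = 0`, and the
bracket descends to cohomology.

On a reduced cochain the inner terms of the Hochschild differential telescope. Because `r² = 0`,
each contraction `x_i x_{i+1}` splits under `π` into two halves in which a component from `E` acts
on a neighbour in `r`, and balancing over `E` matches the halves of consecutive contractions. Only
the outer terms `π(x_0) f` and `f π(x_n)` remain (`hochschildD_comparison`), which is the
differential `D` written with arrows.

The comparison is a quasi-isomorphism by one statement: a cochain whose differential is reduced is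
itself reduced up to a coboundary (`exists_isReduced_sub`). Applied to cocycles it gives
surjectivity on cohomology, applied to primitives of reduced cochains it gives injectivity. Its
proof is a dimension shift. Currying the last variable moves the problem to coefficients in `Hom(A,
M)` with a twisted right action, and averaging over the vertex idempotents, `φ ↦ ∑ φ(e_j) e_j`,
provides the coboundary that makes the last variable relative to `E`. The lower arity and the
smaller coefficient bimodule `relativeHom` are then handled by induction.

The bracket on the cohomology of `C(Q)` needs no separate computation: an injective chain map that
is injective on cohomology lets the bracket on `HH` be pulled back
(`IsInducedBracket.exists_of_quasiIso`). -/

namespace RadSq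

/-! ### Graded Lie brackets on subobjects and quotients -/

section GradedTransfer

variable {k : Type*} [CommRing k] {L L' : ℕ → Type*}
  [∀ n, AddCommGroup (L n)] [∀ n, Module k (L n)] [∀ n, AddCommGroup (L' n)] [∀ n, Module k (L' n)]
  {b : ∀ n m : ℕ, L n →ₗ[k] L m →ₗ[k] L (n + m)}
  {b' : ∀ n m : ℕ, L' n →ₗ[k] L' m →ₗ[k] L' (n + m)}

/-- A graded bracket that embeds into a graded Lie algebra is a graded Lie bracket. -/
theorem IsGradedLie.of_injective (φ : ∀ n, L n →ₗ[k] L' n) (hφ : ∀ n, Function.Injective (φ n))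
    (hb : ∀ n m x y, φ (n + m) (b n m x y) = b' n m (φ n x) (φ m y)) (h : IsGradedLie k L' b') :
    IsGradedLie k L b where
  antisymm n m x y := by
    -- The two sides have types `L (n + m)` and `L (m + n)`, so they are compared in the direct sum,
    -- on which `φ` induces an injective map.
    apply (DirectSum.lmap_injective (f := φ)).2 hφ
    simpa only [map_neg, map_smul, DirectSum.lmap_lof, hb] using h.antisymm n m (φ n x) (φ m y)
  jacobi n m l x y z := by
    apply (DirectSum.lmap_injective (f := φ)).2 hφ
    simpa only [map_add, map_smul, DirectSum.lmap_lof, hb] using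
      h.jacobi n m l (φ n x) (φ m y) (φ l z)
  even_self n x hn := hφ _ (by rw [hb, h.even_self n _ hn, map_zero])
  odd_self n x hn := hφ _ (by rw [hb, hb, h.odd_self n _ hn, map_zero])

/-- A graded bracket onto which a graded Lie algebra maps is a graded Lie bracket. -/
theorem IsGradedLie.of_surjective (φ : ∀ n, L n →ₗ[k] L' n) (hφ : ∀ n, Function.Surjective (φ n))
    (hb : ∀ n m x y, φ (n + m) (b n m x y) = b' n m (φ n x) (φ m y)) (h : IsGradedLie k L b) :
    IsGradedLie k L' b' where
  antisymm n m x y := by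
    obtain ⟨x, rfl⟩ := hφ n x
    obtain ⟨y, rfl⟩ := hφ m y
    simpa only [map_neg, map_smul, DirectSum.lmap_lof, hb] using
      congrArg (DirectSum.lmap φ) (h.antisymm n m x y)
  jacobi n m l x y z := by
    obtain ⟨x, rfl⟩ := hφ n x
    obtain ⟨y, rfl⟩ := hφ m y
    obtain ⟨z, rfl⟩ := hφ l z
    simpa only [map_add, map_smul, DirectSum.lmap_lof, hb] using
      congrArg (DirectSum.lmap φ) (h.jacobi n m l x y z)
  even_self n x hn := by
    obtain ⟨x, rfl⟩ := hφ n x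
    rw [← hb, h.even_self n x hn, map_zero]
  odd_self n x hn := by
    obtain ⟨x, rfl⟩ := hφ n x
    rw [← hb, ← hb, h.odd_self n x hn, map_zero]

end GradedTransfer

/-! ### Brackets induced on cohomology -/

section InducedBracket

variable {k : Type*} [CommRing k] {C : ℕ → Type*} [∀ n, AddCommGroup (C n)] [∀ n, Module k (C n)]
  {d : ∀ n, C n →ₗ[k] C (n + 1)}

lemma cohomologyClass_eq_zero_iff {n : ℕ} (z : C n) (hz : z ∈ cocycles d n) :
    cohomologyClass d n z hz = 0 ↔ z ∈ coboundaries d n :=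
  Submodule.Quotient.mk_eq_zero _

lemma cohomologyClass_surjective {n : ℕ} (c : Cohomology d n) :
    ∃ (z : C n) (hz : z ∈ cocycles d n), cohomologyClass d n z hz = c := by
  obtain ⟨⟨z, hz⟩, rfl⟩ := Submodule.Quotient.mk_surjective _ c
  exact ⟨z, hz, rfl⟩

/-- The bracket of cocycles, for a bracket of cochains that preserves cocycles. -/
def cocycleBracket (b : ∀ n m : ℕ, C (n + 1) →ₗ[k] C (m + 1) →ₗ[k] C (n + m + 1))
    (hZ : ∀ n m x y, x ∈ cocycles d (n + 1) → y ∈ cocycles d (m + 1) →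
      b n m x y ∈ cocycles d (n + m + 1)) (n m : ℕ) :
    cocycles d (n + 1) →ₗ[k] cocycles d (m + 1) →ₗ[k] cocycles d (n + m + 1) :=
  LinearMap.mk₂ k (fun x y => ⟨b n m x y, hZ n m x y x.2 y.2⟩)
    (fun x x' y => Subtype.ext (by simp)) (fun c x y => Subtype.ext (by simp))
    (fun x y y' => Subtype.ext (by simp)) (fun c x y => Subtype.ext (by simp))

/-- A bracket of cochains that preserves cocycles and, on cocycles, coboundaries in each variable
induces a bracket in cohomology. -/
theorem exists_isInducedBracket
    (b : ∀ n m : ℕ, C (n + 1) →ₗ[k] C (m + 1) →ₗ[k] C (n + m + 1))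
    (hZ : ∀ n m x y, x ∈ cocycles d (n + 1) → y ∈ cocycles d (m + 1) →
      b n m x y ∈ cocycles d (n + m + 1))
    (hBl : ∀ n m x y, x ∈ coboundaries d (n + 1) → y ∈ cocycles d (m + 1) →
      b n m x y ∈ coboundaries d (n + m + 1))
    (hBr : ∀ n m x y, x ∈ cocycles d (n + 1) → y ∈ coboundaries d (m + 1) →
      b n m x y ∈ coboundaries d (n + m + 1)) :
    ∃ B : ∀ n m : ℕ, Cohomology d (n + 1) →ₗ[k] Cohomology d (m + 1) →ₗ[k]
        Cohomology d (n + m + 1), IsInducedBracket d b B := by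
  let q : ∀ n, cocycles d n →ₗ[k] Cohomology d n := fun n => Submodule.mkQ _
  -- The bracket descends first in the second variable, for a fixed cocycle `x`, and then in `x`.
  refine ⟨fun n m => Submodule.liftQ _ (LinearMap.mk₂ k
      (fun x c => Submodule.liftQ _ ((q (n + m + 1)).comp (cocycleBracket b hZ n m x)) ?_ c)
      ?_ ?_ ?_ ?_) ?_, ?_⟩
  · intro y hy
    exact (Submodule.Quotient.mk_eq_zero _).2 (hBr n m x y x.2 hy)
  · intro x x' c
    obtain ⟨y, rfl⟩ := Submodule.mkQ_surjective _ c
    simp only [map_add, LinearMap.add_apply, Submodule.mkQ_apply, Submodule.liftQ_apply, LinearMap.comp_apply]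
    rfl
  · intro a x c
    obtain ⟨y, rfl⟩ := Submodule.mkQ_surjective _ c
    simp only [map_smul, LinearMap.smul_apply, Submodule.mkQ_apply, Submodule.liftQ_apply, LinearMap.comp_apply]
    rfl
  · intro x c c'
    simp
  · intro a x c
    simp
  · intro x hx
    rw [LinearMap.mem_ker]
    refine LinearMap.ext fun c => ?_
    obtain ⟨y, rfl⟩ := Submodule.mkQ_surjective _ c
    exact (Submodule.Quotient.mk_eq_zero _).2 (hBl n m x y hx y.2)
  · intro n m x y hx hy
    exact ⟨hZ n m x y hx hy, rfl⟩

/-- The bracket induced in cohomology by a graded Lie bracket is a graded Lie bracket. -/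
theorem IsGradedLie.cohomology
    {b : ∀ n m : ℕ, C (n + 1) →ₗ[k] C (m + 1) →ₗ[k] C (n + m + 1)}
    {B : ∀ n m : ℕ, Cohomology d (n + 1) →ₗ[k] Cohomology d (m + 1) →ₗ[k]
      Cohomology d (n + m + 1)}
    (h : IsGradedLie k (fun n => C (n + 1)) b) (hB : IsInducedBracket d b B) :
    IsGradedLie k (fun n => Cohomology d (n + 1)) B := by
  have hZ : ∀ n m x y, x ∈ cocycles d (n + 1) → y ∈ cocycles d (m + 1) →
      b n m x y ∈ cocycles d (n + m + 1) := fun n m x y hx hy => (hB n m x y hx hy).1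
  -- Cohomology is a subquotient: cocycles embed into cochains and surject onto classes, so the
  -- axioms pass through both transfers.
  have h1 : IsGradedLie k (fun n => cocycles d (n + 1)) (cocycleBracket b hZ) :=
    h.of_injective (fun n => (cocycles d (n + 1)).subtype) (fun n => Subtype.val_injective)
      fun _ _ _ _ => rfl
  refine h1.of_surjective (fun n => Submodule.mkQ _) (fun n => Submodule.mkQ_surjective _) ?_
  intro n m x y
  exact (hB n m x y x.2 y.2).2.symm

end InducedBracket

/-! ### The graded pre-Lie structure on multilinear maps -/

lemma neg_one_pow_congr {k : Type*} [CommRing k] {a b c : ℕ} (h : a = b + 2 * c) :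
    (-1 : k) ^ a = (-1) ^ b := by
  rw [h, pow_add, pow_mul, neg_one_sq, one_pow, mul_one]

/-! ### Insertion calculus on infinite sequences, where arities need no casts -/

section Sequences

variable {k M : Type*}

/-- The sequence `(x_0, …, x_{i-1}, t, x_{i+m}, x_{i+m+1}, …)`. -/
def splice (m i : ℕ) (x : ℕ → M) (t : M) : ℕ → M :=
  -- In the last branch `l > i ≥ 0`, so the subtraction is not truncated, even for `m = 0`, when an
  -- element is inserted as an operation without variables.
  fun l => if l < i then x l else if l = i then t else x (l + m - 1)

/-- Insertion of an operation `G` in `m` variables in the `i`-th variable of `F`. -/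
def seqInsert (m i : ℕ) (F G : (ℕ → M) → M) (x : ℕ → M) : M :=
  F (splice m i x (G fun q => x (i + q)))

/-- `F x` depends on the first `n` entries of `x` only. -/
def DependsOnFirst (n : ℕ) (F : (ℕ → M) → M) : Prop :=
  ∀ x y : ℕ → M, (∀ q < n, x q = y q) → F x = F y

/-- Since `j < m`, the operation `H` lands inside the block read by `G`; together they consume `m +
l - 1` entries and feed a single value to the `i`-th variable of `F`. -/
lemma seqInsert_seqInsert_nested (m l i j : ℕ) (hj : j < m) (F G H : (ℕ → M) → M) (x : ℕ → M) :
    seqInsert l (i + j) (seqInsert m i F G) H x =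
      F (splice (m + l - 1) i x (seqInsert l j G H fun q => x (i + q))) := by
  have h1 : (fun q => splice l (i + j) x (H fun q => x (i + j + q)) (i + q)) =
      splice l j (fun q => x (i + q)) (H fun q => x (i + (j + q))) := by
    funext q
    simp only [splice, add_assoc]
    split_ifs <;> first | rfl | omega | (congr 1; omega)
  unfold seqInsert
  rw [h1]
  congr 1
  funext q
  simp only [splice]
  split_ifs <;> first | rfl | omega | (congr 1; omega)

/-- The operation `H` sits strictly to the right of the block of `G`, whence the shift of its
position by `m - 1`. The block of `G` ends before the place where `H` is spliced in, so the order of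
the two insertions is irrelevant. -/
lemma seqInsert_seqInsert_disjoint (m l i j : ℕ) (hij : i < j) {F G H : (ℕ → M) → M}
    (hG : DependsOnFirst m G) (hH : DependsOnFirst l H) (x : ℕ → M) :
    seqInsert l (j + m - 1) (seqInsert m i F G) H x =
      seqInsert m i (seqInsert l j F H) G x := by
  unfold seqInsert
  have h1 : (G fun q => splice l (j + m - 1) x (H fun q => x (j + m - 1 + q)) (i + q)) =
      G fun q => x (i + q) := by
    apply hG
    intro q hq
    simp only [splice]
    rw [if_pos (by omega)]
  have h2 : (H fun q => splice m i x (G fun q => x (i + q)) (j + q)) =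
      H fun q => x (j + m - 1 + q) := by
    apply hH
    intro q hq
    simp only [splice]
    rw [if_neg (by omega), if_neg (by omega)]
    congr 1
    omega
  rw [h1, h2]
  congr 1
  funext q
  simp only [splice]
  split_ifs <;> first | rfl | omega | (congr 1; omega)

variable [CommRing k] [AddCommGroup M] [Module k M]

variable (k) in
/-- The signed sum of the insertions of `G` in the first `n` variables of `F`. -/
def seqCirc (n m : ℕ) (F G : (ℕ → M) → M) (x : ℕ → M) : M :=
  ∑ i ∈ Finset.range n, (-1 : k) ^ (i * (m + 1)) • seqInsert m i F G x

/-- Both sides run over the triangle `b < a < n`; on the right `a = b + 1 + q`. -/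
lemma sum_range_triangle {B : Type*} [AddCommMonoid B] (n : ℕ) (t : ℕ → ℕ → B) :
    ∑ a ∈ Finset.range n, ∑ b ∈ Finset.range a, t a b =
      ∑ b ∈ Finset.range n, ∑ q ∈ Finset.range (n - 1 - b), t (b + 1 + q) b := by
  have h := Finset.sum_Ico_Ico_comm' 0 n fun i j => t j i
  simp only [← Finset.range_eq_Ico] at h
  rw [← h]
  refine Finset.sum_congr rfl fun b _ => ?_
  rw [Finset.sum_Ico_eq_sum_range]
  congr 2
  omega

/-- The part of the associator of `F`, `G`, `H` where `H` is inserted to the left of `G`. -/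
def seqBrace (k : Type*) {M : Type*} [CommRing k] [AddCommGroup M] [Module k M]
    (n m l : ℕ) (F G H : (ℕ → M) → M) (x : ℕ → M) : M :=
  ∑ a ∈ Finset.range n, ∑ b ∈ Finset.range a,
    (-1 : k) ^ (a * (m + 1) + b * (l + 1)) • seqInsert l b (seqInsert m a F G) H x

/-- For `G` inserted at `i`, the position `j` of `H` satisfies `j < i`, `i ≤ j < i + m` or `i + m ≤
j`. The middle range gives `F ∘ (G ∘ H)` by linearity of `F` and cancels. The first range is a
brace, and the last one is the brace with `G` and `H` exchanged, because disjoint insertions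
commute. -/
lemma seqCirc_associator (n m l N₁ N₂ : ℕ) (h₁ : n + m = N₁ + 1) (h₂ : m + l = N₂ + 1)
    {F G H : (ℕ → M) → M} (hG : DependsOnFirst m G) (hH : DependsOnFirst l H)
    (hF : ∀ i < n, ∀ (x : ℕ → M) (c : ℕ → k) (t : ℕ → M),
      F (splice N₂ i x (∑ j ∈ Finset.range m, c j • t j)) =
        ∑ j ∈ Finset.range m, c j • F (splice N₂ i x (t j))) (x : ℕ → M) :
    seqCirc k N₁ l (seqCirc k n m F G) H x - seqCirc k n N₂ F (seqCirc k m l G H) x =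
      seqBrace k n m l F G H x + (-1 : k) ^ ((m + 1) * (l + 1)) • seqBrace k n l m F H G x := by
  have e1 : seqCirc k N₁ l (seqCirc k n m F G) H x =
      ∑ i ∈ Finset.range n, ∑ j ∈ Finset.range N₁,
        (-1 : k) ^ (i * (m + 1) + j * (l + 1)) • seqInsert l j (seqInsert m i F G) H x := by
    rw [Finset.sum_comm]
    unfold seqCirc
    refine Finset.sum_congr rfl fun j _ => ?_
    conv_lhs => rw [seqInsert]
    rw [Finset.smul_sum]
    refine Finset.sum_congr rfl fun i _ => ?_
    rw [smul_smul, ← pow_add, add_comm (j * _)]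
    rfl
  -- These are the terms with `H` inside `G`, at the absolute position `i + j`; the signs agree
  -- because the exponents differ by `2 * i`.
  have e2 : seqCirc k n N₂ F (seqCirc k m l G H) x =
      ∑ i ∈ Finset.range n, ∑ j ∈ Finset.range m,
        (-1 : k) ^ (i * (m + 1) + (i + j) * (l + 1)) •
          seqInsert l (i + j) (seqInsert m i F G) H x := by
    unfold seqCirc
    refine Finset.sum_congr rfl fun i hi => ?_
    rw [seqInsert, hF i (Finset.mem_range.1 hi), Finset.smul_sum]
    refine Finset.sum_congr rfl fun j hj => ?_
    have hj' := Finset.mem_range.1 hj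
    rw [seqInsert_seqInsert_nested m l i j hj', smul_smul, ← pow_add]
    have : m + l - 1 = N₂ := by omega
    rw [this]
    congr 1
    exact (neg_one_pow_congr (c := i) (by rw [← h₂]; ring)).symm
  -- These are the terms with `H` to the right of `G`, at the absolute position `i + m + q`. The
  -- prefactor accounts for the change of sign when the two insertions are reordered.
  have e3 : (-1 : k) ^ ((m + 1) * (l + 1)) • seqBrace k n l m F H G x =
      ∑ i ∈ Finset.range n, ∑ q ∈ Finset.range (n - 1 - i),
        (-1 : k) ^ (i * (m + 1) + (i + m + q) * (l + 1)) •
          seqInsert l (i + m + q) (seqInsert m i F G) H x := by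
    rw [seqBrace, sum_range_triangle, Finset.smul_sum]
    refine Finset.sum_congr rfl fun i _ => ?_
    rw [Finset.smul_sum]
    refine Finset.sum_congr rfl fun q _ => ?_
    have := seqInsert_seqInsert_disjoint m l i (i + 1 + q) (by omega) (F := F) hG hH x
    rw [show i + 1 + q + m - 1 = i + m + q by omega] at this
    rw [this, smul_smul, ← pow_add]
    congr 1
    exact neg_one_pow_congr (c := l + 1) (by ring)
  rw [e1, e2, e3, seqBrace, ← Finset.sum_sub_distrib, ← Finset.sum_add_distrib]
  refine Finset.sum_congr rfl fun i hi => ?_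
  have hi' := Finset.mem_range.1 hi
  have : N₁ = i + m + (n - 1 - i) := by omega
  -- The positions of `H` are cut at `i` and at `i + m`.
  rw [this, Finset.sum_range_add, Finset.sum_range_add]
  abel

/-- The graded pre-Lie identity: the associator is graded symmetric in the last two operations. -/
lemma seqCirc_preLie (n m l N₁ N₂ N₃ : ℕ) (h₁ : n + m = N₁ + 1) (h₂ : m + l = N₂ + 1)
    (h₃ : n + l = N₃ + 1)
    {F G H : (ℕ → M) → M} (hG : DependsOnFirst m G) (hH : DependsOnFirst l H)
    (hF : ∀ (m : ℕ), ∀ i < n, ∀ (x : ℕ → M) (r : ℕ) (c : ℕ → k) (t : ℕ → M),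
      F (splice m i x (∑ j ∈ Finset.range r, c j • t j)) =
        ∑ j ∈ Finset.range r, c j • F (splice m i x (t j))) (x : ℕ → M) :
    seqCirc k N₁ l (seqCirc k n m F G) H x - seqCirc k n N₂ F (seqCirc k m l G H) x =
      (-1 : k) ^ ((m + 1) * (l + 1)) •
        (seqCirc k N₃ m (seqCirc k n l F H) G x - seqCirc k n N₂ F (seqCirc k l m H G) x) := by
  -- The associator formula is symmetric under the exchange of `G` and `H` up to a sign whose square
  -- is one.
  rw [seqCirc_associator n m l N₁ N₂ h₁ h₂ hG hH (fun i hi x c t => hF _ i hi x _ c t),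
    seqCirc_associator n l m N₃ N₂ h₃ (by omega) hH hG (fun i hi x c t => hF _ i hi x _ c t),
    smul_add, smul_smul, mul_comm (l + 1), ← pow_add,
    neg_one_pow_congr (a := _ + _) (b := 0) (c := (m + 1) * (l + 1)) (by ring), pow_zero,
    one_smul, add_comm]

end Sequences

/-! ### Multilinear operations: circle product, commutator, Jacobi identity -/

section Operations

variable {k M : Type*} [CommRing k] [AddCommGroup M] [Module k M]

/-- The `k`-multilinear operations in `n` variables on `M`. -/
abbrev MultiOp (k M : Type*) [CommRing k] [AddCommGroup M] [Module k M] (n : ℕ) : Type _ :=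
  MultilinearMap k (fun _ : Fin n => M) M

/-- Extension of a vector by zeros. -/
def toSeq {N : ℕ} (x : Fin N → M) : ℕ → M := fun l => if h : l < N then x ⟨l, h⟩ else 0

lemma toSeq_val {N : ℕ} (x : Fin N → M) (i : Fin N) : toSeq x i = x i := dif_pos i.2

lemma toSeq_update {N : ℕ} [DecidableEq (Fin N)] (x : Fin N → M) (j : Fin N) (v : M) :
    toSeq (Function.update x j v) = Function.update (toSeq x) j v := by
  funext l
  by_cases hl : l < N
  · simp only [toSeq, dif_pos hl, Function.update_apply, Fin.ext_iff]
  · simp only [toSeq, dif_neg hl]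
    rw [Function.update_of_ne (by omega), toSeq, dif_neg hl]

/-- The evaluation of an operation at the first entries of a sequence. -/
def seqEval {n : ℕ} (f : MultiOp k M n) (x : ℕ → M) : M := f fun q => x q

lemma seqEval_toSeq {n : ℕ} (f : MultiOp k M n) (x : Fin n → M) : seqEval f (toSeq x) = f x :=
  congrArg f (funext (toSeq_val x))

lemma dependsOnFirst_seqEval {n : ℕ} (f : MultiOp k M n) : DependsOnFirst n (seqEval f) :=
  fun _ _ h => congrArg f (funext fun q => h q q.2)

lemma ext_seqEval {n : ℕ} {f g : MultiOp k M n} (h : ∀ x, seqEval f x = seqEval g x) : f = g := by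
  ext x
  rw [← seqEval_toSeq, h, seqEval_toSeq]

lemma seqEval_update {n : ℕ} (f : MultiOp k M n) (x : ℕ → M) (l : ℕ) (hl : l < n) (v : M) :
    seqEval f (Function.update x l v) = f.toLinearMap (fun q => x q) ⟨l, hl⟩ v := by
  refine congrArg f (funext fun q => ?_)
  simp only [Function.update_apply, Fin.ext_iff]

/-- The inserted value is a single coordinate, so multilinear maps are linear in it. -/
lemma splice_eq_update (m i : ℕ) (x : ℕ → M) (t : M) :
    splice m i x t = Function.update (splice m i x 0) i t := by
  funext l
  simp only [splice, Function.update_apply]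
  split_ifs <;> first | rfl | omega

lemma seqEval_splice {n : ℕ} (f : MultiOp k M n) (m i : ℕ) (hi : i < n) (x : ℕ → M) (t : M) :
    seqEval f (splice m i x t) = f.toLinearMap (fun q => splice m i x 0 q) ⟨i, hi⟩ t := by
  rw [splice_eq_update, seqEval_update]

lemma seqEval_splice_sum {n : ℕ} (f : MultiOp k M n) (m i : ℕ) (hi : i < n) (x : ℕ → M) (r : ℕ)
    (c : ℕ → k) (t : ℕ → M) :
    seqEval f (splice m i x (∑ j ∈ Finset.range r, c j • t j)) =
      ∑ j ∈ Finset.range r, c j • seqEval f (splice m i x (t j)) := by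
  simp only [seqEval_splice f m i hi, map_sum, map_smul]

/-- The entry `x_j` lies before the block of `g`, inside it or after it, and is accordingly a
variable of `f`, of `g`, or again of `f`. A linear map as witness yields additivity and homogeneity
of the insertion at once. -/
lemma exists_linear_seqInsert {n m : ℕ} (f : MultiOp k M n) (g : MultiOp k M m) (i : ℕ) (hi : i < n)
    (x : ℕ → M) (j : ℕ) (hj : j + 1 < n + m) :
    ∃ φ : M →ₗ[k] M, ∀ v,
      seqInsert m i (seqEval f) (seqEval g) (Function.update x j v) = φ v := by
  rcases lt_or_ge j i with h | h
  · refine ⟨f.toLinearMap (fun q => splice m i x (seqEval g fun q => x (i + q)) q) ⟨j, by omega⟩,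
      fun v => ?_⟩
    rw [← seqEval_update, seqInsert]
    congr 1
    have : (fun q => Function.update x j v (i + q)) = fun q => x (i + q) := by
      funext q; rw [Function.update_of_ne (by omega)]
    rw [this]
    funext l
    simp only [splice, Function.update_apply]
    split_ifs <;> first | rfl | omega
  rcases lt_or_ge j (i + m) with h' | h'
  · refine ⟨f.toLinearMap (fun q => splice m i x 0 q) ⟨i, hi⟩ ∘ₗ
      g.toLinearMap (fun q => x (i + q)) ⟨j - i, by omega⟩, fun v => ?_⟩
    rw [LinearMap.comp_apply, ← seqEval_splice, ← seqEval_update g (fun q => x (i + q)), seqInsert]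
    have : (fun q => Function.update x j v (i + q)) =
        Function.update (fun q => x (i + q)) (j - i) v := by
      funext q
      simp only [Function.update_apply]
      split_ifs <;> first | rfl | omega
    rw [this]
    congr 1
    funext l
    simp only [splice, Function.update_apply]
    split_ifs <;> first | rfl | omega
  · refine ⟨f.toLinearMap (fun q => splice m i x (seqEval g fun q => x (i + q)) q)
      ⟨j + 1 - m, by omega⟩, fun v => ?_⟩
    rw [← seqEval_update, seqInsert]
    have : (seqEval g fun q => Function.update x j v (i + q)) = seqEval g fun q => x (i + q) := by
      apply dependsOnFirst_seqEval
      intro q hq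
      exact Function.update_of_ne (by omega) _ _
    rw [this]
    congr 1
    funext l
    simp only [splice, Function.update_apply]
    split_ifs <;> first | rfl | omega

/-- The insertion of an operation in `m ≥ 0` variables into the `i`-th variable of an operation in
`n` variables. -/
def insertOp {n m N : ℕ} (h : n + m = N + 1) (i : Fin n) (f : MultiOp k M n) (g : MultiOp k M m) :
    MultiOp k M N :=
  MultilinearMap.mk' (fun x => seqInsert m i (seqEval f) (seqEval g) (toSeq x))
    (fun x j a b => by
      obtain ⟨φ, hφ⟩ := exists_linear_seqInsert f g i i.2 (toSeq x) j (by omega)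
      simp only [toSeq_update, hφ, map_add])
    (fun x j c a => by
      obtain ⟨φ, hφ⟩ := exists_linear_seqInsert f g i i.2 (toSeq x) j (by omega)
      simp only [toSeq_update, hφ, map_smul])

lemma insertOp_apply {n m N : ℕ} (h : n + m = N + 1) (i : Fin n) (f : MultiOp k M n)
    (g : MultiOp k M m) (x : Fin N → M) :
    insertOp h i f g x = seqInsert m i (seqEval f) (seqEval g) (toSeq x) := rfl

lemma seqEval_insertOp {n m N : ℕ} (h : n + m = N + 1) (i : Fin n) (f : MultiOp k M n)
    (g : MultiOp k M m) (x : ℕ → M) :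
    seqEval (insertOp h i f g) x = seqInsert m i (seqEval f) (seqEval g) x := by
  have hx : ∀ l < N, toSeq (fun q : Fin N => x q) l = x l := fun l hl => dif_pos hl
  rw [seqEval, insertOp_apply, seqInsert, seqInsert]
  have hg : (seqEval g fun q => toSeq (fun q : Fin N => x q) (i + q)) =
      seqEval g fun q => x (i + q) :=
    dependsOnFirst_seqEval g _ _ fun q hq => hx _ (by omega)
  rw [hg]
  apply dependsOnFirst_seqEval f
  intro q hq
  simp only [splice]
  split_ifs
  · exact hx _ (by omega)
  · rfl
  · exact hx _ (by omega)

/-- The signed sum `f ∘ g = ∑_i (-1)^{i (m - 1)} f ∘_i g` of the insertions of `g`. -/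
def opCirc (n m N : ℕ) (h : n + m = N + 1) :
    MultiOp k M n →ₗ[k] MultiOp k M m →ₗ[k] MultiOp k M N :=
  LinearMap.mk₂ k (fun f g => ∑ i : Fin n, (-1 : k) ^ (i.val * (m + 1)) • insertOp h i f g)
    (fun f f' g => by
      have : ∀ i, insertOp h i (f + f') g = insertOp h i f g + insertOp h i f' g := fun i => rfl
      simp only [this, smul_add, Finset.sum_add_distrib])
    (fun c f g => by
      have : ∀ i, insertOp h i (c • f) g = c • insertOp h i f g := fun i => rfl
      simp only [this, Finset.smul_sum, smul_comm c])
    (fun f g g' => by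
      have : ∀ i, insertOp h i f (g + g') = insertOp h i f g + insertOp h i f g' := by
        intro i
        refine ext_seqEval fun x => ?_
        change _ = seqEval (insertOp h i f g) x + seqEval (insertOp h i f g') x
        simp only [seqEval_insertOp, seqInsert, seqEval_splice f m i i.2, ← map_add]
        rfl
      simp only [this, smul_add, Finset.sum_add_distrib])
    (fun c f g => by
      have : ∀ i, insertOp h i f (c • g) = c • insertOp h i f g := by
        intro i
        refine ext_seqEval fun x => ?_
        change _ = c • seqEval (insertOp h i f g) x
        simp only [seqEval_insertOp, seqInsert, seqEval_splice f m i i.2, ← map_smul]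
        rfl
      simp only [this, Finset.smul_sum, smul_comm c])

lemma opCirc_apply {n m N : ℕ} (h : n + m = N + 1) (f : MultiOp k M n) (g : MultiOp k M m) :
    opCirc n m N h f g = ∑ i : Fin n, (-1 : k) ^ (i.val * (m + 1)) • insertOp h i f g := rfl

lemma seqEval_opCirc {n m N : ℕ} (h : n + m = N + 1) (f : MultiOp k M n) (g : MultiOp k M m)
    (x : ℕ → M) :
    seqEval (opCirc n m N h f g) x = seqCirc k n m (seqEval f) (seqEval g) x := by
  rw [seqCirc, ← Fin.sum_univ_eq_sum_range
    (fun i => (-1 : k) ^ (i * (m + 1)) • seqInsert m i (seqEval f) (seqEval g) x), opCirc_apply]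
  conv_lhs => rw [seqEval]
  rw [sum_apply]
  refine Finset.sum_congr rfl fun i _ => ?_
  rw [smul_apply, ← seqEval_insertOp h]
  rfl

/-- The intermediate arities are free variables tied by equations, so that the identity applies to
whatever form the arities take in the Jacobi identity. -/
lemma opCirc_preLie {n m l N₁ N₂ N₃ N : ℕ} (h₁ : n + m = N₁ + 1) (h₂ : m + l = N₂ + 1)
    (h₂' : l + m = N₂ + 1) (h₃ : n + l = N₃ + 1) (h₁' : N₁ + l = N + 1) (h₃' : N₃ + m = N + 1)
    (h₄ : n + N₂ = N + 1) (f : MultiOp k M n) (g : MultiOp k M m) (h : MultiOp k M l) :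
    opCirc N₁ l N h₁' (opCirc n m N₁ h₁ f g) h - opCirc n N₂ N h₄ f (opCirc m l N₂ h₂ g h) =
      (-1 : k) ^ ((m + 1) * (l + 1)) •
        (opCirc N₃ m N h₃' (opCirc n l N₃ h₃ f h) g -
          opCirc n N₂ N h₄ f (opCirc l m N₂ h₂' h g)) := by
  refine ext_seqEval fun x => ?_
  have e : ∀ (c : k) (a b : MultiOp k M N), seqEval (c • (a - b)) x =
    c • (seqEval a x - seqEval b x) := fun _ _ _ => rfl
  have e' : ∀ (a b : MultiOp k M N), seqEval (a - b) x = seqEval a x - seqEval b x :=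
    fun _ _ => rfl
  have s : ∀ {n m N : ℕ} (h : n + m = N + 1) (f : MultiOp k M n) (g : MultiOp k M m),
    seqEval (opCirc n m N h f g) = seqCirc k n m (seqEval f) (seqEval g) :=
    fun h f g => funext (seqEval_opCirc h f g)
  rw [e, e']
  simp only [s]
  exact seqCirc_preLie n m l N₁ N₂ N₃ h₁ h₂ h₃ (dependsOnFirst_seqEval g)
    (dependsOnFirst_seqEval h) (fun m i hi x r c t => seqEval_splice_sum f m i hi x r c t) x

/-- For `g` of even arity the two braces in the associator of `f, g, g` coincide and carry opposite
signs. The pre-Lie identity would give only twice this equality, which says nothing in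
characteristic two. -/
lemma opCirc_self_assoc {n m N₁ N₂ N : ℕ} (h₁ : n + m = N₁ + 1) (h₂ : m + m = N₂ + 1)
    (h₁' : N₁ + m = N + 1) (h₂' : n + N₂ = N + 1) (f : MultiOp k M n) (g : MultiOp k M m)
    (hm : Even m) :
    opCirc N₁ m N h₁' (opCirc n m N₁ h₁ f g) g =
      opCirc n N₂ N h₂' f (opCirc m m N₂ h₂ g g) := by
  rw [← sub_eq_zero]
  refine ext_seqEval fun x => ?_
  have e' : ∀ (a b : MultiOp k M N), seqEval (a - b) x = seqEval a x - seqEval b x :=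
    fun _ _ => rfl
  have s : ∀ {n m N : ℕ} (h : n + m = N + 1) (f : MultiOp k M n) (g : MultiOp k M m),
    seqEval (opCirc n m N h f g) = seqCirc k n m (seqEval f) (seqEval g) :=
    fun h f g => funext (seqEval_opCirc h f g)
  have hs : (-1 : k) ^ ((m + 1) * (m + 1)) = -1 :=
    Odd.neg_one_pow (Nat.odd_mul.2 ⟨hm.add_one, hm.add_one⟩)
  rw [e']
  simp only [s]
  rw [seqCirc_associator n m m N₁ N₂ h₁ h₂ (dependsOnFirst_seqEval g) (dependsOnFirst_seqEval g)
    (fun i hi x c t => seqEval_splice_sum f _ i hi x _ c t), hs, neg_one_smul, add_neg_cancel]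
  rfl

/-- The graded commutator `[f, g] = f ∘ g - (-1)^{(n-1)(m-1)} g ∘ f`. -/
def opBracket (n m N : ℕ) (h : n + m = N + 1) :
    MultiOp k M n →ₗ[k] MultiOp k M m →ₗ[k] MultiOp k M N :=
  -- The exponent has the parity of `(n - 1) * (m - 1)`, and stays correct for operations of arity
  -- zero, whose degree is `-1`.
  opCirc n m N h - (-1 : k) ^ ((n + 1) * (m + 1)) •
    (opCirc m n N ((Nat.add_comm m n).trans h)).flip

lemma opBracket_apply {n m N : ℕ} (h : n + m = N + 1) (h' : m + n = N + 1) (f : MultiOp k M n)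
    (g : MultiOp k M m) :
    opBracket n m N h f g =
      opCirc n m N h f g - (-1 : k) ^ ((n + 1) * (m + 1)) • opCirc m n N h' g f := rfl

lemma opBracket_antisymm {n m N : ℕ} (h : n + m = N + 1) (h' : m + n = N + 1) (f : MultiOp k M n)
    (g : MultiOp k M m) :
    opBracket n m N h f g = -((-1 : k) ^ ((n + 1) * (m + 1)) • opBracket m n N h' g f) := by
  rw [opBracket_apply h h', opBracket_apply h' h, mul_comm (m + 1)]
  rcases neg_one_pow_eq_or k ((n + 1) * (m + 1)) with e | e <;> rw [e] <;> module

/-- After expansion the associators group into three pre-Lie identities, with first entry `f`, `g`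
and `h` respectively. -/
lemma opBracket_jacobi {n m l N₁ N₂ N₃ N : ℕ} (h₁ : n + m = N₁ + 1) (h₂ : m + l = N₂ + 1)
    (h₃ : n + l = N₃ + 1) (h₁' : N₁ + l = N + 1) (h₂' : n + N₂ = N + 1) (h₃' : m + N₃ = N + 1)
    (f : MultiOp k M n) (g : MultiOp k M m) (h : MultiOp k M l) :
    opBracket n N₂ N h₂' f (opBracket m l N₂ h₂ g h) =
      opBracket N₁ l N h₁' (opBracket n m N₁ h₁ f g) h +
        (-1 : k) ^ ((n + 1) * (m + 1)) •
          opBracket m N₃ N h₃' g (opBracket n l N₃ h₃ f h) := by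
  have k₁ : m + n = N₁ + 1 := by omega
  have k₂ : l + m = N₂ + 1 := by omega
  have k₃ : l + n = N₃ + 1 := by omega
  have k₁' : l + N₁ = N + 1 := by omega
  have k₂' : N₂ + n = N + 1 := by omega
  have k₃' : N₃ + m = N + 1 := by omega
  have a₁ := opCirc_preLie h₁ h₂ k₂ h₃ h₁' k₃' h₂' f g h
  have a₂ := opCirc_preLie k₁ h₃ k₃ h₂ h₁' k₂' h₃' g f h
  have a₃ := opCirc_preLie k₃ h₁ k₁ k₂ k₃' k₂' k₁' h f g
  rw [opBracket_apply h₂' k₂', opBracket_apply h₁' k₁', opBracket_apply h₃' k₃',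
    opBracket_apply h₂ k₂, opBracket_apply h₁ k₁, opBracket_apply h₃ k₃]
  have s₁ : (-1 : k) ^ ((n + 1) * (N₂ + 1)) =
      (-1) ^ ((n + 1) * (m + 1)) * (-1) ^ ((n + 1) * (l + 1)) := by
    rw [← pow_add, ← h₂]
    exact (neg_one_pow_congr (c := n + 1) (by ring)).symm
  have s₂ : (-1 : k) ^ ((N₁ + 1) * (l + 1)) =
      (-1) ^ ((n + 1) * (l + 1)) * (-1) ^ ((m + 1) * (l + 1)) := by
    rw [← pow_add, ← h₁]
    exact (neg_one_pow_congr (c := l + 1) (by ring)).symm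
  have s₃ : (-1 : k) ^ ((m + 1) * (N₃ + 1)) =
      (-1) ^ ((n + 1) * (m + 1)) * (-1) ^ ((m + 1) * (l + 1)) := by
    rw [← pow_add, ← h₃]
    exact (neg_one_pow_congr (c := m + 1) (by ring)).symm
  rw [s₁, s₂, s₃]
  simp only [map_sub, map_smul, LinearMap.sub_apply, LinearMap.smul_apply] at a₁ a₂ a₃ ⊢
  -- Only the sign of the pair `f, g` has to be specialised to `±1`; the other two may stay
  -- indeterminate.
  generalize (-1 : k) ^ ((n + 1) * (l + 1)) = t at *
  generalize (-1 : k) ^ ((m + 1) * (l + 1)) = u at *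
  rcases neg_one_pow_eq_or k ((n + 1) * (m + 1)) with e₁ | e₁
  · rw [e₁] at a₃ ⊢
    linear_combination (norm := module) -a₁ + a₂ - (t * u) • a₃
  · rw [e₁] at a₃ ⊢
    linear_combination (norm := module) -a₁ - a₂ - (t * u) • a₃

lemma opBracket_self {n N : ℕ} (h : n + n = N + 1) (f : MultiOp k M n) (hn : ¬ Even n) :
    opBracket n n N h f f = 0 := by
  rw [opBracket_apply h h, Even.neg_one_pow, one_smul, sub_self]
  rw [Nat.even_mul, Nat.even_add_one]
  exact Or.inl hn

/-- For odd degree `[f, f]` is `f ∘ f + f ∘ f`, so the triple bracket is, up to sign, twice the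
associator of `f, f, f`. The pre-Lie identity says that this associator equals its own negative, so
no division by 3 is needed. -/
lemma opBracket_self_self {n N₁ N : ℕ} (h : n + n = N₁ + 1) (h' : n + N₁ = N + 1)
    (f : MultiOp k M n) (hn : Even n) :
    opBracket n N₁ N h' f (opBracket n n N₁ h f f) = 0 := by
  have hs : (-1 : k) ^ ((n + 1) * (n + 1)) = -1 := by
    apply Odd.neg_one_pow
    rw [Nat.odd_mul]
    exact ⟨hn.add_one, hn.add_one⟩
  have hs' : (-1 : k) ^ ((n + 1) * (N₁ + 1)) = 1 := by
    apply Even.neg_one_pow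
    rw [← h]
    exact Even.mul_left ⟨n, rfl⟩ _
  have k' : N₁ + n = N + 1 := by omega
  have a := opCirc_preLie h h h h k' k' h' f f f
  rw [opBracket_apply h h, opBracket_apply h' k', hs']
  rw [hs] at a ⊢
  simp only [map_sub, map_smul, LinearMap.sub_apply, LinearMap.smul_apply] at a ⊢
  linear_combination (norm := module) -a

end Operations

/-! ### The Gerstenhaber bracket and the Hochschild differential -/

section Gerstenhaber

variable {k A : Type*} [CommRing k] [Ring A] [Algebra k A]

/-- Passing to `insertOp` also admits operations of arity zero, which are needed as primitives of
coboundaries in `C^1(A, A)`. -/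
lemma partialComp_eq_insertOp {n m N : ℕ} (h : n + m = N) (h' : n + 1 + (m + 1) = N + 1 + 1)
    (i : Fin (n + 1)) (f : HochschildCochain k A (n + 1)) (g : HochschildCochain k A (m + 1)) :
    partialComp h i f g = insertOp h' i f g := by
  ext x
  have hx : ∀ (l : ℕ) (hl : l < N + 1), toSeq x l = x ⟨l, hl⟩ := fun l hl => dif_pos hl
  have hg : (seqEval g fun q => toSeq x (i + q)) = g (block h x i) :=
    congrArg g (funext fun q => hx _ (by omega))
  rw [partialComp_apply, insertOp_apply, seqInsert, hg]
  refine congrArg f (funext fun q => ?_)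
  simp only [insertVec, splice]
  split_ifs
  · rw [hx]
  · rfl
  · rw [hx _ (by omega)]
    congr 1

lemma hochschildCirc_eq_opCirc {n m N : ℕ} (h : n + m = N) (h' : n + 1 + (m + 1) = N + 1 + 1)
    (f : HochschildCochain k A (n + 1)) (g : HochschildCochain k A (m + 1)) :
    hochschildCirc k A n m N h f g = opCirc (n + 1) (m + 1) (N + 1) h' f g := by
  change ∑ i : Fin (n + 1), (-1 : k) ^ (i.val * m) • partialComp h i f g = _
  rw [opCirc_apply]
  refine Finset.sum_congr rfl fun i _ => ?_
  rw [partialComp_eq_insertOp h h', neg_one_pow_congr (a := i.val * (m + 1 + 1)) (c := i.val)]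
  ring

lemma gerstenhaberBracket_eq_opBracket {n m : ℕ} (h : n + 1 + (m + 1) = n + m + 1 + 1)
    (f : HochschildCochain k A (n + 1)) (g : HochschildCochain k A (m + 1)) :
    gerstenhaberBracket k A n m f g = opBracket (n + 1) (m + 1) (n + m + 1) h f g := by
  have h' : m + 1 + (n + 1) = n + m + 1 + 1 := by omega
  rw [opBracket_apply h h', ← hochschildCirc_eq_opCirc rfl, ← hochschildCirc_eq_opCirc
    (Nat.add_comm m n), neg_one_pow_congr (a := (n + 1 + 1) * (m + 1 + 1)) (b := n * m)
    (c := n + m + 2) (by ring)]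
  rfl

/-- This absorbs the equality of degrees, so that all terms of a Lie identity can be written in one
summand of the direct sum. -/
lemma lof_gerstenhaberBracket {n m N : ℕ} (hN : n + m = N) (h : n + 1 + (m + 1) = N + 1 + 1)
    (f : HochschildCochain k A (n + 1)) (g : HochschildCochain k A (m + 1)) :
    DirectSum.lof k ℕ (fun n => HochschildCochain k A (n + 1)) (n + m)
        (gerstenhaberBracket k A n m f g) =
      DirectSum.lof k ℕ (fun n => HochschildCochain k A (n + 1)) N
        (opBracket (n + 1) (m + 1) (N + 1) h f g) := by
  subst hN
  rw [gerstenhaberBracket_eq_opBracket h]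

/-- The Gerstenhaber bracket on the Hochschild cochains is a graded Lie bracket. -/
theorem isGradedLie_gerstenhaberBracket :
    IsGradedLie k (fun n => HochschildCochain k A (n + 1)) (gerstenhaberBracket k A) where
  antisymm n m x y := by
    rw [lof_gerstenhaberBracket (N := n + m) rfl (by omega),
      lof_gerstenhaberBracket (N := n + m) (by omega) (by omega),
      opBracket_antisymm (by omega) (by omega), map_neg, map_smul,
      neg_one_pow_congr (a := (n + 1 + 1) * (m + 1 + 1)) (b := n * m) (c := n + m + 2) (by ring)]
  jacobi n m l x y z := by
    have h₁ : n + 1 + (m + 1) = n + m + 1 + 1 := by omega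
    have h₂ : m + 1 + (l + 1) = m + l + 1 + 1 := by omega
    have h₃ : n + 1 + (l + 1) = n + l + 1 + 1 := by omega
    rw [gerstenhaberBracket_eq_opBracket h₁, gerstenhaberBracket_eq_opBracket h₂,
      gerstenhaberBracket_eq_opBracket h₃,
      lof_gerstenhaberBracket (N := n + m + l) (by omega) (by omega),
      lof_gerstenhaberBracket (N := n + m + l) (by omega) (by omega),
      lof_gerstenhaberBracket (N := n + m + l) (by omega) (by omega),
      opBracket_jacobi (N := n + m + l + 1) h₁ h₂ h₃ (by omega) (by omega) (by omega),
      map_add, map_smul,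
      neg_one_pow_congr (a := (n + 1 + 1) * (m + 1 + 1)) (b := n * m) (c := n + m + 2) (by ring)]
  even_self n x hn := by
    rw [gerstenhaberBracket_eq_opBracket (by omega), opBracket_self]
    rw [Nat.even_add_one]
    exact fun h => h hn
  odd_self n x hn := by
    rw [gerstenhaberBracket_eq_opBracket (n := n) (m := n + n) (by omega),
      gerstenhaberBracket_eq_opBracket (n := n) (m := n) (by omega), opBracket_self_self]
    exact hn.add_one

variable (k A) in
/-- The multiplication of an algebra, as a Hochschild cochain. -/
def mulCochain : HochschildCochain k A 2 :=
  MultilinearMap.mk' (fun x => x 0 * x 1)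
    (fun x j a b => by fin_cases j <;> simp [add_mul, mul_add])
    (fun x j c a => by fin_cases j <;> simp)

/-- The Hochschild differential is the bracket with the multiplication. -/
lemma hochschildD_eq_opBracket {n : ℕ} (h : 2 + n = n + 1 + 1) (f : HochschildCochain k A n) :
    hochschildD k A n f = (-1 : k) ^ (n + 1) • opBracket 2 n (n + 1) h (mulCochain k A) f := by
  rw [opBracket_apply h (by omega), opCirc_apply, opCirc_apply, Fin.sum_univ_two]
  ext x
  have hx : ∀ (l : ℕ) (hl : l < n + 1), toSeq x l = x ⟨l, hl⟩ := fun l hl => dif_pos hl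
  -- The two insertions of `f` into `μ` are the outer terms of the differential, and the insertions
  -- of `μ` into `f` are the contractions.
  have e0 : insertOp h 0 (mulCochain k A) f x = f (Fin.init x) * x (Fin.last n) := by
    change splice n 0 (toSeq x) (seqEval f fun q => toSeq x (0 + q)) 0 *
      splice n 0 (toSeq x) _ 1 = _
    simp only [splice]
    rw [if_neg (by omega), if_pos trivial, if_neg (by omega), if_neg (by omega), hx _ (by omega)]
    congr 1
    · refine congrArg f (funext fun q => ?_)
      exact (hx _ (by omega)).trans (congrArg x (Fin.ext (by simp)))
    · exact congrArg x (Fin.ext (by simp))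
  have e1 : insertOp h 1 (mulCochain k A) f x = x 0 * f (Fin.tail x) := by
    change splice n 1 (toSeq x) _ 0 *
      splice n 1 (toSeq x) (seqEval f fun q => toSeq x (1 + q)) 1 = _
    simp only [splice]
    rw [if_pos (by omega), if_neg (by omega), if_pos trivial, hx _ (by omega)]
    congr 1
    refine congrArg f (funext fun q => ?_)
    exact (hx _ (by omega)).trans (congrArg x (Fin.ext (by simp [Nat.add_comm])))
  have e2 : ∀ i : Fin n, insertOp (n := n) (m := 2) (N := n + 1) (by omega) i f (mulCochain k A) x =
      contractCochain f i x := by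
    intro i
    refine congrArg f (funext fun q => ?_)
    change splice 2 i (toSeq x) (toSeq x (i + 0) * toSeq x (i + 1)) q = _
    simp only [splice, Fin.contractNth, Fin.val_castSucc]
    split_ifs with h1 h2
    · rw [hx _ (by omega)]
      rfl
    · rw [hx _ (by omega), hx _ (by omega)]
      congr 2 <;> exact Fin.ext (by simp [h2])
    · rw [hx _ (by omega)]
      exact congrArg x (Fin.ext (by simp))
  have lhs : hochschildD k A n f x = x 0 * f (Fin.tail x) +
      (∑ i : Fin n, (-1 : k) ^ (i.val + 1) • contractCochain f i x) +
        (-1 : k) ^ (n + 1) • (f (Fin.init x) * x (Fin.last n)) := by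
    change (_ + ∑ i : Fin n, (-1 : k) ^ (i.val + 1) • contractCochain f i + _) x = _
    simp only [add_apply, sum_apply]
    rfl
  rw [lhs]
  simp only [smul_apply, sub_apply, add_apply, sum_apply, e0, e1, e2]
  have s1 : (-1 : k) ^ ((2 + 1) * (n + 1)) = (-1) ^ (n + 1) := neg_one_pow_congr (c := n + 1) (by ring)
  have s2 : ∀ i : Fin n, (-1 : k) ^ (i.val * (2 + 1)) • contractCochain f i x =
      -((-1 : k) ^ (i.val + 1) • contractCochain f i x) := fun i => by
    rw [neg_one_pow_congr (a := i.val * (2 + 1)) (b := i.val) (c := i.val) (by ring), pow_succ,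
      mul_neg_one, neg_smul, neg_neg]
  simp only [s1, s2, Finset.sum_neg_distrib, Fin.val_zero, Fin.val_one, zero_mul, one_mul,
    pow_zero, one_smul]
  rcases neg_one_pow_eq_or k (n + 1) with e | e <;> rw [e] <;> module

/-- The Hochschild differential is a graded derivation of the Gerstenhaber bracket. -/
lemma hochschildD_opBracket {n m N : ℕ} (h : n + m = N + 1) (h₁ : n + 1 + m = N + 1 + 1)
    (h₂ : n + (m + 1) = N + 1 + 1) (f : HochschildCochain k A n) (g : HochschildCochain k A m) :
    hochschildD k A N (opBracket n m N h f g) =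
      (-1 : k) ^ (m + 1) • opBracket (n + 1) m (N + 1) h₁ (hochschildD k A n f) g +
        opBracket n (m + 1) (N + 1) h₂ f (hochschildD k A m g) := by
  -- With the differential written as `±[μ, -]`, the claim is the Jacobi identity for `μ`, `f`, `g`.
  rw [hochschildD_eq_opBracket (by omega), hochschildD_eq_opBracket (n := n) (by omega),
    hochschildD_eq_opBracket (n := m) (by omega),
    opBracket_jacobi (N₁ := n + 1) (N₂ := N) (N₃ := m + 1) (N := N + 1) (by omega) h (by omega) h₁
      (by omega) h₂, map_smul, map_smul, LinearMap.smul_apply,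
      neg_one_pow_congr (a := (2 + 1) * (n + 1)) (b := n + 1) (c := n + 1) (by ring)]
  have s : (-1 : k) ^ (N + 1) = (-1) ^ (n + 1) * (-1) ^ (m + 1) := by
    rw [← pow_add, ← h]
    exact (neg_one_pow_congr (c := 1) (by ring)).symm
  rw [s]
  rcases neg_one_pow_eq_or k (n + 1) with e | e <;> rw [e] <;> module

/-- The two insertions of `μ` into itself are the two bracketings of a triple product and have
opposite signs. -/
lemma opCirc_mulCochain_self : opCirc 2 2 3 rfl (mulCochain k A) (mulCochain k A) = 0 := by
  ext x
  rw [opCirc_apply, Fin.sum_univ_two]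
  change (-1 : k) ^ (0 * (2 + 1)) • (x 0 * x 1 * x 2) +
    (-1 : k) ^ (1 * (2 + 1)) • (x 0 * (x 1 * x 2)) = 0
  rw [mul_assoc, zero_mul, pow_zero, neg_one_pow_congr (b := 1) (c := 1) (by ring)]
  module

/-- The Jacobi identity would determine only twice `[μ, [μ, f]]`. Instead the bracket is expanded:
the pre-Lie identity for `μ, μ, f` and the self-associativity `(f ∘ μ) ∘ μ = f ∘ (μ ∘ μ)` cancel all
terms, given `μ ∘ μ = 0`. -/
lemma hochschildD_comp_hochschildD (n : ℕ) (f : HochschildCochain k A n) :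
    hochschildD k A (n + 1) (hochschildD k A n f) = 0 := by
  have h₂ : n + 2 = n + 1 + 1 := rfl
  have h₂' : 2 + n = n + 1 + 1 := by omega
  have h₃ : n + 1 + 2 = n + 2 + 1 := rfl
  have h₃' : 2 + (n + 1) = n + 2 + 1 := by omega
  have h₄ : n + 3 = n + 2 + 1 := rfl
  have h₄' : 3 + n = n + 2 + 1 := by omega
  have a₁ := opCirc_preLie (n := 2) (m := 2) (l := n) (N₁ := 3) (N := n + 2) rfl h₂' h₂ h₂' h₄' h₃ h₃' (mulCochain k A)
    (mulCochain k A) f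
  have a₂ := opCirc_self_assoc (m := 2) (N := n + 2) h₂ rfl h₃ h₄ f (mulCochain k A) (by decide)
  rw [opCirc_mulCochain_self, map_zero] at a₂
  rw [opCirc_mulCochain_self, map_zero, LinearMap.zero_apply,
    neg_one_pow_congr (b := n + 1) (c := n + 1) (by ring)] at a₁
  rw [hochschildD_eq_opBracket h₃', hochschildD_eq_opBracket h₂', map_smul,
    opBracket_apply h₃' h₃, opBracket_apply h₂' h₂, map_sub, map_sub, map_smul, map_smul,
    LinearMap.sub_apply, LinearMap.smul_apply, a₂,
    neg_one_pow_congr (a := (2 + 1) * (n + 1)) (b := n + 1) (c := n + 1) (by ring),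
    neg_one_pow_congr (a := (2 + 1) * (n + 1 + 1)) (b := n + 1 + 1) (c := n + 2) (by ring),
    pow_succ _ (n + 1)]
  generalize (-1 : k) ^ (n + 1) = s at *
  linear_combination (norm := module) (s * s) • a₁

/-- The Gerstenhaber bracket induces a bracket in Hochschild cohomology. -/
theorem exists_isInducedBracket_gerstenhaberBracket :
    ∃ B : ∀ n m : ℕ, HH k A (n + 1) →ₗ[k] HH k A (m + 1) →ₗ[k] HH k A (n + m + 1),
      IsInducedBracket (hochschildD k A) (gerstenhaberBracket k A) B := by
  have hZ : ∀ n m (x : HochschildCochain k A (n + 1)) (y : HochschildCochain k A (m + 1)),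
      x ∈ cocycles (hochschildD k A) (n + 1) → y ∈ cocycles (hochschildD k A) (m + 1) →
      gerstenhaberBracket k A n m x y ∈ cocycles (hochschildD k A) (n + m + 1) := by
    intro n m x y hx hy
    rw [cocycles, LinearMap.mem_ker] at hx hy ⊢
    rw [gerstenhaberBracket_eq_opBracket (by omega),
      hochschildD_opBracket (by omega) (by omega) (by omega), hx, hy, map_zero, map_zero,
      LinearMap.zero_apply, smul_zero, add_zero]
  refine exists_isInducedBracket _ hZ ?_ ?_
  · rintro n m _ y ⟨x, rfl⟩ hy
    rw [cocycles, LinearMap.mem_ker] at hy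
    have h := hochschildD_opBracket (n := n) (m := m + 1) (N := n + m) (by omega) (by omega)
      (by omega) x y
    rw [hy, map_zero, add_zero] at h
    -- The primitive is `[x, y]` with the sign of the derivation rule. It is an `opBracket` because
    -- `x` may have arity zero.
    refine ⟨(-1 : k) ^ (m + 1 + 1) • opBracket n (m + 1) (n + m) (by omega) x y, ?_⟩
    rw [map_smul, h, smul_smul, ← pow_add, neg_one_pow_congr (b := 0) (c := m + 1 + 1) (by ring),
      pow_zero, one_smul, gerstenhaberBracket_eq_opBracket (by omega)]
  · rintro n m x _ hx ⟨y, rfl⟩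
    rw [cocycles, LinearMap.mem_ker] at hx
    have h := hochschildD_opBracket (n := n + 1) (m := m) (N := n + m) (by omega) (by omega)
      (by omega) x y
    rw [hx, map_zero, LinearMap.zero_apply, smul_zero, zero_add] at h
    refine ⟨opBracket (n + 1) m (n + m) (by omega) x y, ?_⟩
    rw [h, gerstenhaberBracket_eq_opBracket (by omega)]

end Gerstenhaber

/-! ### Hochschild cochains with coefficients, relative to orthogonal idempotents -/

section Bimodule

variable {k A M : Type*} [CommRing k] [Ring A] [Algebra k A] [AddCommGroup M] [Module k M]

/-- The maps `l` and `r` are a left and a right action of `A` on `M` which commute; the right action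
is unital. -/
structure IsBimodule (l r : A →ₗ[k] M →ₗ[k] M) : Prop where
  left_mul : ∀ a b m, l (a * b) m = l a (l b m)
  right_mul : ∀ a b m, r (a * b) m = r b (r a m)
  comm : ∀ a b m, l a (r b m) = r b (l a m)
  right_one : ∀ m, r 1 m = m

variable (l r : A →ₗ[k] M →ₗ[k] M)

/-- The Hochschild differential with coefficients in a bimodule. -/
def bimoduleD (n : ℕ) : MultilinearMap k (fun _ : Fin n => A) M →ₗ[k]
    MultilinearMap k (fun _ : Fin (n + 1) => A) M where
  toFun f :=
    MultilinearMap.mk' (fun x => l (x 0) (f (Fin.tail x)))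
      (by
        intro x j a b
        refine Fin.cases ?_ (fun j => ?_) j
        · simp [Fin.tail_update_zero]
        · simp [Fin.tail_update_succ, (Fin.succ_ne_zero j).symm])
      (by
        intro x j c a
        refine Fin.cases ?_ (fun j => ?_) j
        · simp [Fin.tail_update_zero]
        · simp [Fin.tail_update_succ, (Fin.succ_ne_zero j).symm]) +
    ∑ i : Fin n, (-1 : k) ^ (i.val + 1) •
      MultilinearMap.mk' (fun x => f (Fin.contractNth i.castSucc (· * ·) x))
        (by
          intro x j a b
          obtain ⟨q, φ, hq⟩ := contractNth_update (k := k) i x j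
          simp only [hq, map_add, f.map_update_add])
        (by
          intro x j c a
          obtain ⟨q, φ, hq⟩ := contractNth_update (k := k) i x j
          simp only [hq, map_smul, f.map_update_smul]) +
    (-1 : k) ^ (n + 1) • MultilinearMap.mk' (fun x => r (x (Fin.last n)) (f (Fin.init x)))
      (by
        intro x j a b
        refine Fin.lastCases ?_ (fun j => ?_) j
        · simp [Fin.init_update_last]
        · simp [Fin.init_update_castSucc, (Fin.castSucc_lt_last j).ne'])
      (by
        intro x j c a
        refine Fin.lastCases ?_ (fun j => ?_) j
        · simp [Fin.init_update_last]
        · simp [Fin.init_update_castSucc, (Fin.castSucc_lt_last j).ne'])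
  map_add' f g := by
    ext x
    simp only [MultilinearMap.mk'_apply, add_apply, sum_apply, smul_apply, map_add, smul_add,
      Finset.sum_add_distrib]
    abel
  map_smul' c f := by
    ext x
    simp only [MultilinearMap.mk'_apply, add_apply, sum_apply, smul_apply, map_smul, smul_add,
      Finset.smul_sum, RingHom.id_apply, smul_comm c]

lemma bimoduleD_apply (n : ℕ) (f : MultilinearMap k (fun _ : Fin n => A) M)
    (x : Fin (n + 1) → A) :
    bimoduleD l r n f x = l (x 0) (f (Fin.tail x)) +
      ∑ i : Fin n, (-1 : k) ^ (i.val + 1) • f (Fin.contractNth i.castSucc (· * ·) x) +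
      (-1 : k) ^ (n + 1) • r (x (Fin.last n)) (f (Fin.init x)) := by
  simp only [bimoduleD, LinearMap.coe_mk, AddHom.coe_mk, add_apply, sum_apply, smul_apply,
    MultilinearMap.mk'_apply]

lemma bimoduleD_mul_eq_hochschildD (n : ℕ) (f : HochschildCochain k A n) :
    bimoduleD (LinearMap.mul k A) (LinearMap.mul k A).flip n f = hochschildD k A n f := by
  ext x
  rw [bimoduleD_apply]
  change _ = (_ + ∑ i : Fin n, (-1 : k) ^ (i.val + 1) • contractCochain f i + _) x
  simp only [add_apply, sum_apply]
  rfl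

variable {l r}

/-- Compatibility of the differential with a left linear map between the coefficients. -/
lemma map_bimoduleD {M' : Type*} [AddCommGroup M'] [Module k M'] {l' r' : A →ₗ[k] M' →ₗ[k] M'}
    (t : M →ₗ[k] M') (hl : ∀ a m, t (l a m) = l' a (t m)) (n : ℕ)
    (f : MultilinearMap k (fun _ : Fin n => A) M) (x : Fin (n + 1) → A) :
    t (bimoduleD l r n f x) = bimoduleD l' r' n (t.compMultilinearMap f) x +
      (-1 : k) ^ (n + 1) • (t (r (x (Fin.last n)) (f (Fin.init x))) -
        r' (x (Fin.last n)) (t (f (Fin.init x)))) := by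
  rw [bimoduleD_apply, bimoduleD_apply]
  simp only [map_add, map_sum, map_smul, hl, LinearMap.compMultilinearMap_apply]
  module

variable (l r)

/-- The left action `(a φ)(x) = a φ(x)` on the linear maps `A → M`. -/
def homLeft : A →ₗ[k] (A →ₗ[k] M) →ₗ[k] (A →ₗ[k] M) :=
  (LinearMap.llcomp k A M M).comp l

/-- The right action `(φ a)(x) = φ(a x) - φ(a) x` on the linear maps `A → M`. -/
def homRight : A →ₗ[k] (A →ₗ[k] M) →ₗ[k] (A →ₗ[k] M) :=
  LinearMap.mk₂ k (fun a φ => φ.comp (LinearMap.mulLeft k a) - r.flip (φ a))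
    (fun a b φ => by ext x; simp [add_mul]; abel)
    (fun c a φ => by ext x; simp [smul_sub])
    (fun a φ ψ => by ext x; simp; abel)
    (fun c a φ => by ext x; simp [smul_sub])

@[simp] lemma homLeft_apply (a : A) (φ : A →ₗ[k] M) (x : A) : homLeft l a φ x = l a (φ x) := rfl

@[simp] lemma homRight_apply (a : A) (φ : A →ₗ[k] M) (x : A) :
    homRight r a φ x = φ (a * x) - r x (φ a) := rfl

/-- The isomorphism `Hom(A^{⊗ (n + 1)}, M) = Hom(A^{⊗ n}, Hom(A, M))` commutes with the
differentials. -/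
lemma curryRight_bimoduleD (n : ℕ) (f : MultilinearMap k (fun _ : Fin (n + 1) => A) M) :
    (bimoduleD l r (n + 1) f).curryRight =
      bimoduleD (homLeft l) (homRight r) n f.curryRight := by
  ext x a
  rw [MultilinearMap.curryRight_apply, bimoduleD_apply, bimoduleD_apply]
  simp only [LinearMap.add_apply, LinearMap.smul_apply, homLeft_apply, homRight_apply,
    LinearMap.coe_sum, Finset.sum_apply, MultilinearMap.curryRight_apply, Fin.snoc_last,
    Fin.init_snoc]
  -- The last contraction, which multiplies the last entry of `x` by `a`, and the outer right term
  -- together form the twisted right action on the curried cochain.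
  rw [Fin.sum_univ_castSucc]
  have h0 : Fin.snoc (α := fun _ => A) x a 0 = x 0 := Fin.snoc_castSucc (i := 0) ..
  have h1 : Fin.tail (Fin.snoc (α := fun _ => A) x a) = Fin.snoc (α := fun _ => A) (Fin.tail x) a := by
    funext q
    refine Fin.lastCases ?_ (fun q => ?_) q
    · simp [Fin.tail]
    · rw [Fin.snoc_castSucc, Fin.tail, ← Fin.castSucc_succ, Fin.snoc_castSucc, Fin.tail]
  have h2 : ∀ i : Fin n, Fin.contractNth i.castSucc.castSucc (· * ·) (Fin.snoc (α := fun _ => A) x a) =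
      Fin.snoc (α := fun _ => A) (Fin.contractNth i.castSucc (· * ·) x) a := by
    intro i
    funext q
    refine Fin.lastCases ?_ (fun q => ?_) q
    · rw [Fin.contractNth_apply_of_gt _ _ _ _ (by simp), Fin.succ_last, Fin.snoc_last,
        Fin.snoc_last]
    · rw [Fin.snoc_castSucc]
      simp only [Fin.contractNth, Fin.val_castSucc, ← Fin.castSucc_succ, Fin.snoc_castSucc]
  have h3 : Fin.contractNth (Fin.last n).castSucc (· * ·) (Fin.snoc (α := fun _ => A) x a) =
      Fin.snoc (α := fun _ => A) (Fin.init x) (x (Fin.last n) * a) := by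
    funext q
    refine Fin.lastCases ?_ (fun q => ?_) q
    · rw [Fin.contractNth_apply_of_eq _ _ _ _ (by simp), Fin.succ_last, Fin.snoc_last,
        Fin.snoc_last, Fin.snoc_castSucc]
    · rw [Fin.contractNth_apply_of_lt _ _ _ _ (by simp), Fin.snoc_castSucc, Fin.snoc_castSucc,
        Fin.init]
  have h4 : Fin.snoc (α := fun _ => A) (Fin.init x) (x (Fin.last n)) = x := Fin.snoc_init_self x
  simp only [h0, h1, h2, h3, h4, Fin.val_castSucc, Fin.val_last]
  module

variable {ι : Type*} (e : ι → A)

/-- The multilinear map `f` vanishes if some argument is one of the idempotents `e_j`, and it is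
balanced over the subalgebra spanned by them. -/
structure IsReduced {n : ℕ} (f : MultilinearMap k (fun _ : Fin n => A) M) : Prop where
  vanish : ∀ (x : Fin n → A) (i : Fin n) (j : ι), x i = e j → f x = 0
  balanced : ∀ (j : ι) (x : Fin n → A) (i i' : Fin n), i'.val = i.val + 1 →
    f (Function.update x i (x i * e j)) = f (Function.update x i' (e j * x i'))
  left : ∀ (j : ι) (x : Fin n → A) (i : Fin n), i.val = 0 →
    f (Function.update x i (e j * x i)) = l (e j) (f x)
  right : ∀ (j : ι) (x : Fin n → A) (i : Fin n), i.val + 1 = n →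
    f (Function.update x i (x i * e j)) = r (e j) (f x)
  zero : n = 0 → ∀ (j : ι) (x : Fin n → A), l (e j) (f x) = r (e j) (f x)

/-- The linear maps `φ : A → M` with `φ(x e_j) = φ(x) e_j` and `φ(e_j) = 0`. -/
def relativeHom : Submodule k (A →ₗ[k] M) where
  carrier := {φ | (∀ x j, φ (x * e j) = r (e j) (φ x)) ∧ ∀ j, φ (e j) = 0}
  add_mem' {φ ψ} hφ hψ := ⟨fun x j => by simp [hφ.1 x j, hψ.1 x j], fun j => by
    simp [hφ.2 j, hψ.2 j]⟩
  zero_mem' := ⟨fun _ _ => by simp, fun _ => rfl⟩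
  smul_mem' c φ hφ := ⟨fun x j => by simp [hφ.1 x j], fun j => by simp [hφ.2 j]⟩


end Bimodule

/-! ### Dimension shifting with relative homomorphisms -/

section RelativeHom

variable {k A M : Type*} [CommRing k] [Ring A] [Algebra k A] [AddCommGroup M] [Module k M]
  {l r : A →ₗ[k] M →ₗ[k] M} {ι : Type*} {e : ι → A}

lemma homLeft_mem (hb : IsBimodule l r) (a : A) (φ : A →ₗ[k] M) (hφ : φ ∈ relativeHom r e) :
    homLeft l a φ ∈ relativeHom r e :=
  ⟨fun x j => by rw [homLeft_apply, homLeft_apply, hφ.1, hb.comm], fun j => by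
    rw [homLeft_apply, hφ.2, map_zero]⟩

/-- The correction term of the twisted action makes `(φ a)(e_j) = φ(a e_j) - φ(a) e_j`, which
vanishes for relative `φ`. -/
lemma homRight_mem (hb : IsBimodule l r) (a : A) (φ : A →ₗ[k] M) (hφ : φ ∈ relativeHom r e) :
    homRight r a φ ∈ relativeHom r e :=
  ⟨fun x j => by
    rw [homRight_apply, homRight_apply, ← mul_assoc, hφ.1, hb.right_mul, map_sub], fun j => by
    rw [homRight_apply, hφ.1, sub_self]⟩

/-- The left action on `relativeHom`. -/
def relativeLeft (hb : IsBimodule l r) (e : ι → A) :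
    A →ₗ[k] relativeHom r e →ₗ[k] relativeHom r e :=
  LinearMap.mk₂ k (fun a φ => ⟨homLeft l a φ, homLeft_mem hb a φ φ.2⟩)
    (fun _ _ _ => Subtype.ext (by simp)) (fun _ _ _ => Subtype.ext (by simp))
    (fun _ _ _ => Subtype.ext (by simp)) (fun _ _ _ => Subtype.ext (by simp))

/-- The right action on `relativeHom`. -/
def relativeRight (hb : IsBimodule l r) (e : ι → A) :
    A →ₗ[k] relativeHom r e →ₗ[k] relativeHom r e :=
  LinearMap.mk₂ k (fun a φ => ⟨homRight r a φ, homRight_mem hb a φ φ.2⟩)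
    (fun _ _ _ => Subtype.ext (by simp)) (fun _ _ _ => Subtype.ext (by simp))
    (fun _ _ _ => Subtype.ext (by simp)) (fun _ _ _ => Subtype.ext (by simp))

lemma coe_relativeLeft (hb : IsBimodule l r) (a : A) (φ : relativeHom r e) :
    (relativeLeft hb e a φ : A →ₗ[k] M) = homLeft l a φ := rfl

lemma coe_relativeRight (hb : IsBimodule l r) (a : A) (φ : relativeHom r e) :
    (relativeRight hb e a φ : A →ₗ[k] M) = homRight r a φ := rfl

/-- A multilinear map with values in `relativeHom`, as a multilinear map in one more variable. -/
def relativeUncurry {n : ℕ} (g : MultilinearMap k (fun _ : Fin n => A) (relativeHom r e)) :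
    MultilinearMap k (fun _ : Fin (n + 1) => A) M :=
  ((relativeHom r e).subtype.compMultilinearMap g).uncurryRight

lemma relativeUncurry_apply {n : ℕ} (g : MultilinearMap k (fun _ : Fin n => A) (relativeHom r e))
    (x : Fin (n + 1) → A) :
    relativeUncurry g x = (g (Fin.init x) : A →ₗ[k] M) (x (Fin.last n)) := rfl

lemma relativeUncurry_snoc {n : ℕ} (g : MultilinearMap k (fun _ : Fin n => A) (relativeHom r e))
    (x : Fin n → A) (a : A) :
    relativeUncurry g (Fin.snoc (α := fun _ => A) x a) = (g x : A →ₗ[k] M) a := by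
  rw [relativeUncurry_apply, Fin.init_snoc, Fin.snoc_last]

/-- Since `φ(e_j) = 0`, the twisted action of an idempotent is just `(φ e_j)(x) = φ(e_j x)`.
Balancing across the last two variables therefore becomes the right condition on `g`, and for `n =
0` the left condition becomes commutation with the idempotents. -/
lemma IsReduced.of_relativeUncurry (hb : IsBimodule l r) {n : ℕ}
    {g : MultilinearMap k (fun _ : Fin n => A) (relativeHom r e)}
    (h : IsReduced l r e (relativeUncurry g)) :
    IsReduced (relativeLeft hb e) (relativeRight hb e) e g where
  vanish x i j hx := by
    refine Subtype.ext (LinearMap.ext fun a => ?_)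
    rw [← relativeUncurry_snoc]
    exact h.vanish _ i.castSucc j (by rw [Fin.snoc_castSucc, hx])
  balanced j x i i' hi := by
    refine Subtype.ext (LinearMap.ext fun a => ?_)
    rw [← relativeUncurry_snoc, ← relativeUncurry_snoc, Fin.snoc_update, Fin.snoc_update]
    have := h.balanced j (Fin.snoc (α := fun _ => A) x a) i.castSucc i'.castSucc hi
    rwa [Fin.snoc_castSucc, Fin.snoc_castSucc] at this
  left j x i hi := by
    refine Subtype.ext (LinearMap.ext fun a => ?_)
    rw [← relativeUncurry_snoc, Fin.snoc_update, coe_relativeLeft, homLeft_apply,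
      ← relativeUncurry_snoc]
    have := h.left j (Fin.snoc (α := fun _ => A) x a) i.castSucc hi
    rwa [Fin.snoc_castSucc] at this
  right j x i hi := by
    refine Subtype.ext (LinearMap.ext fun a => ?_)
    rw [← relativeUncurry_snoc, Fin.snoc_update, coe_relativeRight, homRight_apply, (g x).2.2,
      map_zero, sub_zero, ← relativeUncurry_snoc]
    have := h.balanced j (Fin.snoc (α := fun _ => A) x a) i.castSucc (Fin.last n) hi.symm
    rwa [Fin.snoc_castSucc, Fin.snoc_last, Fin.update_snoc_last] at this
  zero hn j x := by
    refine Subtype.ext (LinearMap.ext fun a => ?_)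
    subst hn
    rw [coe_relativeLeft, homLeft_apply, coe_relativeRight, homRight_apply, (g x).2.2, map_zero,
      sub_zero, ← relativeUncurry_snoc, ← relativeUncurry_snoc]
    have := h.left j (Fin.snoc (α := fun _ => A) x a) (Fin.last 0) rfl
    rw [Fin.snoc_last, Fin.update_snoc_last] at this
    exact this.symm

/-- The conditions on the new last variable are built into `relativeHom`; the remaining ones are the
dictionary of `IsReduced.of_relativeUncurry` read backwards. -/
lemma IsReduced.relativeUncurry (hb : IsBimodule l r) {n : ℕ}
    {g : MultilinearMap k (fun _ : Fin n => A) (relativeHom r e)}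
    (h : IsReduced (relativeLeft hb e) (relativeRight hb e) e g) :
    IsReduced l r e (relativeUncurry g) where
  vanish x i j := by
    refine Fin.lastCases (fun hx => ?_) (fun i hx => ?_) i
    · rw [relativeUncurry_apply, hx, (g _).2.2]
    · rw [relativeUncurry_apply, h.vanish (Fin.init x) i j hx]
      rfl
  balanced j x i i' := by
    refine Fin.lastCases (fun hi => ?_) (fun i => ?_) i
    · have := i'.2
      rw [Fin.val_last] at hi
      omega
    refine Fin.lastCases (fun hi => ?_) (fun i' hi => ?_) i'
    · have := h.right j (Fin.init x) i hi.symm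
      rw [relativeUncurry_apply, relativeUncurry_apply, Fin.init_update_castSucc,
        Fin.init_update_last, Function.update_self,
        Function.update_of_ne (Fin.castSucc_lt_last i).ne']
      change (g (Function.update (Fin.init x) i (Fin.init x i * e j)) : A →ₗ[k] M) _ = _
      rw [this, coe_relativeRight, homRight_apply, (g _).2.2, map_zero, sub_zero]
    · have := h.balanced j (Fin.init x) i i' hi
      rw [relativeUncurry_apply, relativeUncurry_apply, Fin.init_update_castSucc,
        Fin.init_update_castSucc, Function.update_of_ne (Fin.castSucc_lt_last i).ne',
        Function.update_of_ne (Fin.castSucc_lt_last i').ne']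
      exact congrArg (fun φ : relativeHom r e => (φ : A →ₗ[k] M) (x (Fin.last n))) this
  left j x i := by
    refine Fin.lastCases (fun hi => ?_) (fun i hi => ?_) i
    · rw [Fin.val_last] at hi
      subst hi
      have := congrArg (fun φ : relativeHom r e => (φ : A →ₗ[k] M) (x (Fin.last 0)))
        (h.zero rfl j (Fin.init x))
      simp only [coe_relativeLeft, homLeft_apply, coe_relativeRight, homRight_apply,
        (g _).2.2, map_zero, sub_zero] at this
      rw [relativeUncurry_apply, relativeUncurry_apply, Fin.init_update_last, Function.update_self,
        this]
    · have := h.left j (Fin.init x) i hi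
      rw [relativeUncurry_apply, relativeUncurry_apply, Fin.init_update_castSucc,
        Function.update_of_ne (Fin.castSucc_lt_last i).ne']
      exact congrArg (fun φ : relativeHom r e => (φ : A →ₗ[k] M) (x (Fin.last n))) this
  right j x i := by
    refine Fin.lastCases (fun hi => ?_) (fun i hi => ?_) i
    · rw [relativeUncurry_apply, relativeUncurry_apply, Fin.init_update_last, Function.update_self,
        (g _).2.1]
    · have := i.2
      rw [Fin.val_castSucc] at hi
      omega
  zero hn := absurd hn (Nat.succ_ne_zero n)

lemma IsReduced.curryRight_mem {n : ℕ} {f : MultilinearMap k (fun _ : Fin (n + 1) => A) M}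
    (h : IsReduced l r e f) (x : Fin n → A) : f.curryRight x ∈ relativeHom r e := by
  refine ⟨fun a j => ?_, fun j => ?_⟩
  · have := h.right j (Fin.snoc (α := fun _ => A) x a) (Fin.last n) rfl
    rwa [Fin.snoc_last, Fin.update_snoc_last] at this
  · exact h.vanish _ (Fin.last n) j (Fin.snoc_last ..)

/-- The inclusion of `relativeHom` respects both actions, so the defect term of `map_bimoduleD`
vanishes. -/
lemma subtype_comp_bimoduleD (hb : IsBimodule l r) {n : ℕ}
    (g : MultilinearMap k (fun _ : Fin n => A) (relativeHom r e)) :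
    (relativeHom r e).subtype.compMultilinearMap
        (bimoduleD (relativeLeft hb e) (relativeRight hb e) n g) =
      bimoduleD (homLeft l) (homRight r) n ((relativeHom r e).subtype.compMultilinearMap g) := by
  refine MultilinearMap.ext fun x => ?_
  rw [LinearMap.compMultilinearMap_apply, map_bimoduleD (r := relativeRight hb e) (l' := homLeft l)
    (r' := homRight r) (relativeHom r e).subtype (fun a φ => rfl)]
  have : (relativeHom r e).subtype (relativeRight hb e (x (Fin.last n)) (g (Fin.init x))) =
    homRight r (x (Fin.last n)) ((relativeHom r e).subtype (g (Fin.init x))) := rfl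
  rw [this, sub_self, smul_zero, add_zero]

lemma relativeUncurry_bimoduleD (hb : IsBimodule l r) {n : ℕ}
    (g : MultilinearMap k (fun _ : Fin n => A) (relativeHom r e)) :
    relativeUncurry (bimoduleD (relativeLeft hb e) (relativeRight hb e) n g) =
      bimoduleD l r (n + 1) (relativeUncurry g) := by
  have h : (relativeUncurry g).curryRight = (relativeHom r e).subtype.compMultilinearMap g :=
    MultilinearMap.curry_uncurryRight _
  rw [← MultilinearMap.uncurry_curryRight (bimoduleD l r (n + 1) (relativeUncurry g)),
    curryRight_bimoduleD, h, ← subtype_comp_bimoduleD hb]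
  rfl

variable [Fintype ι]

variable (r e) in
/-- The map `φ ↦ ∑_j φ(e_j) e_j`. -/
def averageMap : (A →ₗ[k] M) →ₗ[k] M := ∑ j, (r (e j)).comp (LinearMap.applyₗ (e j))

lemma averageMap_apply (φ : A →ₗ[k] M) : averageMap r e φ = ∑ j, r (e j) (φ (e j)) := by
  simp [averageMap]

lemma averageMap_homLeft (hb : IsBimodule l r) (a : A) (φ : A →ₗ[k] M) :
    averageMap r e (homLeft l a φ) = l a (averageMap r e φ) := by
  simp only [averageMap_apply, homLeft_apply, map_sum, hb.comm]

variable (r e) in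
/-- The map that sends `φ` to `a ↦ ∑_j φ(a e_j) e_j - (∑_j φ(e_j) e_j) a`. -/
def relativeProj : (A →ₗ[k] M) →ₗ[k] (A →ₗ[k] M) :=
  LinearMap.mk₂ k (fun φ a => ∑ j, r (e j) (φ (a * e j)) - r a (averageMap r e φ))
    (fun φ ψ a => by simp [Finset.sum_add_distrib]; abel)
    (fun c φ a => by simp [Finset.smul_sum, smul_sub])
    (fun φ a b => by simp [add_mul, Finset.sum_add_distrib]; abel)
    (fun c φ a => by simp [Finset.smul_sum, smul_sub])

lemma relativeProj_apply (φ : A →ₗ[k] M) (a : A) :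
    relativeProj r e φ a = ∑ j, r (e j) (φ (a * e j)) - r a (averageMap r e φ) := rfl

lemma relativeProj_homLeft (hb : IsBimodule l r) (a : A) (φ : A →ₗ[k] M) :
    relativeProj r e (homLeft l a φ) = homLeft l a (relativeProj r e φ) := by
  ext x
  simp only [relativeProj_apply, homLeft_apply, averageMap_homLeft hb, map_sub, map_sum, hb.comm]

variable (he : CompleteOrthogonalIdempotents e)
include he

lemma sum_right_idempotent (hb : IsBimodule l r) (m : M) : ∑ j, r (e j) m = m := by
  rw [← LinearMap.sum_apply, ← map_sum, he.complete, hb.right_one]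

/-- The average is left linear but not right linear. By this formula, the average of `φ a` minus the
average of `φ` times `a` is `relativeProj φ (a) - φ(a)`, so `relativeProj` differs from the identity
by exactly this defect. -/
lemma averageMap_homRight (hb : IsBimodule l r) (a : A) (φ : A →ₗ[k] M) :
    averageMap r e (homRight r a φ) = ∑ j, r (e j) (φ (a * e j)) - φ a := by
  simp only [averageMap_apply, homRight_apply, map_sub, Finset.sum_sub_distrib]
  congr 1
  conv_rhs => rw [← sum_right_idempotent he hb (φ a)]
  refine Finset.sum_congr rfl fun j _ => ?_
  rw [← hb.right_mul, (he.idem j).eq]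

/-- Orthogonality leaves one summand each time: at `x e_j` in the sum defining the projection, and
in the average multiplied by `e_j`. At `x = 1` the two survivors are equal, which gives the
vanishing at `e_j`. -/
lemma relativeProj_mem (hb : IsBimodule l r) (φ : A →ₗ[k] M) :
    relativeProj r e φ ∈ relativeHom r e := by
  classical
  have key : ∀ x j, ∑ i, r (e i) (φ (x * e j * e i)) = r (e j) (φ (x * e j)) := by
    intro x j
    rw [Finset.sum_eq_single j]
    · rw [mul_assoc, (he.idem j).eq]
    · intro i _ hi
      rw [mul_assoc, he.ortho hi.symm, mul_zero, map_zero, map_zero]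
    · intro h
      exact absurd (Finset.mem_univ j) h
  have key2 : ∀ (j : ι) (t : ι → M), r (e j) (∑ i, r (e i) (t i)) = r (e j) (t j) := by
    intro j t
    rw [map_sum, Finset.sum_eq_single j]
    · rw [← hb.right_mul, (he.idem j).eq]
    · intro i _ hi
      rw [← hb.right_mul, he.ortho hi, map_zero, LinearMap.zero_apply]
    · intro h
      exact absurd (Finset.mem_univ j) h
  refine ⟨fun x j => ?_, fun j => ?_⟩
  · rw [relativeProj_apply, relativeProj_apply, key, map_sub, key2, hb.right_mul]
  · have := key 1 j
    simp only [one_mul] at this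
    rw [relativeProj_apply, this, averageMap_apply, key2, sub_self]

lemma relativeProj_eq_self (hb : IsBimodule l r) (φ : A →ₗ[k] M) (hφ : φ ∈ relativeHom r e) :
    relativeProj r e φ = φ := by
  ext a
  have h1 : averageMap r e φ = 0 := by
    rw [averageMap_apply]
    exact Finset.sum_eq_zero fun j _ => by rw [hφ.2, map_zero]
  rw [relativeProj_apply, h1, map_zero, sub_zero, ← sum_right_idempotent he hb (φ a)]
  refine Finset.sum_congr rfl fun j _ => ?_
  rw [hφ.1, ← hb.right_mul, (he.idem j).eq]

/-- The correction `φ(a) x` appears once through the twisted action and once through the average of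
`φ a`, with opposite signs. Together with left linearity this makes the projection a bimodule map,
so it commutes with the differential. -/
lemma relativeProj_homRight (hb : IsBimodule l r) (a : A) (φ : A →ₗ[k] M) :
    relativeProj r e (homRight r a φ) = homRight r a (relativeProj r e φ) := by
  ext x
  rw [relativeProj_apply, averageMap_homRight he hb]
  simp only [relativeProj_apply, homRight_apply, map_sub, Finset.sum_sub_distrib]
  have h : ∑ j, r (e j) (r (x * e j) (φ a)) = r x (φ a) := by
    rw [← sum_right_idempotent he hb (r x (φ a))]
    refine Finset.sum_congr rfl fun j _ => ?_
    rw [← hb.right_mul, mul_assoc, (he.idem j).eq, hb.right_mul]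
  rw [h, hb.right_mul]
  simp only [mul_assoc]
  abel

/-- A cochain whose differential vanishes on the idempotents in the last argument is, up to a
coboundary, relative in the last argument. -/
lemma sub_bimoduleD_averageMap (hb : IsBimodule l r) {n : ℕ}
    (f : MultilinearMap k (fun _ : Fin (n + 1) => A) M)
    (hf : ∀ x, (bimoduleD l r (n + 1) f).curryRight x ∈ relativeHom r e) (x : Fin n → A) (a : A) :
    f (Fin.snoc (α := fun _ => A) x a) - (-1 : k) ^ (n + 1) •
        bimoduleD l r n ((averageMap r e).compMultilinearMap f.curryRight)
          (Fin.snoc (α := fun _ => A) x a) = relativeProj r e (f.curryRight x) a := by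
  -- Applied to the average, the defect term of `map_bimoduleD` is the failure of right linearity,
  -- that is, projection minus identity.
  have h := map_bimoduleD (l' := l) (r' := r) (r := homRight r) (averageMap r e)
    (averageMap_homLeft hb) n f.curryRight (Fin.snoc (α := fun _ => A) x a)
  rw [← curryRight_bimoduleD, averageMap_homRight he hb, Fin.init_snoc, Fin.snoc_last] at h
  -- Relative homomorphisms vanish at the idempotents, so their average is zero.
  have h0 : averageMap r e ((bimoduleD l r (n + 1) f).curryRight
      (Fin.snoc (α := fun _ => A) x a)) = 0 := by
    rw [averageMap_apply]
    exact Finset.sum_eq_zero fun j _ => by rw [(hf _).2, map_zero]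
  rw [h0] at h
  rw [relativeProj_apply]
  have h1 : f.curryRight x a = f (Fin.snoc (α := fun _ => A) x a) := rfl
  rw [h1] at h
  rcases neg_one_pow_eq_or k (n + 1) with s | s <;> rw [s] at h ⊢
  · linear_combination (norm := module) h
  · linear_combination (norm := module) -h

end RelativeHom

/-! ### Every cochain with reduced differential is reduced up to a coboundary -/

section Reduction

variable {k : Type*} {A : Type u} [CommRing k] [Ring A] [Algebra k A] {ι : Type*} [Fintype ι]
  {e : ι → A}

/-- Relative Hochschild cochains with respect to orthogonal idempotents: a cochain whose
differential is reduced is reduced up to a coboundary. -/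
theorem exists_isReduced_sub (he : CompleteOrthogonalIdempotents e) (n : ℕ) :
    ∀ (M : Type u) [AddCommGroup M] [Module k M] (l r : A →ₗ[k] M →ₗ[k] M)
      (_ : IsBimodule l r) (f : MultilinearMap k (fun _ : Fin n => A) M),
      IsReduced l r e (bimoduleD l r n f) →
      ∃ h ∈ coboundaries (bimoduleD l r) n, IsReduced l r e (f - h) := by
  -- The induction is over all coefficient bimodules at once, since the step replaces `M` by
  -- `relativeHom`. This stays in the universe of `M` because `A` lies there too.
  induction n with
  | zero =>
    intro M _ _ l r hb f hf
    refine ⟨0, zero_mem _, ⟨fun x i => i.elim0, fun j x i => i.elim0, fun j x i => i.elim0,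
      fun j x i => i.elim0, fun _ j x => ?_⟩⟩
    -- The only condition on an element is commutation with each `e_j`, and its differential at
    -- `e_j` is the commutator.
    have := hf.vanish (fun _ => e j) 0 j rfl
    rw [bimoduleD_apply] at this
    rw [sub_zero, ← sub_eq_zero, ← this]
    simp only [Finset.univ_eq_empty, Finset.sum_empty, add_zero, zero_add, pow_one, neg_smul,
      one_smul, ← sub_eq_add_neg]
    congr 2 <;> exact congrArg f (Subsingleton.elim _ _)
  | succ n ih =>
    intro M _ _ l r hb f hf
    have hN := hf.curryRight_mem
    -- This is `f`, made relative in its last variable and curried; by `hg` it differs from `f` by a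
    -- coboundary.
    let g : MultilinearMap k (fun _ : Fin n => A) (relativeHom r e) :=
      ((relativeProj r e).compMultilinearMap f.curryRight).codRestrict _
        fun x => relativeProj_mem he hb _
    have hg : relativeUncurry g = f - (-1 : k) ^ (n + 1) •
        bimoduleD l r n ((averageMap r e).compMultilinearMap f.curryRight) := by
      refine MultilinearMap.ext fun x => ?_
      have := sub_bimoduleD_averageMap he hb f hN (Fin.init x) (x (Fin.last n))
      rw [Fin.snoc_init_self] at this
      exact this.symm
    -- The projection commutes with the differential and fixes the values of the curried
    -- differential of `f`, which are already relative. So `g` inherits a reduced differential.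
    have hd : relativeUncurry (bimoduleD (relativeLeft hb e) (relativeRight hb e) n g) =
        bimoduleD l r (n + 1) f := by
      rw [← MultilinearMap.uncurry_curryRight (bimoduleD l r (n + 1) f)]
      rw [relativeUncurry]
      congr 1
      refine MultilinearMap.ext fun x => ?_
      rw [subtype_comp_bimoduleD]
      have h2 := map_bimoduleD (l := homLeft l) (r := homRight r) (l' := homLeft l)
        (r' := homRight r) (relativeProj r e) (relativeProj_homLeft hb) n f.curryRight x
      rw [relativeProj_homRight he hb, sub_self, smul_zero, add_zero, ← curryRight_bimoduleD,
        relativeProj_eq_self he hb _ (hN x)] at h2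
      rw [h2]
      rfl
    have hbN : IsBimodule (relativeLeft hb e) (relativeRight hb e) := by
      refine ⟨fun a b φ => ?_, fun a b φ => ?_, fun a b φ => ?_, fun φ => ?_⟩ <;>
        refine Subtype.ext (LinearMap.ext fun x => ?_)
      · simp only [coe_relativeLeft, homLeft_apply, hb.left_mul]
      · simp only [coe_relativeRight, homRight_apply, hb.right_mul, mul_assoc, map_sub]
        abel
      · simp only [coe_relativeRight, coe_relativeLeft, homRight_apply, homLeft_apply, map_sub,
          hb.comm]
      -- The twisted right action is unital only on maps that kill `1 = ∑ e_j`, as relative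
      -- homomorphisms do.
      · have : (φ : A →ₗ[k] M) 1 = 0 := by
          rw [← he.complete, map_sum]
          exact Finset.sum_eq_zero fun j _ => φ.2.2 j
        simp only [coe_relativeRight, homRight_apply, one_mul, this, map_zero, sub_zero]
    obtain ⟨h, hh, hr⟩ := ih (relativeHom r e) (relativeLeft hb e) (relativeRight hb e) hbN g
      (IsReduced.of_relativeUncurry hb (by rw [hd]; exact hf))
    have hu : relativeUncurry (g - h) = relativeUncurry g - relativeUncurry h := rfl
    refine ⟨(-1 : k) ^ (n + 1) • bimoduleD l r n
      ((averageMap r e).compMultilinearMap f.curryRight) + relativeUncurry h, ?_, ?_⟩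
    · refine add_mem (Submodule.smul_mem _ _ ⟨_, rfl⟩) ?_
      -- A coboundary of arity zero is zero by definition; in higher arity, uncurrying commutes with
      -- the differential.
      cases n with
      | zero =>
        rw [coboundaries, Submodule.mem_bot] at hh
        subst hh
        exact zero_mem _
      | succ n =>
        obtain ⟨h', rfl⟩ := hh
        exact ⟨relativeUncurry h', (relativeUncurry_bimoduleD hb h').symm⟩
    · rw [← sub_sub, ← hg, ← hu]
      exact IsReduced.relativeUncurry hb hr

end Reduction

/-! ### Paths and lists of arrows -/

section Walks

variable {V : Type u} [Quiver.{v + 1} V]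

/-- The arrows of the list can be composed, to a path from `s` to `t`. -/
def IsWalk (s t : V) : List (Quiver.Total V) → Prop
  | [] => s = t
  | a :: l => a.left = s ∧ IsWalk a.right t l

/-- A path grows at its end and a list at its head; this reconciles the two recursions. -/
lemma isWalk_append_singleton (s t : V) (l : List (Quiver.Total V)) (a : Quiver.Total V) :
    IsWalk s t (l ++ [a]) ↔ IsWalk s a.left l ∧ a.right = t := by
  induction l generalizing s with
  | nil => simp only [List.nil_append, IsWalk, eq_comm]
  | cons b l ih => simp only [List.cons_append, IsWalk, ih, and_assoc]

lemma isWalk_arrowsOf {s t : V} (p : Quiver.Path s t) : IsWalk s t (arrowsOf p) := by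
  induction p with
  | nil => rfl
  | cons p e ih => exact (isWalk_append_singleton _ _ _ _).2 ⟨ih, rfl⟩

lemma arrowsOf_comp {s t u : V} (p : Quiver.Path s t) (q : Quiver.Path t u) :
    arrowsOf (p.comp q) = arrowsOf p ++ arrowsOf q := by
  induction q with
  | nil => simp [arrowsOf]
  | cons q e ih => simp [arrowsOf, ih]

lemma arrowsOf_cast {s t s' t' : V} (hs : s = s') (ht : t = t') (p : Quiver.Path s t) :
    arrowsOf (p.cast hs ht) = arrowsOf p := by
  subst hs; subst ht; rfl

lemma IsWalk.exists_path {s t : V} {l : List (Quiver.Total V)} (h : IsWalk s t l) :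
    ∃ p : Quiver.Path s t, arrowsOf p = l := by
  induction l generalizing s with
  | nil =>
    cases h
    exact ⟨.nil, rfl⟩
  | cons a l ih =>
    obtain ⟨rfl, h⟩ := h
    obtain ⟨p, rfl⟩ := ih h
    exact ⟨a.hom.toPath.comp p, by simp [arrowsOf_comp, Quiver.Hom.toPath, arrowsOf]⟩

/-- An arrow in `Quiver.Total` remembers its source, so the intermediate vertices can be recovered
from the list. -/
lemma arrowsOf_injective {s t : V} (p q : Quiver.Path s t) (h : arrowsOf p = arrowsOf q) :
    p = q := by
  induction p with
  | nil =>
    cases q with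
    | nil => rfl
    | cons q e => simp [arrowsOf] at h
  | cons p e ih =>
    cases q with
    | nil => simp [arrowsOf] at h
    | cons q e' =>
      obtain ⟨h1, h2⟩ := List.append_inj' h rfl
      simp only [List.cons.injEq, and_true] at h2
      cases h2
      rw [ih q h1]

/-- The four conditions match the fields `zero`, `left`, `right` and `balanced` of `IsBimoduleHom`.
-/
lemma isWalk_ofFn_iff {n : ℕ} (s t : V) (a : Fin n → Quiver.Total V) :
    IsWalk s t (List.ofFn a) ↔ (n = 0 → s = t) ∧ (∀ i, i.val = 0 → (a i).left = s) ∧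
      (∀ i, i.val + 1 = n → (a i).right = t) ∧
      ∀ i j, j.val = i.val + 1 → (a i).right = (a j).left := by
  induction n generalizing s with
  | zero => simp [IsWalk]
  | succ n ih =>
    rw [List.ofFn_succ, IsWalk, ih]
    constructor
    · rintro ⟨h1, h2, h3, h4, h5⟩
      refine ⟨fun h => absurd h (Nat.succ_ne_zero n), fun i hi => ?_, fun i => ?_, fun i j => ?_⟩
      · rw [← h1]
        exact congrArg (fun i => (a i).left) (Fin.ext hi)
      · refine Fin.cases (fun hi => ?_) (fun i hi => h4 i (by simpa using hi)) i
        exact h2 (by simpa using hi.symm)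
      · refine Fin.cases (fun hj => ?_) (fun j => ?_) j
        · simp at hj
        refine Fin.cases (fun hj => ?_) (fun i hj => h5 i j (by simpa using hj)) i
        exact (h3 j (by simpa using hj)).symm
    · rintro ⟨_, h1, h2, h3⟩
      refine ⟨h1 0 rfl, fun hn => ?_, fun i hi => ?_, fun i hi => ?_, fun i j hj => ?_⟩
      · exact h2 0 (by simp [hn])
      · exact (h3 0 i.succ (by simp [hi])).symm
      · exact h2 i.succ (by simp [hi])
      · exact h3 i.succ j.succ (by simp [hj])

namespace QPath

lemma length_arrows (p : QPath V) : p.arrows.length = p.length := length_arrowsOf p.path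

lemma arrows_ofArrow (a : Quiver.Total V) : (ofArrow a).arrows = [a] := rfl

lemma arrows_concat (p q : QPath V) (h : p.tgt = q.src) :
    (p.concat q h).arrows = p.arrows ++ q.arrows := by
  rw [arrows, concat, arrowsOf_comp, arrowsOf_cast]
  rfl

lemma length_ofArrow_le (a : Quiver.Total V) : (ofArrow a).length ≤ 1 :=
  (rfl : (ofArrow a).length = 1).le

lemma ofArrow_injective : Function.Injective (ofArrow : Quiver.Total V → QPath V) := by
  intro a b h
  have := congrArg arrows h
  rw [arrows_ofArrow, arrows_ofArrow] at this
  simpa using this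

lemma ext_arrows {p q : QPath V} (h : p.Parallel q) (ha : p.arrows = q.arrows) : p = q := by
  obtain ⟨s, t, p⟩ := p
  obtain ⟨s', t', q⟩ := q
  obtain ⟨rfl, rfl⟩ := h
  rw [arrowsOf_injective p q ha]

lemma exists_eq_ofArrow {p : QPath V} (h : p.length = 1) : ∃ a, p = ofArrow a := by
  obtain ⟨s, t, p⟩ := p
  cases p with
  | nil => simp [length] at h
  | cons p e =>
    cases p with
    | nil => exact ⟨⟨_, _, e⟩, rfl⟩
    | cons p e' => simp [length] at h

lemma eq_trivial {p : QPath V} (h : p.length = 0) : p = trivial p.src := by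
  obtain ⟨s, t, p⟩ := p
  cases p with
  | nil => rfl
  | cons p e => simp [length] at h

end QPath

end Walks

/-! ### Coordinates on the algebra of radical square zero -/

section Coordinates

variable {k : Type w} [Field k] {V : Type u} [Quiver.{v + 1} V]

variable (k) in
/-- The coefficient of a path in an element of the path algebra. -/
noncomputable def pathCoeff (p : QPath V) : PathAlg k V →ₗ[k] k :=
  (Finsupp.lapply p : (QPath V →₀ k) →ₗ[k] k)

open Classical in
lemma pathCoeff_ofPath (p q : QPath V) :
    pathCoeff k p (ofPath q) = if q = p then 1 else 0 := Finsupp.single_apply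

variable [Fintype V]

lemma RadSqAlg.hom_ext {M : Type*} [AddCommGroup M] [Module k M] {f g : RadSqAlg k V →ₗ[k] M}
    (h : ∀ p, f (pathClass k p) = g (pathClass k p)) : f = g :=
  LinearMap.ext_on span_pathClass (by rintro _ ⟨p, rfl⟩; exact h p)

/-- The ideal lies in the span of the paths of length at least two, so short paths have well-defined
coefficients in `A`. -/
lemma ker_toRadSq_le (p : QPath V) (hp : p.length ≤ 1) :
    LinearMap.ker (toRadSq k V).toLinearMap ≤ LinearMap.ker (pathCoeff k p) := by
  classical
  intro x hx
  have hx' : toRadSq k V x = toRadSq k V 0 := (LinearMap.mem_ker.1 hx).trans (map_zero _).symm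
  rw [toRadSq_eq_iff, sub_zero] at hx'
  refine (Submodule.span_le (p := LinearMap.ker (pathCoeff k p))).2 ?_ (idealQ2_le _ hx')
  rintro _ ⟨q, hq, rfl⟩
  rw [SetLike.mem_coe, LinearMap.mem_ker, pathCoeff_ofPath, if_neg (by rintro rfl; omega)]

variable (k) in
/-- The coefficient in an element of `A` of a path of length at most one. -/
noncomputable def coeff (p : QPath V) (hp : p.length ≤ 1) : RadSqAlg k V →ₗ[k] k :=
  (Submodule.liftQ _ (pathCoeff k p) (ker_toRadSq_le p hp)).comp
    ((toRadSq k V).toLinearMap.quotKerEquivOfSurjective toRadSq_surjective).symm.toLinearMap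

lemma coeff_toRadSq (p : QPath V) (hp : p.length ≤ 1) (x : PathAlg k V) :
    coeff k p hp (toRadSq k V x) = pathCoeff k p x := by
  have : ((toRadSq k V).toLinearMap.quotKerEquivOfSurjective toRadSq_surjective).symm
      (toRadSq k V x) = Submodule.Quotient.mk x := by
    rw [LinearEquiv.symm_apply_eq]
    rfl
  rw [coeff, LinearMap.comp_apply, LinearEquiv.coe_coe, this, Submodule.liftQ_apply]

open Classical in
lemma coeff_pathClass (p : QPath V) (hp : p.length ≤ 1) (q : QPath V) :
    coeff k p hp (pathClass k q) = if q = p then 1 else 0 := by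
  rw [pathClass, coeff_toRadSq, pathCoeff_ofPath]

/-- A lift without short coefficients is supported on paths of length at least two, and these die in
`A`. -/
lemma eq_zero_of_coeff {x : RadSqAlg k V} (h : ∀ p hp, coeff k p hp x = 0) : x = 0 := by
  obtain ⟨y, rfl⟩ := toRadSq_surjective x
  have hy : y ∈ Submodule.span k (ofPath '' {p : QPath V | 2 ≤ p.length}) := by
    have : (y : QPath V →₀ k) ∈ Finsupp.supported k k {p : QPath V | 2 ≤ p.length} := by
      refine (Finsupp.mem_supported k (y : QPath V →₀ k)).2 fun p hp => ?_
      by_contra hlt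
      have hlt' : ¬ 2 ≤ p.length := hlt
      have := h p (by omega)
      rw [coeff_toRadSq] at this
      exact Finsupp.mem_support_iff.1 hp this
    rw [Finsupp.supported_eq_span_single] at this
    exact this
  have hle : Submodule.span k (ofPath '' {p : QPath V | 2 ≤ p.length}) ≤
      LinearMap.ker (toRadSq k V).toLinearMap := by
    rw [Submodule.span_le]
    rintro _ ⟨p, hp, rfl⟩
    exact pathClass_eq_zero p hp
  exact hle hy

variable (k) in
/-- The coefficient in an element of `r` of an arrow. -/
noncomputable def arrowCoeff (a : Quiver.Total V) : rad k V →ₗ[k] k :=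
  (coeff k (QPath.ofArrow a) (QPath.length_ofArrow_le a)).comp (rad k V).subtype

open Classical in
lemma arrowCoeff_arrowClass (a b : Quiver.Total V) :
    arrowCoeff k a (arrowClass k b) = if b = a then 1 else 0 := by
  change coeff k (QPath.ofArrow a) (QPath.length_ofArrow_le a) (pathClass k (QPath.ofArrow b)) = _
  simp only [coeff_pathClass, QPath.ofArrow_injective.eq_iff]

variable (k V) in
/-- The arrows are a basis of the radical. -/
noncomputable def arrowBasis : Module.Basis (Quiver.Total V) k (rad k V) :=
  Module.Basis.mk (v := arrowClass k)
    (by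
      classical
      rw [linearIndependent_iff']
      intro s c hc a ha
      have := congrArg (arrowCoeff k a) hc
      simpa [arrowCoeff_arrowClass, ha] using this)
    (by
      rintro ⟨x, hx⟩ -
      induction hx using Submodule.span_induction with
      | zero => exact zero_mem _
      | add x y hx hy h1 h2 => exact add_mem h1 h2
      | smul c x hx h => exact Submodule.smul_mem _ c h
      | mem x h =>
        obtain ⟨p, hp, rfl⟩ := h
        obtain ⟨a, rfl⟩ := QPath.exists_eq_ofArrow hp
        exact Submodule.subset_span ⟨a, rfl⟩)

lemma arrowBasis_apply (a : Quiver.Total V) : arrowBasis k V a = arrowClass k a :=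
  Module.Basis.mk_apply _ _ a

lemma rad_multilinear_ext {n : ℕ} {M : Type*} [AddCommGroup M] [Module k M]
    {f g : MultilinearMap k (fun _ : Fin n => rad k V) M}
    (h : ∀ a : Fin n → Quiver.Total V,
      f (fun i => arrowClass k (a i)) = g (fun i => arrowClass k (a i))) : f = g :=
  Module.Basis.ext_multilinear (fun _ => arrowBasis k V) fun a => by
    simpa only [arrowBasis_apply] using h a

open Classical in
lemma trivial_mul_pathClass (i : V) (p : QPath V) :
    pathClass k (QPath.trivial i) * pathClass k p =
      (if p.src = i then 1 else 0 : k) • pathClass k p := by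
  split_ifs with h
  · rw [pathClass_mul _ _ h.symm, QPath.trivial_concat, one_smul]
  · rw [pathClass_mul_of_ne _ _ (fun h' => h h'.symm), zero_smul]

open Classical in
lemma pathClass_mul_trivial (i : V) (p : QPath V) :
    pathClass k p * pathClass k (QPath.trivial i) =
      (if p.tgt = i then 1 else 0 : k) • pathClass k p := by
  split_ifs with h
  · rw [pathClass_mul p (QPath.trivial i) h, QPath.concat_trivial, one_smul]
  · rw [pathClass_mul_of_ne p (QPath.trivial i) h, zero_smul]

/-- The elements of `E` act on paths by scalars. -/
lemma exists_weight (e : RadSqAlg k V) (he : e ∈ subE k V) :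
    ∃ ε : V → k, (∀ p : QPath V, e * pathClass k p = ε p.src • pathClass k p) ∧
      ∀ p : QPath V, pathClass k p * e = ε p.tgt • pathClass k p := by
  classical
  induction he using Submodule.span_induction with
  | zero => exact ⟨0, by simp, by simp⟩
  | add x y _ _ hx hy =>
    obtain ⟨ε, h1, h2⟩ := hx
    obtain ⟨η, h3, h4⟩ := hy
    exact ⟨ε + η, fun p => by rw [add_mul, h1, h3, Pi.add_apply, add_smul],
      fun p => by rw [mul_add, h2, h4, Pi.add_apply, add_smul]⟩
  | smul c x _ hx =>
    obtain ⟨ε, h1, h2⟩ := hx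
    exact ⟨c • ε, fun p => by rw [smul_mul_assoc, h1, Pi.smul_apply, smul_assoc],
      fun p => by rw [mul_smul_comm, h2, Pi.smul_apply, smul_assoc]⟩
  | mem x hx =>
    obtain ⟨q, hq, rfl⟩ := hx
    rw [QPath.eq_trivial hq]
    exact ⟨fun v => if v = q.src then 1 else 0, fun p => trivial_mul_pathClass q.src p,
      fun p => pathClass_mul_trivial q.src p⟩

lemma coeff_mul_left {e : RadSqAlg k V} {ε : V → k}
    (hε : ∀ p : QPath V, e * pathClass k p = ε p.src • pathClass k p) (p : QPath V)
    (hp : p.length ≤ 1) (x : RadSqAlg k V) : coeff k p hp (e * x) = ε p.src * coeff k p hp x := by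
  classical
  have : (coeff k p hp).comp (LinearMap.mulLeft k e) = ε p.src • coeff k p hp := by
    refine RadSqAlg.hom_ext fun q => ?_
    rw [LinearMap.comp_apply, LinearMap.mulLeft_apply, hε, map_smul, LinearMap.smul_apply,
      coeff_pathClass]
    split_ifs with h
    · rw [h]
    · simp
  exact congrArg (fun f => f x) this

lemma coeff_mul_right {e : RadSqAlg k V} {ε : V → k}
    (hε : ∀ p : QPath V, pathClass k p * e = ε p.tgt • pathClass k p) (p : QPath V)
    (hp : p.length ≤ 1) (x : RadSqAlg k V) : coeff k p hp (x * e) = ε p.tgt * coeff k p hp x := by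
  classical
  have : (coeff k p hp).comp (LinearMap.mulRight k e) = ε p.tgt • coeff k p hp := by
    refine RadSqAlg.hom_ext fun q => ?_
    rw [LinearMap.comp_apply, LinearMap.mulRight_apply, hε, map_smul, LinearMap.smul_apply,
      coeff_pathClass]
    split_ifs with h
    · rw [h]
    · simp
  exact congrArg (fun f => f x) this

lemma actL_arrowClass {e : RadSqAlg k V} {ε : V → k}
    (hε : ∀ p : QPath V, e * pathClass k p = ε p.src • pathClass k p) (a : Quiver.Total V) :
    actL e (arrowClass k a) = ε a.left • arrowClass k a := Subtype.ext (hε (QPath.ofArrow a))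

lemma actR_arrowClass {e : RadSqAlg k V} {ε : V → k}
    (hε : ∀ p : QPath V, pathClass k p * e = ε p.tgt • pathClass k p) (a : Quiver.Total V) :
    actR e (arrowClass k a) = ε a.right • arrowClass k a := Subtype.ext (hε (QPath.ofArrow a))

lemma trivial_mem_subE (i : V) : pathClass k (QPath.trivial i) ∈ subE k V :=
  Submodule.subset_span ⟨_, rfl, rfl⟩

lemma completeOrthogonalIdempotents_trivial :
    CompleteOrthogonalIdempotents fun i : V => pathClass k (QPath.trivial i) := by
  classical
  refine CompleteOrthogonalIdempotents.iff_ortho_complete.2 ⟨fun i j hij => ?_, ?_⟩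
  · exact pathClass_mul_of_ne _ _ hij
  · have : (1 : RadSqAlg k V) = toRadSq k V (∑ i : V, ofPath (QPath.trivial i)) :=
      (map_one (toRadSq k V)).symm
    rw [this, map_sum]
    rfl

end Coordinates

/-! ### The isomorphism of the combinatorial cochains with the reduced cochains -/

section Comparison

variable {k : Type w} [Field k] {V : Type u} [Quiver.{v + 1} V]

lemma basisPairs_length_le {n : ℕ} (c : basisPairs V n) : c.1.2.length ≤ 1 := by
  rcases c.2.2.1 with h | h
  · exact (show c.1.2.length = 0 from h).le.trans zero_le_one
  · exact (show c.1.2.length = 1 from h).le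

/-- The arrows of the first path of a pair of parallel paths. -/
def arrowVec {n : ℕ} (c : basisPairs V n) (i : Fin n) : Quiver.Total V :=
  c.1.1.arrows.get (i.cast ((QPath.length_arrows _).trans c.2.1).symm)

lemma ofFn_arrowVec {n : ℕ} (c : basisPairs V n) : List.ofFn (arrowVec c) = c.1.1.arrows := by
  have h : c.1.1.arrows.length = n := (QPath.length_arrows _).trans c.2.1
  conv_rhs => rw [← List.ofFn_get c.1.1.arrows]
  rw [List.ofFn_congr h]
  rfl

lemma arrows_eq_ofFn_iff {n : ℕ} (c : basisPairs V n) (a : Fin n → Quiver.Total V) :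
    c.1.1.arrows = List.ofFn a ↔ a = arrowVec c := by
  rw [← ofFn_arrowVec, List.ofFn_injective.eq_iff, eq_comm]

lemma isWalk_arrowVec {n : ℕ} (c : basisPairs V n) :
    IsWalk c.1.2.src c.1.2.tgt (List.ofFn (arrowVec c)) := by
  rw [ofFn_arrowVec, ← c.2.2.2.1, ← c.2.2.2.2]
  exact isWalk_arrowsOf _

/-- The end points of the first path are those of the second one. This is what determines it when it
is trivial and has no arrows. -/
lemma basisPairs_ext {n : ℕ} {c d : basisPairs V n} (h1 : arrowVec c = arrowVec d)
    (h2 : c.1.2 = d.1.2) : c = d := by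
  refine Subtype.ext (Prod.ext (QPath.ext_arrows ⟨?_, ?_⟩ ?_) h2)
  · exact c.2.2.2.1.trans ((congrArg QPath.src h2).trans d.2.2.2.1.symm)
  · exact c.2.2.2.2.trans ((congrArg QPath.tgt h2).trans d.2.2.2.2.symm)
  · rw [← ofFn_arrowVec c, ← ofFn_arrowVec d, h1]

lemma exists_basisPair {n : ℕ} (a : Fin n → Quiver.Total V) (p : QPath V) (hp : p.length ≤ 1)
    (h : IsWalk p.src p.tgt (List.ofFn a)) :
    ∃ c : basisPairs V n, arrowVec c = a ∧ c.1.2 = p := by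
  obtain ⟨q, hq⟩ := h.exists_path
  have hl : q.length = n := by rw [← length_arrowsOf, hq, List.length_ofFn]
  have hp' : p ∈ pathsOfLength V 0 ∪ pathsOfLength V 1 := by
    rcases Nat.le_one_iff_eq_zero_or_eq_one.1 hp with h | h
    · exact Or.inl h
    · exact Or.inr h
  let c : basisPairs V n := ⟨(⟨p.src, p.tgt, q⟩, p), hl, hp', rfl, rfl⟩
  exact ⟨c, ((arrows_eq_ofFn_iff c a).1 hq).symm, rfl⟩

variable [Fintype V]

variable (k) in
/-- The multilinear map on the radical that sends the arrows of `γ` to `x`, for a pair `(γ, x)`, and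
the other vectors of arrows to zero. -/
noncomputable def pairMap {n : ℕ} (c : basisPairs V n) :
    MultilinearMap k (fun _ : Fin n => rad k V) (RadSqAlg k V) :=
  ((MultilinearMap.mkPiAlgebra k (Fin n) k).compLinearMap fun i => arrowCoeff k (arrowVec c i)).smulRight
    (pathClass k c.1.2)

lemma pairMap_apply {n : ℕ} (c : basisPairs V n) (x : Fin n → rad k V) :
    pairMap k c x = (∏ i, arrowCoeff k (arrowVec c i) (x i)) • pathClass k c.1.2 := rfl

open Classical in
lemma pairMap_arrowClass {n : ℕ} (c : basisPairs V n) (a : Fin n → Quiver.Total V) :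
    pairMap k c (fun i => arrowClass k (a i)) =
      if a = arrowVec c then pathClass k c.1.2 else 0 := by
  simp only [pairMap_apply, arrowCoeff_arrowClass, Finset.prod_ite_zero, Finset.prod_const_one,
    Finset.mem_univ, forall_const, funext_iff]
  split_ifs <;> simp

lemma pairMap_update {n : ℕ} (c : basisPairs V n) (x : Fin n → rad k V) (i : Fin n)
    (φ : rad k V →ₗ[k] rad k V) (η : k)
    (h : ∀ y, arrowCoeff k (arrowVec c i) (φ y) = η * arrowCoeff k (arrowVec c i) y) :
    pairMap k c (Function.update x i (φ (x i))) = η • pairMap k c x := by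
  rw [pairMap_apply, pairMap_apply, smul_smul]
  congr 1
  rw [← Finset.mul_prod_erase _ _ (Finset.mem_univ i), ← Finset.mul_prod_erase _ _ (Finset.mem_univ i),
    Function.update_self, h, mul_assoc]
  congr 2
  refine Finset.prod_congr rfl fun l hl => ?_
  rw [Function.update_of_ne (Finset.ne_of_mem_erase hl)]

/-- An element of `E` scales the coordinate of an arrow by a weight at its source or its target,
depending on the side. The walk condition says that the weights on the two sides of each equation
are taken at the same vertex. -/
lemma isBimoduleHom_pairMap {n : ℕ} (c : basisPairs V n) : IsBimoduleHom (pairMap k c) := by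
  obtain ⟨w0, w1, w2, w3⟩ := (isWalk_ofFn_iff _ _ _).1 (isWalk_arrowVec c)
  have hL : ∀ (e : RadSqAlg k V) (ε : V → k),
      (∀ p : QPath V, e * pathClass k p = ε p.src • pathClass k p) → ∀ i y,
      arrowCoeff k (arrowVec c i) (actL e y) =
        ε (arrowVec c i).left * arrowCoeff k (arrowVec c i) y := fun e ε hε i y =>
    coeff_mul_left hε (QPath.ofArrow (arrowVec c i)) (QPath.length_ofArrow_le _) y
  have hR : ∀ (e : RadSqAlg k V) (ε : V → k),
      (∀ p : QPath V, pathClass k p * e = ε p.tgt • pathClass k p) → ∀ i y,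
      arrowCoeff k (arrowVec c i) (actR e y) =
        ε (arrowVec c i).right * arrowCoeff k (arrowVec c i) y := fun e ε hε i y =>
    coeff_mul_right hε (QPath.ofArrow (arrowVec c i)) (QPath.length_ofArrow_le _) y
  refine ⟨fun e he x i j hij => ?_, fun e he x i hi => ?_, fun e he x i hi => ?_,
    fun hn e he x => ?_⟩ <;> obtain ⟨ε, h1, h2⟩ := exists_weight e he
  · rw [pairMap_update c x i _ _ (hR e ε h2 i), pairMap_update c x j _ _ (hL e ε h1 j), w3 i j hij]
  · rw [pairMap_update c x i _ _ (hL e ε h1 i), pairMap_apply, mul_smul_comm, h1, w1 i hi,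
      smul_comm]
  · rw [pairMap_update c x i _ _ (hR e ε h2 i), pairMap_apply, smul_mul_assoc, h2, w2 i hi,
      smul_comm]
  · rw [pairMap_apply, mul_smul_comm, smul_mul_assoc, h1, h2, w0 hn]

variable (k V) in
/-- The linear map from the combinatorial cochains to the reduced cochains. -/
noncomputable def toReduced (n : ℕ) : QuiverCochain k V n →ₗ[k] ReducedCochain k V n :=
  Finsupp.linearCombination k fun c => ⟨pairMap k c, isBimoduleHom_pairMap c⟩

lemma toReduced_single {n : ℕ} (c : basisPairs V n) (a : k) :
    toReduced k V n (Finsupp.single c a) = a • ⟨pairMap k c, isBimoduleHom_pairMap c⟩ := by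
  rw [toReduced, Finsupp.linearCombination_single]

variable (k V) in
/-- The coefficients of a reduced cochain. -/
noncomputable def reducedCoeff (n : ℕ) : ReducedCochain k V n →ₗ[k] (basisPairs V n → k) :=
  LinearMap.pi fun c =>
    { toFun := fun f => coeff k c.1.2 (basisPairs_length_le c)
        (f.1 fun i => arrowClass k (arrowVec c i))
      map_add' := fun f g => by simp
      map_smul' := fun a f => by simp }

lemma reducedCoeff_apply {n : ℕ} (f : ReducedCochain k V n) (c : basisPairs V n) :
    reducedCoeff k V n f c = coeff k c.1.2 (basisPairs_length_le c)
      (f.1 fun i => arrowClass k (arrowVec c i)) := rfl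

/-- The coefficients are dual to the basis of pairs, so they form a left inverse. -/
lemma reducedCoeff_toReduced {n : ℕ} (x : QuiverCochain k V n) :
    reducedCoeff k V n (toReduced k V n x) = x := by
  classical
  induction x using Finsupp.induction_linear with
  | zero => rw [map_zero, map_zero]; rfl
  | add x y hx hy => rw [map_add, map_add, hx, hy]; rfl
  | single c a =>
    rw [toReduced_single, map_smul]
    funext d
    rw [Pi.smul_apply, reducedCoeff_apply]
    change a • coeff k _ _ (pairMap k c fun i => arrowClass k (arrowVec d i)) = _
    rw [pairMap_arrowClass, Finsupp.single_apply]
    by_cases h : c = d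
    · subst h
      rw [if_pos rfl, if_pos rfl, coeff_pathClass, if_pos rfl, smul_eq_mul, mul_one]
    · rw [if_neg h]
      split_ifs with h'
      · rw [coeff_pathClass, if_neg (fun h2 => h (basisPairs_ext h'.symm h2)), smul_zero]
      · rw [map_zero, smul_zero]

/-- Each incidence is tested with the idempotent of one of the two vertices involved. It fixes one
side of the corresponding bimodule equation, and kills the other side if the vertices differ. -/
lemma IsBimoduleHom.isWalk {n : ℕ} {f : MultilinearMap k (fun _ : Fin n => rad k V) (RadSqAlg k V)}
    (hf : IsBimoduleHom f) (a : Fin n → Quiver.Total V) (p : QPath V) (hp : p.length ≤ 1)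
    (h : coeff k p hp (f fun i => arrowClass k (a i)) ≠ 0) :
    IsWalk p.src p.tgt (List.ofFn a) := by
  classical
  have hL : ∀ (v : V) (i : Fin n), f (Function.update (fun i => arrowClass k (a i)) i
      (actL (pathClass k (QPath.trivial v)) (arrowClass k (a i)))) =
      (if (a i).left = v then 1 else 0 : k) • f fun i => arrowClass k (a i) := by
    intro v i
    rw [actL_arrowClass (ε := fun s => if s = v then 1 else 0) (trivial_mul_pathClass v),
      f.map_update_smul, Function.update_eq_self i (fun i => arrowClass k (a i))]
  have hR : ∀ (v : V) (i : Fin n), f (Function.update (fun i => arrowClass k (a i)) i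
      (actR (pathClass k (QPath.trivial v)) (arrowClass k (a i)))) =
      (if (a i).right = v then 1 else 0 : k) • f fun i => arrowClass k (a i) := by
    intro v i
    rw [actR_arrowClass (ε := fun s => if s = v then 1 else 0) (pathClass_mul_trivial v),
      f.map_update_smul, Function.update_eq_self i (fun i => arrowClass k (a i))]
  have cL : ∀ (v : V) (x : RadSqAlg k V),
      coeff k p hp (pathClass k (QPath.trivial v) * x) =
        (if p.src = v then 1 else 0) * coeff k p hp x := fun v x =>
    coeff_mul_left (ε := fun s => if s = v then 1 else 0) (trivial_mul_pathClass v) p hp x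
  have cR : ∀ (v : V) (x : RadSqAlg k V),
      coeff k p hp (x * pathClass k (QPath.trivial v)) =
        (if p.tgt = v then 1 else 0) * coeff k p hp x := fun v x =>
    coeff_mul_right (ε := fun s => if s = v then 1 else 0) (pathClass_mul_trivial v) p hp x
  have h0 : (f fun i => arrowClass k (a i)) ≠ 0 := fun h' => h (by rw [h', map_zero])
  rw [isWalk_ofFn_iff]
  refine ⟨fun hn => ?_, fun i hi => ?_, fun i hi => ?_, fun i j hij => ?_⟩
  · have := congrArg (coeff k p hp) (hf.zero hn _ (trivial_mem_subE p.src)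
      fun i => arrowClass k (a i))
    rw [cL, cR, if_pos rfl, one_mul] at this
    by_contra hne
    rw [if_neg (Ne.symm hne), zero_mul] at this
    exact h this
  · have := congrArg (coeff k p hp) (hf.left _ (trivial_mem_subE (a i).left)
      (fun i => arrowClass k (a i)) i hi)
    rw [hL, cL, if_pos rfl, one_smul] at this
    by_contra hne
    rw [if_neg (Ne.symm hne), zero_mul] at this
    exact h this
  · have := congrArg (coeff k p hp) (hf.right _ (trivial_mem_subE (a i).right)
      (fun i => arrowClass k (a i)) i hi)
    rw [hR, cR, if_pos rfl, one_smul] at this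
    by_contra hne
    rw [if_neg (Ne.symm hne), zero_mul] at this
    exact h this
  · have := hf.balanced _ (trivial_mem_subE (a i).right) (fun i => arrowClass k (a i)) i j hij
    rw [hR, hL, if_pos rfl, one_smul] at this
    by_contra hne
    rw [if_neg (Ne.symm hne), zero_smul] at this
    exact h0 this

/-- The coordinates of `f` that are not indexed by parallel pairs vanish by `IsBimoduleHom.isWalk`,
so the listed ones suffice. -/
lemma reducedCoeff_injective (n : ℕ) : Function.Injective (reducedCoeff k V n) := by
  refine (injective_iff_map_eq_zero _).2 fun f hf => ?_
  refine Subtype.ext (rad_multilinear_ext fun a => eq_zero_of_coeff fun p hp => ?_)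
  by_contra h
  obtain ⟨c, rfl, rfl⟩ := exists_basisPair a p hp (f.2.isWalk a p hp h)
  exact h (congrFun hf c)

variable [∀ s t : V, Fintype (s ⟶ t)]

omit [Fintype V] in
lemma finite_total [Finite V] : Finite (Quiver.Total V) :=
  Finite.of_injective (β := Σ s : V, Σ t : V, (s ⟶ t)) (fun a => ⟨a.left, a.right, a.hom⟩) (by
    rintro ⟨s, t, a⟩ ⟨s', t', a'⟩ h
    cases h
    rfl)

lemma finite_basisPairs (n : ℕ) : Finite (basisPairs V n) := by
  have := finite_total (V := V)
  have h : Finite {p : QPath V // p.length ≤ 1} := by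
    refine Finite.of_surjective (α := V ⊕ Quiver.Total V)
      (fun s => Sum.elim (fun i => ⟨QPath.trivial i, zero_le_one⟩)
        (fun a => ⟨QPath.ofArrow a, QPath.length_ofArrow_le a⟩) s) ?_
    rintro ⟨p, hp⟩
    rcases Nat.le_one_iff_eq_zero_or_eq_one.1 hp with h | h
    · exact ⟨Sum.inl p.src, Subtype.ext (QPath.eq_trivial h).symm⟩
    · obtain ⟨a, rfl⟩ := QPath.exists_eq_ofArrow h
      exact ⟨Sum.inr a, rfl⟩
  refine Finite.of_injective (β := (Fin n → Quiver.Total V) × {p : QPath V // p.length ≤ 1})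
    (fun c => (arrowVec c, ⟨c.1.2, basisPairs_length_le c⟩)) fun c d h => ?_
  exact basisPairs_ext (congrArg Prod.fst h) (congrArg (fun x => x.2.1) h)

lemma toReduced_bijective (n : ℕ) : Function.Bijective (toReduced k V n) := by
  refine ⟨fun x y h => ?_, fun f => ?_⟩
  · refine DFunLike.coe_injective ?_
    rw [← reducedCoeff_toReduced x, h, reducedCoeff_toReduced]
  · have := finite_basisPairs (V := V) n
    -- Finiteness of the quiver turns the family of coefficients into a finitely supported one; this
    -- is where surjectivity uses it.
    refine ⟨Finsupp.equivFunOnFinite.symm (reducedCoeff k V n f), reducedCoeff_injective n ?_⟩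
    rw [reducedCoeff_toReduced]
    rfl

variable (k V) in
/-- The isomorphism of the combinatorial cochains with the reduced cochains. -/
noncomputable def reducedEquiv (n : ℕ) : QuiverCochain k V n ≃ₗ[k] ReducedCochain k V n :=
  LinearEquiv.ofBijective (toReduced k V n) (toReduced_bijective n)

lemma reducedEquiv_single {n : ℕ} (c : basisPairs V n) :
    (reducedEquiv k V n (Finsupp.single c 1)).1 = pairMap k c := by
  change (toReduced k V n (Finsupp.single c 1)).1 = _
  rw [toReduced_single, one_smul]

end Comparison

/-! ### Substituting a path for an arrow, in terms of arrow vectors -/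

section Substitution

variable {V : Type u} [Quiver.{v + 1} V]

lemma arrowsOf_substArrow (β : QPath V) (i : ℕ) {s t : V} (p : Quiver.Path s t)
    (a : Quiver.Total V) (ha : (arrowsOf p)[i]? = some a) (hs : β.src = a.left)
    (ht : β.tgt = a.right) :
    arrowsOf (substArrow β i p) =
      (arrowsOf p).take i ++ (β.arrows ++ (arrowsOf p).drop (i + 1)) := by
  induction p with
  | nil => simp [arrowsOf] at ha
  | cons p e ih =>
    unfold substArrow
    by_cases hi : i = p.length
    · have hl : (arrowsOf p).length = i := by rw [length_arrowsOf, hi]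
      have : a = ⟨_, _, e⟩ := by
        rw [arrowsOf, List.getElem?_append_right hl.le, hl] at ha
        simpa using ha.symm
      subst this
      rw [if_pos hi, dif_pos ⟨hs, ht⟩, arrowsOf_comp, arrowsOf_cast, arrowsOf,
        List.take_left' hl, List.drop_eq_nil_of_le (by simp [hl]), List.append_nil]
      rfl
    · rw [if_neg hi]
      have hlt : i < (arrowsOf p).length := by
        by_contra hcon
        have := (List.getElem?_eq_some_iff.1 ha).1
        rw [arrowsOf, List.length_append, List.length_singleton] at this
        rw [← length_arrowsOf] at hi
        omega
      have := ih (by rwa [arrowsOf, List.getElem?_append_left hlt] at ha)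
      rw [arrowsOf, this, arrowsOf, List.take_append_of_le_length hlt.le,
        List.drop_append_of_le_length hlt]
      simp

lemma getElem?_arrows {n : ℕ} (c : basisPairs V n) (q : Fin n) :
    c.1.1.arrows[q.val]? = some (arrowVec c q) := by
  rw [← ofFn_arrowVec, List.getElem?_ofFn, dif_pos q.2]

lemma arrowVec_eq_of_getElem? {n : ℕ} (c : basisPairs V n) (q : Fin n) {a : Quiver.Total V}
    (h : c.1.1.arrows[q.val]? = some a) : arrowVec c q = a := by
  rw [getElem?_arrows] at h
  exact Option.some_injective _ h

/-- Entries inside the block are recovered from the first equation, the others from the second. With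
the next lemmas this characterises the arrows of `α ⋄_i β` by the two vectors that an insertion
reads. -/
lemma eq_of_block_eq_of_insertVec_eq {n m N : ℕ} {T : Type*} (h : n + m = N) (i : Fin (n + 1))
    {a a' : Fin (N + 1) → T} {b : T} (h1 : block h a i = block h a' i)
    (h2 : insertVec h a i b = insertVec h a' i b) : a = a' := by
  funext q
  rcases lt_or_ge q.val i.val with hq | hq
  · have := congrFun h2 ⟨q.val, by omega⟩
    rwa [insertVec_apply_left h a i b _ hq, insertVec_apply_left h a' i b _ hq] at this
  rcases le_or_gt q.val (i.val + m) with hq' | hq'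
  · have := congrFun h1 ⟨q.val - i.val, by omega⟩
    simp only [block] at this
    have e : (⟨i.val + (q.val - i.val), by omega⟩ : Fin (N + 1)) = q := Fin.ext (by simp; omega)
    rwa [e] at this
  · have := congrFun h2 ⟨q.val - m, by omega⟩
    rw [insertVec_apply_right h a i b _ (by simp only; omega),
      insertVec_apply_right h a' i b _ (by simp only; omega)] at this
    have e : (⟨q.val - m + m, by omega⟩ : Fin (N + 1)) = q := Fin.ext (by simp; omega)
    rwa [e] at this

lemma arrows_subst {α β : QPath V} {i : ℕ} {b : Quiver.Total V} (ha : α.arrows[i]? = some b)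
    (hβ : β.Parallel (QPath.ofArrow b)) :
    (α.subst i β).arrows = α.arrows.take i ++ (β.arrows ++ α.arrows.drop (i + 1)) :=
  arrowsOf_substArrow β i α.path b ha hβ.1 hβ.2

section

variable {n m N : ℕ} (h : n + m = N) (i : Fin (n + 1)) {c : basisPairs V (n + 1)}
  {d : basisPairs V (m + 1)} {b : Quiver.Total V} (hc : c.1.1.arrows[i.val]? = some b)
  (hd : d.1.2 = QPath.ofArrow b) {e : basisPairs V (N + 1)} (he : e.1.1 = c.1.1.subst i.val d.1.1)
include hc hd he

lemma arrows_of_subst : e.1.1.arrows =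
    c.1.1.arrows.take i ++ (d.1.1.arrows ++ c.1.1.arrows.drop (i + 1)) := by
  rw [he]
  exact arrows_subst hc (hd ▸ d.2.2.2)

lemma block_arrowVec_subst : block h (arrowVec e) i = arrowVec d := by
  have hl : c.1.1.arrows.length = n + 1 := (QPath.length_arrows _).trans c.2.1
  have hl' : d.1.1.arrows.length = m + 1 := (QPath.length_arrows _).trans d.2.1
  funext q
  refine arrowVec_eq_of_getElem? e _ ?_
  rw [arrows_of_subst i hc hd he, List.getElem?_append_right (by simp), List.length_take, hl,
    min_eq_left i.2.le, List.getElem?_append_left (by simp only; omega), ← getElem?_arrows]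
  congr 1
  simp

lemma insertVec_arrowVec_subst : insertVec h (arrowVec e) i b = arrowVec c := by
  have hl : c.1.1.arrows.length = n + 1 := (QPath.length_arrows _).trans c.2.1
  have hl' : d.1.1.arrows.length = m + 1 := (QPath.length_arrows _).trans d.2.1
  have hi := i.2
  funext q
  rcases lt_trichotomy q.val i.val with hq | hq | hq
  · rw [insertVec_apply_left h _ i b q hq]
    refine arrowVec_eq_of_getElem? e _ ?_
    rw [arrows_of_subst i hc hd he, List.getElem?_append_left (by simp [hl]; omega),
      List.getElem?_take_of_lt hq, getElem?_arrows]
  · rw [Fin.ext hq, insertVec_apply_self, arrowVec_eq_of_getElem? c i hc]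
  · rw [insertVec_apply_right h _ i b q hq]
    refine arrowVec_eq_of_getElem? e _ ?_
    rw [arrows_of_subst i hc hd he, List.getElem?_append_right (by simp; omega), List.length_take,
      hl, min_eq_left i.2.le, List.getElem?_append_right (by simp only; omega), hl',
      List.getElem?_drop, ← getElem?_arrows]
    congr 1
    simp only
    omega

end

end Substitution

/-! ### Compatibility of the three circle products and brackets -/

section Bracket

variable {k : Type w} [Field k] {V : Type u} [Quiver.{v + 1} V]

lemma quiverCirc_single {n m N : ℕ} (h : n + m = N) (c : basisPairs V (n + 1))
    (d : basisPairs V (m + 1)) (s t : k) :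
    quiverCirc k V n m N h (Finsupp.single c s) (Finsupp.single d t) =
      s • t • ∑ i : Fin (n + 1), (-1 : k) ^ (i.val * m) • pairInsert k h i c d := by
  rw [quiverCirc, Finsupp.linearCombination_single, LinearMap.smul_apply,
    Finsupp.linearCombination_single]

lemma map_insertVec_zero {n m N : ℕ} {M P : Type*} [AddCommGroup M] [Module k M] [AddCommGroup P]
    [Module k P] (h : n + m = N) (f : MultilinearMap k (fun _ : Fin (n + 1) => M) P)
    (x : Fin (N + 1) → M) (i : Fin (n + 1)) : f (insertVec h x i 0) = 0 := by
  have := map_insertVec_smul h f x i (0 : k) 0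
  rwa [zero_smul, zero_smul] at this

variable [Fintype V]

/-- On arrows `a` the reduced insertion is nonzero exactly when the block of `a` spells `β`, the
path `y` survives `π`, and `a` with the block replaced by `y` spells `α`. This says that `y` is the
arrow `a_i` and that `a` spells the substituted path. -/
lemma toReduced_pairInsert {n m N : ℕ} (h : n + m = N) (i : Fin (n + 1))
    (c : basisPairs V (n + 1)) (d : basisPairs V (m + 1)) :
    toReduced k V (N + 1) (pairInsert k h i c d) =
      reducedInsert h i ⟨pairMap k c, isBimoduleHom_pairMap c⟩
        ⟨pairMap k d, isBimoduleHom_pairMap d⟩ := by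
  classical
  refine Subtype.ext (rad_multilinear_ext fun a => ?_)
  have hblock : block h (fun q => arrowClass k (a q)) i =
    fun q => arrowClass k (block h a i q) := rfl
  have hins : ∀ b, insertVec h (fun q => arrowClass k (a q)) i (arrowClass k b) =
      fun q => arrowClass k (insertVec h a i b q) := by
    intro b
    funext q
    simp only [insertVec]
    split_ifs <;> rfl
  have rhs : (reducedInsert h i ⟨pairMap k c, isBimoduleHom_pairMap c⟩
      ⟨pairMap k d, isBimoduleHom_pairMap d⟩).1 (fun q => arrowClass k (a q)) =
      pairMap k c (insertVec h (fun q => arrowClass k (a q)) i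
        (radProj k V (if block h a i = arrowVec d then pathClass k d.1.2 else 0))) := by
    rw [← pairMap_arrowClass, ← hblock]
    rfl
  rw [rhs]
  have hproj : ∀ b, d.1.2 = QPath.ofArrow b →
      radProj k V (pathClass k d.1.2) = arrowClass k b := fun b hb => by
    rw [hb]
    exact radProj_of_mem (arrowClass k b)
  unfold pairInsert
  split_ifs with hd hb hb
  · obtain ⟨b, hc, hdb⟩ := hd
    rw [hproj b hdb, hins, pairMap_arrowClass, toReduced_single, one_smul, pairMap_arrowClass]
    refine if_congr ⟨?_, fun h2 => ?_⟩ rfl rfl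
    · rintro rfl
      exact insertVec_arrowVec_subst h i hc hdb rfl
    · refine eq_of_block_eq_of_insertVec_eq h i (b := b) ?_ ?_
      · rw [hb, block_arrowVec_subst h i hc hdb rfl]
      · rw [h2, insertVec_arrowVec_subst h i hc hdb rfl]
  · obtain ⟨b, hc, hdb⟩ := hd
    rw [map_zero, map_insertVec_zero, toReduced_single, one_smul, pairMap_arrowClass, if_neg]
    rintro rfl
    exact hb (block_arrowVec_subst h i hc hdb rfl)
  -- The combinatorial side vanishes because `y` is not `a_i`: either `y` is a vertex, killed by
  -- `π`, or it is an arrow that does not fit into `α`.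
  · rw [map_zero]
    change (0 : RadSqAlg k V) = _
    rcases Nat.le_one_iff_eq_zero_or_eq_one.1 (basisPairs_length_le d) with h0 | h1
    · rw [radProj_of_mem_subE _ (Submodule.subset_span ⟨_, h0, rfl⟩), map_insertVec_zero]
    · obtain ⟨b, hdb⟩ := QPath.exists_eq_ofArrow h1
      rw [hproj b hdb, hins, pairMap_arrowClass, if_neg]
      intro h2
      refine hd ⟨b, ?_, hdb⟩
      rw [getElem?_arrows, ← h2, insertVec_apply_self]
  · rw [map_zero, map_zero, map_insertVec_zero]
    rfl

lemma reducedCirc_apply {n m N : ℕ} (h : n + m = N) (f : ReducedCochain k V (n + 1))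
    (g : ReducedCochain k V (m + 1)) :
    reducedCirc k V n m N h f g =
      ∑ i : Fin (n + 1), (-1 : k) ^ (i.val * m) • reducedInsert h i f g := rfl

lemma toReduced_quiverCirc {n m N : ℕ} (h : n + m = N) (x : QuiverCochain k V (n + 1))
    (y : QuiverCochain k V (m + 1)) :
    toReduced k V (N + 1) (quiverCirc k V n m N h x y) =
      reducedCirc k V n m N h (toReduced k V (n + 1) x) (toReduced k V (m + 1) y) := by
  induction x using Finsupp.induction_linear with
  | zero => simp only [map_zero, LinearMap.zero_apply]
  | add x x' hx hx' => simp only [map_add, LinearMap.add_apply, hx, hx']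
  | single c s =>
    induction y using Finsupp.induction_linear with
    | zero => simp only [map_zero]
    | add y y' hy hy' => simp only [map_add, hy, hy']
    | single d t =>
      simp only [quiverCirc_single, toReduced_single, map_smul, LinearMap.smul_apply, map_sum,
        toReduced_pairInsert, reducedCirc_apply]
      exact smul_comm _ _ _

lemma toReduced_quiverBracket (n m : ℕ) (x : QuiverCochain k V (n + 1))
    (y : QuiverCochain k V (m + 1)) :
    toReduced k V (n + m + 1) (quiverBracket k V n m x y) =
      reducedBracket k V n m (toReduced k V (n + 1) x) (toReduced k V (m + 1) y) := by
  change toReduced k V (n + m + 1) (quiverCirc k V n m (n + m) rfl x y -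
    (-1 : k) ^ (n * m) • quiverCirc k V m n (n + m) (Nat.add_comm m n) y x) = _
  rw [map_sub, map_smul, toReduced_quiverCirc, toReduced_quiverCirc]
  rfl

/-- The projection is the identity on `r`, so evaluating at radical elements recovers the reduced
cochain. -/
lemma comparison_injective (n : ℕ) : Function.Injective (comparison k V n) := by
  intro f g h
  refine Subtype.ext (MultilinearMap.ext fun x => ?_)
  have := congrArg (fun F => F fun i => (x i : RadSqAlg k V)) h
  change f.1 (fun i => radProj k V (x i)) = g.1 (fun i => radProj k V (x i)) at this
  simpa only [radProj_of_mem] using this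

/-- The `π` in the reduced insertion is the one that `p f` applies to the argument where `p g` is
inserted. -/
lemma comparison_reducedCirc {n m N : ℕ} (h : n + m = N) (f : ReducedCochain k V (n + 1))
    (g : ReducedCochain k V (m + 1)) :
    comparison k V (N + 1) (reducedCirc k V n m N h f g) =
      hochschildCirc k (RadSqAlg k V) n m N h (comparison k V (n + 1) f)
        (comparison k V (m + 1) g) := by
  rw [reducedCirc_apply, map_sum]
  refine Finset.sum_congr rfl fun i _ => ?_
  rw [map_smul]
  congr 1
  refine MultilinearMap.ext fun x => congrArg f.1 (funext fun q => ?_)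
  simp only [insertVec]
  split_ifs <;> rfl

lemma comparison_reducedBracket (n m : ℕ) (f : ReducedCochain k V (n + 1))
    (g : ReducedCochain k V (m + 1)) :
    comparison k V (n + m + 1) (reducedBracket k V n m f g) =
      gerstenhaberBracket k (RadSqAlg k V) n m (comparison k V (n + 1) f)
        (comparison k V (m + 1) g) := by
  refine (map_sub (comparison k V (n + m + 1)) (reducedCirc k V n m (n + m) rfl f g)
    ((-1 : k) ^ (n * m) • reducedCirc k V m n (n + m) (Nat.add_comm m n) g f)).trans ?_
  rw [map_smul, comparison_reducedCirc, comparison_reducedCirc]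
  rfl

theorem isGradedLie_reducedBracket :
    IsGradedLie k (fun n => ReducedCochain k V (n + 1)) (reducedBracket k V) :=
  isGradedLie_gerstenhaberBracket.of_injective (fun n => comparison k V (n + 1))
    (fun n => comparison_injective (n + 1)) comparison_reducedBracket

theorem isGradedLie_quiverBracket [∀ s t : V, Fintype (s ⟶ t)] :
    IsGradedLie k (fun n => QuiverCochain k V (n + 1)) (quiverBracket k V) :=
  isGradedLie_reducedBracket.of_injective (fun n => toReduced k V (n + 1))
    (fun n => (toReduced_bijective (n + 1)).1) toReduced_quiverBracket

end Bracket

/-! ### The differential on reduced and on combinatorial cochains -/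

section ReducedDifferential

variable {k : Type w} [Field k] {V : Type u} [Quiver.{v + 1} V]

lemma eq_arrowVec_leftPair_iff {n : ℕ} (c : basisPairs V n) (hc : c.1.2.length = 0) {s : V}
    (α : s ⟶ c.1.1.src) (a : Fin (n + 1) → Quiver.Total V) :
    a = arrowVec ⟨_, leftPair_mem c hc α⟩ ↔
      a 0 = ⟨s, _, α⟩ ∧ (fun i => a i.succ) = arrowVec c := by
  rw [← arrows_eq_ofFn_iff, ← arrows_eq_ofFn_iff]
  change ((QPath.ofArrow ⟨s, _, α⟩).concat c.1.1 rfl).arrows = _ ↔ _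
  rw [QPath.arrows_concat, QPath.arrows_ofArrow, List.ofFn_succ, List.singleton_append,
    List.cons.injEq, eq_comm]

lemma eq_arrowVec_rightPair_iff {n : ℕ} (c : basisPairs V n) (hc : c.1.2.length = 0) {t : V}
    (α : c.1.1.tgt ⟶ t) (a : Fin (n + 1) → Quiver.Total V) :
    a = arrowVec ⟨_, rightPair_mem c hc α⟩ ↔
      a (Fin.last n) = ⟨_, t, α⟩ ∧ (fun i => a i.castSucc) = arrowVec c := by
  rw [← arrows_eq_ofFn_iff, ← arrows_eq_ofFn_iff]
  change (c.1.1.concat (QPath.ofArrow ⟨_, t, α⟩) rfl).arrows = _ ↔ _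
  rw [QPath.arrows_concat, QPath.arrows_ofArrow, List.ofFn_succ_last]
  constructor
  · intro h
    obtain ⟨h1, h2⟩ := List.append_inj' h rfl
    exact ⟨(List.singleton_injective h2).symm, h1⟩
  · rintro ⟨h1, h2⟩
    rw [h1, h2]

variable [Fintype V]

lemma rad_mul_rad {x y : RadSqAlg k V} (hx : x ∈ rad k V) (hy : y ∈ rad k V) : x * y = 0 := by
  induction hx using Submodule.span_induction with
  | zero => exact zero_mul y
  | add a b _ _ ha hb => rw [add_mul, ha, hb, add_zero]
  | smul c a _ ha => rw [smul_mul_assoc, ha, smul_zero]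
  | mem x hx =>
    obtain ⟨p, hp, rfl⟩ := hx
    induction hy using Submodule.span_induction with
    | zero => exact mul_zero _
    | add a b _ _ ha hb => rw [mul_add, ha, hb, add_zero]
    | smul c a _ ha => rw [mul_smul_comm, ha, smul_zero]
    | mem y hy =>
      obtain ⟨q, hq, rfl⟩ := hy
      by_cases h : p.tgt = q.src
      · rw [pathClass_mul p q h, pathClass_eq_zero]
        rw [QPath.length_concat, hp, hq]
      · exact pathClass_mul_of_ne p q h

lemma sub_radProj_mem (x : RadSqAlg k V) : x - radProj k V x ∈ subE k V := by
  obtain ⟨y, z, hz, rfl⟩ := exists_decomp x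
  rwa [map_add, radProj_of_mem, radProj_of_mem_subE z hz, add_zero, add_sub_cancel_left]

/-- Write `x = y + ε` and `x' = y' + ε'` with `y, y'` in `r` and `ε, ε'` in `E`. Since `y y' = 0`
and `ε ε'` lies in `E`, what remains is `y ε' + ε y'`. -/
lemma radProj_mul (x x' : RadSqAlg k V) :
    radProj k V (x * x') = actR (x' - (radProj k V x' : RadSqAlg k V)) (radProj k V x) +
      actL (x - (radProj k V x : RadSqAlg k V)) (radProj k V x') := by
  rw [← radProj_mul_right _ _ (sub_radProj_mem x'), ← radProj_of_mem
    (actL (x - (radProj k V x : RadSqAlg k V)) (radProj k V x')), ← map_add]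
  congr 1
  change x * x' = x * (x' - (radProj k V x' : RadSqAlg k V)) +
    (x - (radProj k V x : RadSqAlg k V)) * (radProj k V x' : RadSqAlg k V)
  rw [mul_sub, sub_mul, rad_mul_rad (radProj k V x).2 (radProj k V x').2, sub_zero,
    sub_add_cancel]

lemma sum_range_telescope {B : Type*} [AddCommGroup B] [Module k B] (S : ℕ → B) (n : ℕ) :
    ∑ i ∈ Finset.range n, (-1 : k) ^ (i + 1) • (S (i + 1) + S i) = (-1 : k) ^ n • S n - S 0 := by
  induction n with
  | zero => simp
  | succ n ih =>
    rw [Finset.sum_range_succ, ih, pow_succ]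
    module

/-- The Hochschild differential of the cochain given by a reduced cochain: only the outer terms
remain. -/
lemma hochschildD_comparison (n : ℕ) (f : ReducedCochain k V n) (x : Fin (n + 1) → RadSqAlg k V) :
    hochschildD k (RadSqAlg k V) n (comparison k V n f) x =
      radProj k V (x 0) * f.1 (fun i => radProj k V (x i.succ)) +
        (-1 : k) ^ (n + 1) •
          (f.1 (fun i => radProj k V (x i.castSucc)) * radProj k V (x (Fin.last n))) := by
  let y : Fin (n + 1) → rad k V := fun i => radProj k V (x i)
  let ε : Fin (n + 1) → RadSqAlg k V := fun i => x i - y i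
  have hε : ∀ i, ε i ∈ subE k V := fun i => sub_radProj_mem (x i)
  -- The vector `z p` is `y` with the entry `y_p` left out.
  let z : ℕ → Fin n → rad k V := fun p q => if q.val < p then y q.castSucc else y q.succ
  -- The term `S p` is `f` at `z p` with `ε_p` acting where `y_p` was left out: from outside for `p
  -- = 0`, and otherwise on the right of `y_{p-1}`. The default value is not reached for `p ≤ n`.
  let S : ℕ → RadSqAlg k V := fun p => match p with
    | 0 => ε 0 * f.1 (z 0)
    | p + 1 => if h : p < n then
        f.1 (Function.update (z (p + 1)) ⟨p, h⟩ (actR (ε ⟨p + 1, by omega⟩) (y ⟨p, by omega⟩)))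
      else 0
  have hS : ∀ i : Fin n,
      contractCochain (comparison k V n f) i x = S (i.val + 1) + S i.val := by
    intro i
    have h1 : (fun q => radProj k V (Fin.contractNth i.castSucc (· * ·) x q)) =
        Function.update (z (i.val + 1)) i
          (actR (ε i.succ) (y i.castSucc) + actL (ε i.castSucc) (y i.succ)) := by
      funext q
      rcases lt_trichotomy q.val i.val with h | h | h
      · rw [Function.update_of_ne (fun e => by simp [e] at h),
          Fin.contractNth_apply_of_lt _ _ _ _ (by simpa using h)]
        simp only [z]
        rw [if_pos (by omega)]
      · have : q = i := Fin.ext h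
        subst this
        rw [Function.update_self, Fin.contractNth_apply_of_eq _ _ _ _ rfl, radProj_mul]
      · rw [Function.update_of_ne (fun e => by simp [e] at h),
          Fin.contractNth_apply_of_gt _ _ _ _ (by simpa using h)]
        simp only [z]
        rw [if_neg (by omega)]
    change f.1 (fun q => radProj k V (Fin.contractNth i.castSucc (· * ·) x q)) = _
    rw [h1, f.1.map_update_add]
    congr 1
    · simp only [S]
      rw [dif_pos i.2]
      rfl
    -- The vectors `z (i + 1)` and `z i` differ only in slot `i`, which is overwritten. Balancing
    -- then moves `ε_i` from the left of slot `i` to the right of the previous one.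
    · have h2 : Function.update (z (i.val + 1)) i (actL (ε i.castSucc) (y i.succ)) =
          Function.update (z i.val) i (actL (ε i.castSucc) (z i.val i)) := by
        funext q
        by_cases hq : q = i
        · subst hq
          simp [z]
        · rw [Function.update_of_ne hq, Function.update_of_ne hq]
          have : q.val ≠ i.val := fun e => hq (Fin.ext e)
          simp only [z]
          split_ifs <;> first | rfl | omega
      rw [h2]
      obtain ⟨i, hi⟩ := i
      cases i with
      | zero => exact f.2.left _ (hε _) _ _ rfl
      | succ i =>
        rw [← f.2.balanced _ (hε _) (z (i + 1)) ⟨i, by omega⟩ ⟨i + 1, hi⟩ rfl]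
        simp only [S]
        rw [dif_pos (by omega)]
        simp only [z]
        rw [if_pos (by omega)]
        rfl
  have hS0 : S 0 = ε 0 * f.1 (fun i => y i.succ) := rfl
  have hSn : S n = f.1 (fun i => y i.castSucc) * ε (Fin.last n) := by
    cases n with
    | zero =>
      refine (f.2.zero rfl _ (hε _) _).trans ?_
      congr 2
      exact Subsingleton.elim _ _
    | succ n =>
      simp only [S]
      rw [dif_pos (by omega)]
      have h3 : z (n + 1) = fun i => y i.castSucc := by
        funext q
        exact if_pos q.2
      rw [h3]
      exact f.2.right _ (hε _) (fun i => y i.castSucc) (Fin.last n) rfl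
  have lhs : hochschildD k (RadSqAlg k V) n (comparison k V n f) x =
      x 0 * f.1 (fun i => y i.succ) +
      (∑ i : Fin n, (-1 : k) ^ (i.val + 1) • contractCochain (comparison k V n f) i x) +
        (-1 : k) ^ (n + 1) • (f.1 (fun i => y i.castSucc) * x (Fin.last n)) := by
    change (_ + ∑ i : Fin n, (-1 : k) ^ (i.val + 1) • contractCochain (comparison k V n f) i + _) x
      = _
    simp only [add_apply, sum_apply]
    rfl
  rw [lhs]
  simp only [hS]
  rw [Fin.sum_univ_eq_sum_range (fun i => (-1 : k) ^ (i + 1) • (S (i + 1) + S i)),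
    sum_range_telescope, hS0, hSn]
  -- The telescoped sum leaves the terms with `ε_0` and `ε_n`, which cancel the `E`-components of
  -- the outer factors `x_0` and `x_n`.
  have e1 : ∀ i, x i = y i + ε i := fun i => (add_sub_cancel _ _).symm
  change _ = (y 0 : RadSqAlg k V) * f.1 (fun i => y i.succ) + (-1 : k) ^ (n + 1) •
    (f.1 (fun i => y i.castSucc) * (y (Fin.last n) : RadSqAlg k V))
  rw [e1 0, e1 (Fin.last n), add_mul, mul_add, pow_succ]
  module

/-- At most one arrow ending at `u` equals `b`, and there is one exactly when `b` ends at `u`. -/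
lemma sum_arrows_to {B : Type*} [AddCommMonoid B] [∀ s t : V, Fintype (s ⟶ t)]
    [DecidableEq (Quiver.Total V)] [DecidableEq V] (W : Quiver.Total V → B) (b : Quiver.Total V)
    (u : V) :
    ∑ s : V, ∑ α : s ⟶ u, (if b = ⟨s, u, α⟩ then W ⟨s, u, α⟩ else 0) =
      if b.right = u then W b else 0 := by
  obtain ⟨s, t, b⟩ := b
  split_ifs with h
  · dsimp only at h
    subst h
    rw [Finset.sum_eq_single s, Finset.sum_eq_single b, if_pos rfl]
    · intro c _ hc
      rw [if_neg]
      intro e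
      cases e
      exact hc rfl
    · simp
    · intro c _ hc
      refine Finset.sum_eq_zero fun α _ => if_neg ?_
      intro e
      cases e
      exact hc rfl
    · simp
  · refine Finset.sum_eq_zero fun c _ => Finset.sum_eq_zero fun α _ => if_neg ?_
    intro e
    cases e
    exact h rfl

lemma sum_arrows_from {B : Type*} [AddCommMonoid B] [∀ s t : V, Fintype (s ⟶ t)]
    [DecidableEq (Quiver.Total V)] [DecidableEq V] (W : Quiver.Total V → B) (b : Quiver.Total V)
    (u : V) :
    ∑ t : V, ∑ α : u ⟶ t, (if b = ⟨u, t, α⟩ then W ⟨u, t, α⟩ else 0) =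
      if b.left = u then W b else 0 := by
  obtain ⟨s, t, b⟩ := b
  split_ifs with h
  · dsimp only at h
    subst h
    rw [Finset.sum_eq_single t, Finset.sum_eq_single b, if_pos rfl]
    · intro c _ hc
      rw [if_neg]
      intro e
      cases e
      exact hc rfl
    · simp
    · intro c _ hc
      refine Finset.sum_eq_zero fun α _ => if_neg ?_
      intro e
      cases e
      exact hc rfl
    · simp
  · refine Finset.sum_eq_zero fun c _ => Finset.sum_eq_zero fun α _ => if_neg ?_
    intro e
    cases e
    exact h rfl

variable [∀ s t : V, Fintype (s ⟶ t)]

/-- If `x` is a vertex, it acts on `a_0` and on the last arrow as an idempotent, which selects the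
one matching summand in each sum of `pairD`. If `x` is an arrow, both products lie in `r² = 0`. -/
lemma toReduced_pairD_arrowClass {n : ℕ} (c : basisPairs V n) (a : Fin (n + 1) → Quiver.Total V) :
    (toReduced k V (n + 1) (pairD k n c)).1 (fun i => arrowClass k (a i)) =
      arrowClass k (a 0) * pairMap k c (fun i => arrowClass k (a i.succ)) + (-1 : k) ^ (n + 1) •
        (pairMap k c (fun i => arrowClass k (a i.castSucc)) *
          (arrowClass k (a (Fin.last n)) : RadSqAlg k V)) := by
  classical
  rw [pairMap_arrowClass, pairMap_arrowClass]
  by_cases hc : c.1.2.length = 0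
  · have hs : c.1.1.src = c.1.2.src := c.2.2.2.1
    have ht : c.1.1.tgt = c.1.2.src :=
      c.2.2.2.2.trans (Quiver.Path.eq_of_length_zero c.1.2.path hc).symm
    have e1 : (toReduced k V (n + 1) (∑ s : V, ∑ α : s ⟶ c.1.1.src,
        Finsupp.single ⟨_, leftPair_mem c hc α⟩ 1)).1 (fun i => arrowClass k (a i)) =
        if (fun i => a i.succ) = arrowVec c then
          (if (a 0).right = c.1.1.src then pathClass k (QPath.ofArrow (a 0)) else 0) else 0 := by
      rw [← sum_arrows_to (fun b => pathClass k (QPath.ofArrow b)) (a 0) c.1.1.src]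
      have t : ∀ (s : V) (α : s ⟶ c.1.1.src),
          (toReduced k V (n + 1) (Finsupp.single ⟨_, leftPair_mem c hc α⟩ 1)).1
            (fun i => arrowClass k (a i)) =
          if a 0 = ⟨s, _, α⟩ ∧ (fun i => a i.succ) = arrowVec c then
            pathClass k (QPath.ofArrow ⟨s, _, α⟩) else 0 := by
        intro s α
        rw [toReduced_single, one_smul, pairMap_arrowClass]
        exact if_congr (eq_arrowVec_leftPair_iff c hc α a) rfl rfl
      simp only [map_sum, Submodule.coe_sum, sum_apply, t]
      split_ifs with h
      · simp only [h, and_true]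
      · simp only [h, and_false, if_false, Finset.sum_const_zero]
    have e2 : (toReduced k V (n + 1) (∑ t : V, ∑ α : c.1.1.tgt ⟶ t,
        Finsupp.single ⟨_, rightPair_mem c hc α⟩ 1)).1 (fun i => arrowClass k (a i)) =
        if (fun i => a i.castSucc) = arrowVec c then
          (if (a (Fin.last n)).left = c.1.1.tgt then
            pathClass k (QPath.ofArrow (a (Fin.last n))) else 0) else 0 := by
      rw [← sum_arrows_from (fun b => pathClass k (QPath.ofArrow b)) (a (Fin.last n)) c.1.1.tgt]
      have t : ∀ (t : V) (α : c.1.1.tgt ⟶ t),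
          (toReduced k V (n + 1) (Finsupp.single ⟨_, rightPair_mem c hc α⟩ 1)).1
            (fun i => arrowClass k (a i)) =
          if a (Fin.last n) = ⟨_, t, α⟩ ∧ (fun i => a i.castSucc) = arrowVec c then
            pathClass k (QPath.ofArrow ⟨_, t, α⟩) else 0 := by
        intro t α
        rw [toReduced_single, one_smul, pairMap_arrowClass]
        exact if_congr (eq_arrowVec_rightPair_iff c hc α a) rfl rfl
      simp only [map_sum, Submodule.coe_sum, sum_apply, t]
      split_ifs with h
      · simp only [h, and_true]
      · simp only [h, and_false, if_false, Finset.sum_const_zero]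
    rw [pairD, dif_pos hc, map_add, map_smul]
    change (toReduced k V (n + 1) _).1 _ + (-1 : k) ^ (n + 1) • (toReduced k V (n + 1) _).1 _ = _
    rw [e1, e2, QPath.eq_trivial hc, hs, ht]
    congr 1
    · split_ifs with h h'
      · exact ((pathClass_mul_trivial _ _).trans (by rw [if_pos h', one_smul])).symm
      · exact ((pathClass_mul_trivial _ _).trans (by rw [if_neg h', zero_smul])).symm
      · rw [mul_zero]
    · congr 1
      split_ifs with h h'
      · exact ((trivial_mul_pathClass _ _).trans (by rw [if_pos h', one_smul])).symm
      · exact ((trivial_mul_pathClass _ _).trans (by rw [if_neg h', zero_smul])).symm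
      · rw [zero_mul]
  · have hr : pathClass k c.1.2 ∈ rad k V := Submodule.subset_span
      ⟨_, (Nat.le_one_iff_eq_zero_or_eq_one.1 (basisPairs_length_le c)).resolve_left hc, rfl⟩
    have hr' : ∀ (P : Prop) [Decidable P], (if P then pathClass k c.1.2 else 0) ∈ rad k V := by
      intro P _
      split_ifs
      · exact hr
      · exact zero_mem _
    rw [pairD, dif_neg hc, map_zero, rad_mul_rad (arrowClass k (a 0)).2 (hr' _),
      rad_mul_rad (hr' _) (arrowClass k (a (Fin.last n))).2, smul_zero, add_zero]
    rfl

lemma toReduced_quiverD {n : ℕ} (x : QuiverCochain k V n) :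
    (toReduced k V (n + 1) (quiverD k V n x)).1 =
      (hochschildD k (RadSqAlg k V) n (comparison k V n (toReduced k V n x))).compLinearMap
        fun _ => (rad k V).subtype := by
  induction x using Finsupp.induction_linear with
  | zero => simp only [map_zero]; rfl
  | add x y hx hy =>
    simp only [map_add, Submodule.coe_add, hx, hy]
    rfl
  | single c s =>
    have h : Finsupp.single c s = s • Finsupp.single c (1 : k) := by
      rw [Finsupp.smul_single, smul_eq_mul, mul_one]
    have key : (toReduced k V (n + 1) (quiverD k V n (Finsupp.single c 1))).1 =
        (hochschildD k (RadSqAlg k V) n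
          (comparison k V n (toReduced k V n (Finsupp.single c 1)))).compLinearMap
            fun _ => (rad k V).subtype := by
      rw [quiverD, Finsupp.linearCombination_single, one_smul, toReduced_single, one_smul]
      refine rad_multilinear_ext fun a => ?_
      rw [MultilinearMap.compLinearMap_apply, hochschildD_comparison, toReduced_pairD_arrowClass]
      simp only [Submodule.subtype_apply, radProj_of_mem]
    rw [h]
    simp only [map_smul, Submodule.coe_smul, key]
    rfl

/-- The comparison with the Hochschild complex is a morphism of complexes. -/
lemma comparison_toReduced_quiverD (n : ℕ) (x : QuiverCochain k V n) :
    comparison k V (n + 1) (toReduced k V (n + 1) (quiverD k V n x)) =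
      hochschildD k (RadSqAlg k V) n (comparison k V n (toReduced k V n x)) := by
  refine MultilinearMap.ext fun y => ?_
  change (toReduced k V (n + 1) (quiverD k V n x)).1 (fun i => radProj k V (y i)) = _
  -- Equality on `r` suffices, because the differential of a comparison cochain depends only on the
  -- projections of its arguments.
  rw [toReduced_quiverD, MultilinearMap.compLinearMap_apply, hochschildD_comparison,
    hochschildD_comparison]
  simp only [Submodule.subtype_apply, radProj_of_mem]

end ReducedDifferential

/-! ### Transport of an induced bracket along a quasi-isomorphism -/

section QuasiIso

variable {k : Type w} [CommRing k] {C : ℕ → Type*} [∀ n, AddCommGroup (C n)] [∀ n, Module k (C n)]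
  {C' : ℕ → Type*} [∀ n, AddCommGroup (C' n)] [∀ n, Module k (C' n)]
  {d : ∀ n, C n →ₗ[k] C (n + 1)} {d' : ∀ n, C' n →ₗ[k] C' (n + 1)} {φ : ∀ n, C n →ₗ[k] C' n}

lemma map_mem_cocycles (hd : ∀ n x, φ (n + 1) (d n x) = d' n (φ n x)) {n : ℕ} {x : C n}
    (hx : x ∈ cocycles d n) : φ n x ∈ cocycles d' n := by
  change d' n (φ n x) = 0
  rw [← hd, show d n x = 0 from hx, map_zero]

lemma map_mem_coboundaries (hd : ∀ n x, φ (n + 1) (d n x) = d' n (φ n x)) {n : ℕ} {x : C n}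
    (hx : x ∈ coboundaries d n) : φ n x ∈ coboundaries d' n := by
  cases n with
  | zero =>
    rw [show x = 0 from hx, map_zero]
    exact zero_mem _
  | succ n =>
    obtain ⟨y, rfl⟩ := hx
    exact ⟨φ n y, (hd n y).symm⟩

lemma exists_cohomologyEquiv (hd : ∀ n x, φ (n + 1) (d n x) = d' n (φ n x))
    (hinj : ∀ n z, z ∈ cocycles d n → φ n z ∈ coboundaries d' n → z ∈ coboundaries d n)
    (hsurj : ∀ n, ∀ F ∈ cocycles d' n, ∃ z ∈ cocycles d n, F - φ n z ∈ coboundaries d' n) :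
    ∃ Ψ : ∀ n : ℕ, Cohomology d n ≃ₗ[k] Cohomology d' n,
      ∀ (n : ℕ) (z : C n) (hz : z ∈ cocycles d n), ∃ hz' : φ n z ∈ cocycles d' n,
        Ψ n (cohomologyClass d n z hz) = cohomologyClass d' n (φ n z) hz' := by
  let ψ : ∀ n, Cohomology d n →ₗ[k] Cohomology d' n := fun n =>
    Submodule.mapQ _ _ ((φ n).restrict fun x hx => map_mem_cocycles hd hx)
      fun x hx => map_mem_coboundaries hd hx
  have hψ : ∀ n z (hz : z ∈ cocycles d n),
      ψ n (cohomologyClass d n z hz) = cohomologyClass d' n (φ n z) (map_mem_cocycles hd hz) :=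
    fun n z hz => rfl
  refine ⟨fun n => LinearEquiv.ofBijective (ψ n) ⟨?_, ?_⟩,
    fun n z hz => ⟨map_mem_cocycles hd hz, hψ n z hz⟩⟩
  · rw [injective_iff_map_eq_zero]
    intro c hc
    obtain ⟨z, hz, rfl⟩ := cohomologyClass_surjective c
    rw [hψ, cohomologyClass_eq_zero_iff] at hc
    exact (cohomologyClass_eq_zero_iff z hz).2 (hinj n z hz hc)
  · intro c
    obtain ⟨F, hF, rfl⟩ := cohomologyClass_surjective c
    obtain ⟨z, hz, h⟩ := hsurj n F hF
    refine ⟨cohomologyClass d n z hz, ?_⟩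
    rw [hψ]
    exact ((Submodule.Quotient.eq ((coboundaries d' n).submoduleOf (cocycles d' n))
      (x := ⟨F, hF⟩)).2 h).symm

lemma IsInducedBracket.mem_coboundaries
    {b : ∀ n m : ℕ, C (n + 1) →ₗ[k] C (m + 1) →ₗ[k] C (n + m + 1)}
    {B : ∀ n m : ℕ, Cohomology d (n + 1) →ₗ[k] Cohomology d (m + 1) →ₗ[k]
      Cohomology d (n + m + 1)} (h : IsInducedBracket d b B) {n m : ℕ}
    {x : C (n + 1)} {y : C (m + 1)} (hx : x ∈ cocycles d (n + 1)) (hy : y ∈ cocycles d (m + 1))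
    (hxy : x ∈ coboundaries d (n + 1) ∨ y ∈ coboundaries d (m + 1)) :
    b n m x y ∈ coboundaries d (n + m + 1) := by
  obtain ⟨hb, e⟩ := h n m x y hx hy
  rw [← cohomologyClass_eq_zero_iff _ hb, ← e]
  rcases hxy with h0 | h0
  · rw [(cohomologyClass_eq_zero_iff x hx).2 h0, map_zero, LinearMap.zero_apply]
  · rw [(cohomologyClass_eq_zero_iff y hy).2 h0, map_zero]

/-- Injectivity of `φ` detects cocycles in the target, and injectivity on cohomology detects
coboundaries. So the closure properties of `b` follow from those of `b'`, without a derivation rule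
for `d`. -/
lemma IsInducedBracket.exists_of_quasiIso (hd : ∀ n x, φ (n + 1) (d n x) = d' n (φ n x))
    (hφ : ∀ n, Function.Injective (φ n))
    (hinj : ∀ n z, z ∈ cocycles d n → φ n z ∈ coboundaries d' n → z ∈ coboundaries d n)
    (hdd : ∀ n x, d' (n + 1) (d' n x) = 0)
    {b : ∀ n m : ℕ, C (n + 1) →ₗ[k] C (m + 1) →ₗ[k] C (n + m + 1)}
    {b' : ∀ n m : ℕ, C' (n + 1) →ₗ[k] C' (m + 1) →ₗ[k] C' (n + m + 1)}
    (hb : ∀ n m x y, φ (n + m + 1) (b n m x y) = b' n m (φ (n + 1) x) (φ (m + 1) y))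
    {B' : ∀ n m : ℕ, Cohomology d' (n + 1) →ₗ[k] Cohomology d' (m + 1) →ₗ[k]
      Cohomology d' (n + m + 1)} (hB' : IsInducedBracket d' b' B') :
    ∃ B : ∀ n m : ℕ, Cohomology d (n + 1) →ₗ[k] Cohomology d (m + 1) →ₗ[k]
      Cohomology d (n + m + 1), IsInducedBracket d b B := by
  have hZ : ∀ n m x y, x ∈ cocycles d (n + 1) → y ∈ cocycles d (m + 1) →
      b n m x y ∈ cocycles d (n + m + 1) := by
    intro n m x y hx hy
    refine hφ _ ?_
    rw [hd, hb, map_zero]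
    exact (hB' n m _ _ (map_mem_cocycles hd hx) (map_mem_cocycles hd hy)).1
  have hc : ∀ n x, x ∈ coboundaries d (n + 1) → x ∈ cocycles d (n + 1) := by
    rintro n _ ⟨x, rfl⟩
    refine hφ _ ?_
    rw [hd, hd, hdd, map_zero]
  refine exists_isInducedBracket b hZ ?_ ?_
  · intro n m x y hx hy
    refine hinj _ _ (hZ n m x y (hc n x hx) hy) ?_
    rw [hb]
    exact hB'.mem_coboundaries (map_mem_cocycles hd (hc n x hx)) (map_mem_cocycles hd hy)
      (Or.inl (map_mem_coboundaries hd hx))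
  · intro n m x y hx hy
    refine hinj _ _ (hZ n m x y hx (hc m y hy)) ?_
    rw [hb]
    exact hB'.mem_coboundaries (map_mem_cocycles hd hx) (map_mem_cocycles hd (hc m y hy))
      (Or.inr (map_mem_coboundaries hd hy))

lemma IsInducedBracket.map_eq
    {b : ∀ n m : ℕ, C (n + 1) →ₗ[k] C (m + 1) →ₗ[k] C (n + m + 1)}
    {b' : ∀ n m : ℕ, C' (n + 1) →ₗ[k] C' (m + 1) →ₗ[k] C' (n + m + 1)}
    (hb : ∀ n m x y, φ (n + m + 1) (b n m x y) = b' n m (φ (n + 1) x) (φ (m + 1) y))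
    {B : ∀ n m : ℕ, Cohomology d (n + 1) →ₗ[k] Cohomology d (m + 1) →ₗ[k]
      Cohomology d (n + m + 1)} (hB : IsInducedBracket d b B)
    {B' : ∀ n m : ℕ, Cohomology d' (n + 1) →ₗ[k] Cohomology d' (m + 1) →ₗ[k]
      Cohomology d' (n + m + 1)} (hB' : IsInducedBracket d' b' B')
    {Ψ : ∀ n : ℕ, Cohomology d n ≃ₗ[k] Cohomology d' n}
    (hΨ : ∀ (n : ℕ) (z : C n) (hz : z ∈ cocycles d n), ∃ hz' : φ n z ∈ cocycles d' n,
        Ψ n (cohomologyClass d n z hz) = cohomologyClass d' n (φ n z) hz')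
    (n m : ℕ) (x : Cohomology d (n + 1)) (y : Cohomology d (m + 1)) :
    Ψ (n + m + 1) (B n m x y) = B' n m (Ψ (n + 1) x) (Ψ (m + 1) y) := by
  obtain ⟨x, hx, rfl⟩ := cohomologyClass_surjective x
  obtain ⟨y, hy, rfl⟩ := cohomologyClass_surjective y
  obtain ⟨hx', ex⟩ := hΨ _ x hx
  obtain ⟨hy', ey⟩ := hΨ _ y hy
  obtain ⟨hxy, e⟩ := hB n m x y hx hy
  obtain ⟨hxy', e'⟩ := hB' n m _ _ hx' hy'
  obtain ⟨hz', ez⟩ := hΨ _ _ hxy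
  rw [e, ez, ex, ey, e']
  exact congrArg Submodule.Quotient.mk (Subtype.ext (hb n m x y))

end QuasiIso

/-! ### The comparison is a quasi-isomorphism -/

section Comparison

variable {k : Type w} [Field k] {V : Type u} [Quiver.{v + 1} V] [Fintype V]

local notation "mulL" => LinearMap.mul k (RadSqAlg k V)
local notation "mulR" => LinearMap.flip (LinearMap.mul k (RadSqAlg k V))
local notation "vertex" => fun i : V => pathClass k (QPath.trivial i)

lemma radProj_update {n : ℕ} (x : Fin n → RadSqAlg k V) (i : Fin n) (t : RadSqAlg k V) :
    (fun q => radProj k V (Function.update x i t q)) =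
      Function.update (fun q => radProj k V (x q)) i (radProj k V t) :=
  funext fun q => Function.apply_update (fun _ => radProj k V) x i t q

lemma isReduced_comparison {n : ℕ} (f : ReducedCochain k V n) :
    IsReduced mulL mulR vertex (comparison k V n f) where
  vanish x i j h := f.1.map_coord_zero i (by
    rw [h]
    exact radProj_of_mem_subE _ (trivial_mem_subE j))
  balanced j x i i' h := by
    change f.1 _ = f.1 _
    rw [radProj_update, radProj_update, radProj_mul_right _ _ (trivial_mem_subE j),
      radProj_mul_left _ _ (trivial_mem_subE j)]
    exact f.2.balanced _ (trivial_mem_subE j) (fun q => radProj k V (x q)) i i' h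
  left j x i h := by
    change f.1 _ = _
    rw [radProj_update, radProj_mul_left _ _ (trivial_mem_subE j)]
    exact f.2.left _ (trivial_mem_subE j) (fun q => radProj k V (x q)) i h
  right j x i h := by
    change f.1 _ = _
    rw [radProj_update, radProj_mul_right _ _ (trivial_mem_subE j)]
    exact f.2.right _ (trivial_mem_subE j) (fun q => radProj k V (x q)) i h
  zero h j x := f.2.zero h _ (trivial_mem_subE j) (fun q => radProj k V (x q))

/-- Two linear maps on `A` which agree at the vertices agree on `E`. -/
lemma eq_of_eq_trivial {M : Type*} [AddCommGroup M] [Module k M] {φ ψ : RadSqAlg k V →ₗ[k] M}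
    (h : ∀ i : V, φ (pathClass k (QPath.trivial i)) = ψ (pathClass k (QPath.trivial i)))
    {e : RadSqAlg k V} (he : e ∈ subE k V) : φ e = ψ e := by
  refine LinearMap.eqOn_span' (s := {x | ∃ p : QPath V, p.length = 0 ∧ x = pathClass k p}) ?_ he
  rintro _ ⟨p, hp, rfl⟩
  rw [QPath.eq_trivial hp]
  exact h _

lemma IsReduced.apply_eq_zero {n : ℕ} {F : HochschildCochain k (RadSqAlg k V) n}
    (h : IsReduced mulL mulR vertex F) (x : Fin n → RadSqAlg k V) (i : Fin n)
    (hx : x i ∈ subE k V) : F x = 0 := by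
  have := eq_of_eq_trivial (φ := F.toLinearMap x i) (ψ := 0)
    (fun j => h.vanish _ i j (Function.update_self i _ x)) hx
  rwa [MultilinearMap.toLinearMap_apply, Function.update_eq_self] at this

/-- The difference `x_i - π x_i` lies in `E`, where `F` vanishes, so the arguments can be replaced
one at a time. -/
lemma IsReduced.apply_radProj {n : ℕ} {F : HochschildCochain k (RadSqAlg k V) n}
    (h : IsReduced mulL mulR vertex F) (x : Fin n → RadSqAlg k V) :
    F (fun i => (radProj k V (x i) : RadSqAlg k V)) = F x := by
  classical
  have key : ∀ s : Finset (Fin n),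
      F (s.piecewise (fun i => (radProj k V (x i) : RadSqAlg k V)) x) = F x := by
    intro s
    induction s using Finset.induction_on with
    | empty => rw [Finset.piecewise_empty]
    | insert i s hi ih =>
      rw [Finset.piecewise_insert, ← ih, ← sub_eq_zero]
      nth_rw 2 [← Function.update_eq_self i (s.piecewise _ x)]
      rw [← F.map_update_sub]
      refine h.apply_eq_zero _ i ?_
      rw [Function.update_self, Finset.piecewise_eq_of_notMem _ _ _ hi, ← neg_sub]
      exact neg_mem (sub_radProj_mem _)
  rw [← key Finset.univ, Finset.piecewise_univ]

lemma coe_update {n : ℕ} (x : Fin n → rad k V) (i : Fin n) (t : rad k V) :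
    (fun q => (Function.update x i t q : RadSqAlg k V)) =
      Function.update (fun q => (x q : RadSqAlg k V)) i (t : RadSqAlg k V) :=
  funext fun q => Function.apply_update (fun _ => Subtype.val) x i t q

/-- The cochain factors through `π`, and its restriction to `r` is the reduced cochain. Both sides
of each bimodule condition are linear in the element of `E`, so checking the vertices is enough. -/
lemma IsReduced.exists_comparison {n : ℕ} {F : HochschildCochain k (RadSqAlg k V) n}
    (h : IsReduced mulL mulR vertex F) : ∃ f : ReducedCochain k V n, comparison k V n f = F := by
  refine ⟨⟨F.compLinearMap fun _ => (rad k V).subtype, ⟨?_, ?_, ?_, ?_⟩⟩,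
    MultilinearMap.ext h.apply_radProj⟩
  · intro e he x i j hij
    change F (fun q => (Function.update x i (actR e (x i)) q : RadSqAlg k V)) =
      F (fun q => (Function.update x j (actL e (x j)) q : RadSqAlg k V))
    rw [coe_update, coe_update]
    exact eq_of_eq_trivial
      (φ := (F.toLinearMap (fun q => (x q : RadSqAlg k V)) i) ∘ₗ LinearMap.mulLeft k (x i : RadSqAlg k V))
      (ψ := (F.toLinearMap (fun q => (x q : RadSqAlg k V)) j) ∘ₗ LinearMap.mulRight k (x j : RadSqAlg k V))
      (fun l => h.balanced l (fun q => (x q : RadSqAlg k V)) i j hij) he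
  · intro e he x i hi
    change F (fun q => (Function.update x i (actL e (x i)) q : RadSqAlg k V)) = _
    rw [coe_update]
    exact eq_of_eq_trivial
      (φ := (F.toLinearMap (fun q => (x q : RadSqAlg k V)) i) ∘ₗ LinearMap.mulRight k (x i : RadSqAlg k V))
      (ψ := LinearMap.mulRight k (F fun q => (x q : RadSqAlg k V)))
      (fun l => h.left l (fun q => (x q : RadSqAlg k V)) i hi) he
  · intro e he x i hi
    change F (fun q => (Function.update x i (actR e (x i)) q : RadSqAlg k V)) = _
    rw [coe_update]
    exact eq_of_eq_trivial
      (φ := (F.toLinearMap (fun q => (x q : RadSqAlg k V)) i) ∘ₗ LinearMap.mulLeft k (x i : RadSqAlg k V))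
      (ψ := LinearMap.mulLeft k (F fun q => (x q : RadSqAlg k V)))
      (fun l => h.right l (fun q => (x q : RadSqAlg k V)) i hi) he
  · intro hn e he x
    exact eq_of_eq_trivial (φ := LinearMap.mulRight k (F fun q => (x q : RadSqAlg k V)))
      (ψ := LinearMap.mulLeft k (F fun q => (x q : RadSqAlg k V)))
      (fun l => h.zero hn l (fun q => (x q : RadSqAlg k V))) he

/-- A Hochschild cochain whose differential is reduced is reduced up to a coboundary. -/
lemma exists_comparison_sub_mem_coboundaries {n : ℕ} (F : HochschildCochain k (RadSqAlg k V) n)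
    (g : ReducedCochain k V (n + 1))
    (hF : hochschildD k (RadSqAlg k V) n F = comparison k V (n + 1) g) :
    ∃ f : ReducedCochain k V n,
      F - comparison k V n f ∈ coboundaries (hochschildD k (RadSqAlg k V)) n := by
  have hb : IsBimodule mulL mulR :=
    ⟨fun a b m => mul_assoc a b m, fun a b m => (mul_assoc m a b).symm,
      fun a b m => (mul_assoc a m b).symm, fun m => mul_one m⟩
  have hD : (fun n => bimoduleD mulL mulR n) = hochschildD k (RadSqAlg k V) :=
    funext fun n => LinearMap.ext fun f => bimoduleD_mul_eq_hochschildD n f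
  obtain ⟨h, hh, hr⟩ := exists_isReduced_sub completeOrthogonalIdempotents_trivial n _ mulL mulR hb
    F (by
      rw [bimoduleD_mul_eq_hochschildD, hF]
      exact isReduced_comparison g)
  obtain ⟨f, hf⟩ := hr.exists_comparison
  refine ⟨f, ?_⟩
  rw [hf, sub_sub_cancel, ← hD]
  exact hh

lemma hochschildD_eq_zero_of_mem_coboundaries {n : ℕ} {F : HochschildCochain k (RadSqAlg k V) n}
    (hF : F ∈ coboundaries (hochschildD k (RadSqAlg k V)) n) :
    hochschildD k (RadSqAlg k V) n F = 0 := by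
  cases n with
  | zero => rw [show F = 0 from hF, map_zero]
  | succ n =>
    obtain ⟨G, rfl⟩ := hF
    exact hochschildD_comp_hochschildD n G

variable (k V) in
/-- The map `C^n(Q) → C^n(A, A)`. -/
noncomputable def quiverComparison (n : ℕ) :
    QuiverCochain k V n →ₗ[k] HochschildCochain k (RadSqAlg k V) n :=
  comparison k V n ∘ₗ toReduced k V n

lemma quiverComparison_quiverBracket (n m : ℕ) (x : QuiverCochain k V (n + 1))
    (y : QuiverCochain k V (m + 1)) :
    quiverComparison k V (n + m + 1) (quiverBracket k V n m x y) =
      gerstenhaberBracket k (RadSqAlg k V) n m (quiverComparison k V (n + 1) x)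
        (quiverComparison k V (m + 1) y) :=
  (congrArg (comparison k V (n + m + 1)) (toReduced_quiverBracket n m x y)).trans
    (comparison_reducedBracket n m _ _)

variable [∀ s t : V, Fintype (s ⟶ t)]

lemma quiverComparison_injective (n : ℕ) : Function.Injective (quiverComparison k V n) :=
  (comparison_injective n).comp (toReduced_bijective n).1

/-- This contains both halves of the quasi-isomorphism: `z = 0` gives surjectivity, and a primitive
`F` of the image of `z` gives injectivity. Subtracting a coboundary does not change the
differential, so the image of `quiverD y` is the image of `z`, and the comparison is injective. -/
lemma exists_quiverComparison_sub_mem_coboundaries {n : ℕ}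
    (F : HochschildCochain k (RadSqAlg k V) n) (z : QuiverCochain k V (n + 1))
    (hF : hochschildD k (RadSqAlg k V) n F = quiverComparison k V (n + 1) z) :
    ∃ y : QuiverCochain k V n, quiverD k V n y = z ∧
      F - quiverComparison k V n y ∈ coboundaries (hochschildD k (RadSqAlg k V)) n := by
  obtain ⟨f, hf⟩ := exists_comparison_sub_mem_coboundaries F (toReduced k V (n + 1) z) hF
  obtain ⟨y, rfl⟩ := (toReduced_bijective n).2 f
  refine ⟨y, quiverComparison_injective (n + 1) ?_, hf⟩
  have := hochschildD_eq_zero_of_mem_coboundaries hf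
  rw [map_sub, sub_eq_zero, hF] at this
  exact (comparison_toReduced_quiverD n y).trans this.symm

lemma quiverComparison_cohomology_surjective (n : ℕ) (F : HochschildCochain k (RadSqAlg k V) n)
    (hF : F ∈ cocycles (hochschildD k (RadSqAlg k V)) n) : ∃ z ∈ cocycles (quiverD k V) n,
      F - quiverComparison k V n z ∈ coboundaries (hochschildD k (RadSqAlg k V)) n :=
  exists_quiverComparison_sub_mem_coboundaries F 0
    ((show hochschildD k (RadSqAlg k V) n F = 0 from hF).trans (map_zero _).symm)

lemma quiverComparison_cohomology_injective (n : ℕ) (z : QuiverCochain k V n)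
    (hz : quiverComparison k V n z ∈ coboundaries (hochschildD k (RadSqAlg k V)) n) :
    z ∈ coboundaries (quiverD k V) n := by
  cases n with
  | zero => exact quiverComparison_injective 0 ((show _ = _ from hz).trans (map_zero _).symm)
  | succ n =>
    obtain ⟨F, hF⟩ := hz
    obtain ⟨y, hy, -⟩ := exists_quiverComparison_sub_mem_coboundaries F z hF
    exact ⟨y, hy⟩

end Comparison

end RadSq

/-! ### The main theorem -/

theorem mainTheorem4 (k : Type w) [Field k] (V : Type u) [Quiver.{v + 1} V] [Fintype V]
    [∀ s t : V, Fintype (s ⟶ t)] :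
    -- `C^{*+1}(Q)` with the combinatorial bracket is a graded Lie algebra
    IsGradedLie k (fun n => QuiverCochain k V (n + 1)) (quiverBracket k V) ∧
    -- so is `C^{*+1}_E(r, A)` with the reduced bracket
    IsGradedLie k (fun n => ReducedCochain k V (n + 1)) (reducedBracket k V) ∧
    ∃ Φ : ∀ n : ℕ, QuiverCochain k V n ≃ₗ[k] ReducedCochain k V n,
      -- `Φ (γ, x)` sends the arrows `a_1, …, a_n` to `x` if `γ = a_1 ⋯ a_n`, and else to zero
      (∀ (n : ℕ) (c : basisPairs V n) (a : Fin n → Quiver.Total V),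
        (c.1.1.arrows = List.ofFn a →
          (Φ n (Finsupp.single c 1)).1 (fun i => arrowClass k (a i)) = pathClass k c.1.2) ∧
        (c.1.1.arrows ≠ List.ofFn a →
          (Φ n (Finsupp.single c 1)).1 (fun i => arrowClass k (a i)) = 0)) ∧
      -- `Φ` is an isomorphism of graded Lie algebras
      (∀ (n m : ℕ) (x : QuiverCochain k V (n + 1)) (y : QuiverCochain k V (m + 1)),
        Φ (n + m + 1) (quiverBracket k V n m x y) =
          reducedBracket k V n m (Φ (n + 1) x) (Φ (m + 1) y)) ∧
      -- the comparison with the Hochschild complex is a morphism of complexes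
      (∀ (n : ℕ) (x : QuiverCochain k V n),
        comparison k V (n + 1) (Φ (n + 1) (quiverD k V n x)) =
          hochschildD k (RadSqAlg k V) n (comparison k V n (Φ n x))) ∧
      -- the combinatorial bracket induces a bracket on the cohomology of `C^•(Q)`,
      -- the Gerstenhaber bracket induces one on `HH^{*+1}(A)`, and these are
      -- graded Lie algebras which are identified by the comparison
      ∃ (BQ : ∀ n m : ℕ, Cohomology (quiverD k V) (n + 1) →ₗ[k]
            Cohomology (quiverD k V) (m + 1) →ₗ[k] Cohomology (quiverD k V) (n + m + 1))
        (BH : ∀ n m : ℕ, HH k (RadSqAlg k V) (n + 1) →ₗ[k]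
            HH k (RadSqAlg k V) (m + 1) →ₗ[k] HH k (RadSqAlg k V) (n + m + 1))
        (Ψ : ∀ n : ℕ, Cohomology (quiverD k V) n ≃ₗ[k] HH k (RadSqAlg k V) n),
        IsInducedBracket (quiverD k V) (quiverBracket k V) BQ ∧
        IsInducedBracket (hochschildD k (RadSqAlg k V))
          (gerstenhaberBracket k (RadSqAlg k V)) BH ∧
        IsGradedLie k (fun n => Cohomology (quiverD k V) (n + 1)) BQ ∧
        IsGradedLie k (fun n => HH k (RadSqAlg k V) (n + 1)) BH ∧
        (∀ (n : ℕ) (z : QuiverCochain k V n) (hz : z ∈ cocycles (quiverD k V) n),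
          ∃ hz' : comparison k V n (Φ n z) ∈ cocycles (hochschildD k (RadSqAlg k V)) n,
            Ψ n (cohomologyClass (quiverD k V) n z hz) =
              cohomologyClass (hochschildD k (RadSqAlg k V)) n (comparison k V n (Φ n z)) hz') ∧
        ∀ (n m : ℕ) (x : Cohomology (quiverD k V) (n + 1)) (y : Cohomology (quiverD k V) (m + 1)),
          Ψ (n + m + 1) (BQ n m x y) = BH n m (Ψ (n + 1) x) (Ψ (m + 1) y) := by
  obtain ⟨BH, hBH⟩ := exists_isInducedBracket_gerstenhaberBracket (k := k) (A := RadSqAlg k V)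
  have hd := comparison_toReduced_quiverD (k := k) (V := V)
  -- The bracket on the cohomology of the quiver complex is obtained by pulling the one on `HH` back
  -- along the comparison.
  obtain ⟨BQ, hBQ⟩ := IsInducedBracket.exists_of_quasiIso (φ := quiverComparison k V) hd
    quiverComparison_injective (fun n z _ => quiverComparison_cohomology_injective n z)
    hochschildD_comp_hochschildD quiverComparison_quiverBracket hBH
  obtain ⟨Ψ, hΨ⟩ := exists_cohomologyEquiv (φ := quiverComparison k V) hd
    (fun n z _ => quiverComparison_cohomology_injective n z) quiverComparison_cohomology_surjective
  refine ⟨isGradedLie_quiverBracket, isGradedLie_reducedBracket, reducedEquiv k V, ?_,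
    toReduced_quiverBracket, hd, BQ, BH, Ψ, hBQ, hBH, isGradedLie_quiverBracket.cohomology hBQ,
    isGradedLie_gerstenhaberBracket.cohomology hBH, hΨ,
    IsInducedBracket.map_eq quiverComparison_quiverBracket hBQ hBH hΨ⟩
  intro n c a
  rw [reducedEquiv_single, pairMap_arrowClass, ne_eq, arrows_eq_ofFn_iff]
  exact ⟨fun h => if_pos h, fun h => if_neg h⟩
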